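/- Let $S$ be an infinite set of base elements (urelements), $\hat S=\bigcup_n S_n$ its superstructure ($S_0=S$, $S_{n+1}=S_n\cup\mathcal P(S_n)$), and let $*:\hat S\to\widehat{{}^*S}$ be an enlargement, i.e. a map into the superstructure over ${}^*S\supseteq S$ that fixes the elements of $S$ and satisfies the transfer principle for bounded formulas and the saturation principle. An $\hat S$-small category is a category given by a quadruple $\langle M,s,t,c\rangle$ of elements of $\hat S$ (set of morphisms, source and target maps $M\to M$ with objects identified with their identities, and graph $c\subseteq M^3$ of the composition); its enlargement is $\langle {}^*M,{}^*s,{}^*t,{}^*c\rangle$. An $\hat S$-small triangulated category is an $\hat S$-small category $\mathcal T$ with the graph $P\subseteq M^3$ of an addition of morphisms making it additive, an automorphism $\Sigma$ and a set $\Delta\subseteq M^3$ of triangles $A\to B\to C\to\Sigma A$, satisfying the usual axioms (TR1)–(TR4). 1. If $(\mathcal T,\Sigma,\Delta)$ is an $\hat S$-small triangulated category, then $({}^*\mathcal T,{}^*\Sigma,{}^*\Delta)$ (with the addition ${}^*P$) is a triangulated category. 2. If $F:\mathcal T\to\mathcal T'$ is a functor of $\hat S$-small triangulated categories (additive, $F\Sigma=\Sigma'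 F$, mapping $\Delta$ to $\Delta'$), then ${}^*F:{}^*\mathcal T\to{}^*\mathcal T'$ is a functor of triangulated categories. More generally, if $F$ is additive, $\theta:F\Sigma\cong\Sigma'F$ is a natural isomorphism and $(Ff,Fg,\theta_A\circ Fh)\in\Delta'$ for all $(f,g,h)\in\Delta$ (where $A$ is the source of $f$), then $({}^*F,{}^*\theta)$ has the same properties. 3. Let $\mathcal T$ be an $\hat S$-small triangulated category and $\mathcal D\subset\mathcal T$ a thick subcategory, i.e. a full triangulated subcategory such that $x\oplus y\in\mathrm{Ob}(\mathcal D)$ implies $x\in\mathrm{Ob}(\mathcal D)$. Then ${}^*\mathcal D\subset{}^*\mathcal T$ is thick. A quotient of $\mathcal T$ by $\mathcal D$ is a triangulated category $\mathcal T/\mathcal D$ with a functor of triangulated categories $q:\mathcal T\to\mathcal T/\mathcal D$ (commuting strictly with the translations) that inverts every morphism with a cone in $\mathcal D$ and through which every functor from $\mathcal T$ to a category that inverts these morphisms factors uniquely. There is an $\hat S$-small quotient $q:\mathcal T\to\mathcal T/\mathcal D$, and for every such one, ${}^*q:{}^*\mathcal T\to{}^*(\mathcal T/\mathcal D)$ is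 a quotient of ${}^*\mathcal T$ by ${}^*\mathcal D$. Consequently, for every quotient $p:{}^*\mathcal T\to{}^*\mathcal T/{}^*\mathcal D$ there is exactly one functor $\Phi:{}^*\mathcal T/{}^*\mathcal D\to{}^*(\mathcal T/\mathcal D)$ with $\Phi\circ p={}^*q$, and $\Phi$ is an isomorphism of triangulated categories. -/

import Mathlib

open CategoryTheory CategoryTheory.Limits

universe u

namespace Enlarge

/-! ### Superstructures -/

/-- The stage `S_n` of the superstructure over a set `S` of base elements (urelements):
`S_0 = S` and `S_{n+1} = S ∪ P(S_n)`. Since the stages increase, the latter is the same set as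
`S_n ∪ P(S_n)`. -/
def Level (S : Type u) : ℕ → Type u
  | 0 => S
  | n + 1 => S ⊕ Set (Level S n)

/-- The inclusion `S_n ⊆ S_{n+1}`. -/
def Level.up {S : Type u} : (n : ℕ) → Level S n → Level S (n + 1)
  | 0, s => Sum.inl s
  | _ + 1, Sum.inl s => Sum.inl s
  | n + 1, Sum.inr A => Sum.inr (Level.up n '' A)

/-- `x ∈ S_n` is identified with the same element of `S_{n+1}`. -/
inductive Level.Step {S : Type u} : (Σ n, Level S n) → (Σ n, Level S n) → Prop
  | up (n : ℕ) (x : Level S n) : Level.Step ⟨n, x⟩ ⟨n + 1, Level.up n x⟩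

/-- The superstructure over `S`: the increasing union of the stages `S_n`. -/
def Superstructure (S : Type u) : Type u := Quot (Level.Step (S := S))

namespace Superstructure

variable {S : Type u}

/-- The element of the superstructure given by an element of the stage `S_n`. -/
def mk (n : ℕ) (x : Level S n) : Superstructure S := Quot.mk _ ⟨n, x⟩

theorem mk_up (n : ℕ) (x : Level S n) : mk (n + 1) (Level.up n x) = mk n x :=
  (Quot.sound (Level.Step.up n x)).symm

/-- The elements of an element of a stage; base elements have none. -/
def levelElems : (n : ℕ) → Level S n → Set (Superstructure S)
  | 0, _ => ∅
  | _ + 1, Sum.inl _ => ∅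
  | n + 1, Sum.inr A => mk n '' A

theorem levelElems_up : ∀ (n : ℕ) (x : Level S n),
    levelElems (n + 1) (Level.up n x) = levelElems n x
  | 0, _ => rfl
  | _ + 1, Sum.inl _ => rfl
  | n + 1, Sum.inr A => by
      show mk (n + 1) '' (Level.up n '' A) = mk n '' A
      rw [Set.image_image]
      exact Set.image_congr fun x _ => mk_up n x

/-- The set of elements of an element of the superstructure. -/
def elems : Superstructure S → Set (Superstructure S) :=
  Quot.lift (fun p => levelElems p.1 p.2) (by
    rintro _ _ ⟨n, x⟩
    exact (levelElems_up n x).symm)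

instance : Membership (Superstructure S) (Superstructure S) := ⟨fun X y => y ∈ elems X⟩

/-- A base element, as an element of the superstructure. -/
def atom (s : S) : Superstructure S := mk 0 s

/-- The elements of the superstructure that are sets, i.e. that are not base elements. -/
def IsSet (X : Superstructure S) : Prop := ∀ s : S, X ≠ atom s

/-- The set with elements in `A ⊆ S_n`. -/
def ofLevelSet {n : ℕ} (A : Set (Level S n)) : Superstructure S :=
  mk (n + 1) (show Level S (n + 1) from Sum.inr A)

/-- The empty set. -/
def empty : Superstructure S := ofLevelSet (n := 0) ∅

/-- The base set `S`, as an element of its superstructure. -/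
def base : Superstructure S := ofLevelSet (n := 0) Set.univ

theorem mem_ofLevelSet {n : ℕ} (A : Set (Level S n)) (y : Superstructure S) :
    y ∈ ofLevelSet A ↔ ∃ x ∈ A, mk n x = y := Iff.rfl

/-- The base element that an element of a stage is, if it is one. -/
def levelAtom : (n : ℕ) → Level S n → Option S
  | 0, s => some s
  | _ + 1, Sum.inl s => some s
  | _ + 1, Sum.inr _ => none

theorem levelAtom_up : ∀ (n : ℕ) (x : Level S n),
    levelAtom (n + 1) (Level.up n x) = levelAtom n x
  | 0, _ => rfl
  | _ + 1, Sum.inl _ => rfl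
  | _ + 1, Sum.inr _ => rfl

/-- The base element that an element of the superstructure is, if it is one. -/
def toAtom : Superstructure S → Option S :=
  Quot.lift (fun p => levelAtom p.1 p.2) (by
    rintro _ _ ⟨n, x⟩
    exact (levelAtom_up n x).symm)

theorem isSet_ofLevelSet {n : ℕ} (A : Set (Level S n)) : IsSet (ofLevelSet A) := by
  intro s h
  have this := congrArg toAtom h
  exact absurd (show none = some s from this) (Option.some_ne_none s).symm

theorem mk_injective : ∀ n : ℕ, Function.Injective (mk (S := S) n) := by
  have key : ∀ (n : ℕ) (x y : Level S n), mk n x = mk n y → levelAtom n x = levelAtom n y := by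
    intro n x y h
    exact congrArg toAtom h
  intro n
  induction n with
  | zero =>
    intro x y h
    exact Option.some.inj (key 0 x y h)
  | succ n ih =>
    intro x y h
    have hk := key _ x y h
    have he : levelElems (n + 1) x = levelElems (n + 1) y := congrArg elems h
    rcases x with s | A <;> rcases y with t | B
    · exact congrArg Sum.inl (Option.some.inj hk)
    · exact absurd (show some s = none from hk) (Option.some_ne_none s)
    · exact absurd (show none = some t from hk) (Option.some_ne_none t).symm
    · exact congrArg Sum.inr (Set.image_injective.mpr ih he)

theorem exists_rep (X : Superstructure S) : ∃ n : ℕ, ∀ k, n ≤ k → ∃ x : Level S k, mk k x = X := by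
  induction X using Quot.ind with
  | mk p =>
    obtain ⟨n, x⟩ := p
    refine ⟨n, fun k hk => ?_⟩
    induction k, hk using Nat.le_induction with
    | base => exact ⟨x, rfl⟩
    | succ k _ ih =>
      obtain ⟨y, hy⟩ := ih
      exact ⟨Level.up k y, (mk_up k y).trans hy⟩

theorem exists_ofLevelSet {X : Superstructure S} (hX : IsSet X) :
    ∃ n : ℕ, ∀ k, n ≤ k → ∃ A : Set (Level S k), ofLevelSet A = X := by
  obtain ⟨n, hn⟩ := exists_rep X
  refine ⟨n, fun k hk => ?_⟩
  obtain ⟨x, hx⟩ := hn (k + 1) (by omega)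
  rcases x with s | A
  · exfalso
    refine hX s (hx.symm.trans ?_)
    clear hx hk hn
    induction k with
    | zero => exact mk_up 0 s
    | succ k ih => exact (mk_up (k + 1) (show Level S (k + 1) from Sum.inl s)).trans ih
  · exact ⟨A, hx⟩

/-- Sets with the same elements are equal. -/
theorem set_ext {X Y : Superstructure S} (hX : IsSet X) (hY : IsSet Y)
    (h : ∀ z, z ∈ X ↔ z ∈ Y) : X = Y := by
  obtain ⟨n, hn⟩ := exists_ofLevelSet hX
  obtain ⟨m, hm⟩ := exists_ofLevelSet hY
  obtain ⟨A, rfl⟩ := hn (max n m) (le_max_left _ _)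
  obtain ⟨B, rfl⟩ := hm (max n m) (le_max_right _ _)
  have : mk (max n m) '' A = mk (max n m) '' B := Set.ext h
  rw [Set.image_injective.mpr (mk_injective _) this]

theorem exists_upair (a b : Superstructure S) :
    ∃ X : Superstructure S, IsSet X ∧ ∀ z, z ∈ X ↔ z = a ∨ z = b := by
  obtain ⟨n, hn⟩ := exists_rep a
  obtain ⟨m, hm⟩ := exists_rep b
  obtain ⟨x, rfl⟩ := hn (max n m) (le_max_left _ _)
  obtain ⟨y, rfl⟩ := hm (max n m) (le_max_right _ _)
  refine ⟨ofLevelSet {x, y}, isSet_ofLevelSet _, fun z => ?_⟩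
  rw [mem_ofLevelSet]
  constructor
  · rintro ⟨w, rfl | rfl, rfl⟩
    · exact Or.inl rfl
    · exact Or.inr rfl
  · rintro (rfl | rfl)
    · exact ⟨x, Or.inl rfl, rfl⟩
    · exact ⟨y, Or.inr rfl, rfl⟩

/-- The set `{a, b}`. -/
noncomputable def upair (a b : Superstructure S) : Superstructure S := (exists_upair a b).choose

theorem mem_upair (a b z : Superstructure S) : z ∈ upair a b ↔ z = a ∨ z = b :=
  (exists_upair a b).choose_spec.2 z

theorem isSet_upair (a b : Superstructure S) : IsSet (upair a b) :=
  (exists_upair a b).choose_spec.1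

/-- The ordered pair `⟨a, b⟩ = {a, {a, b}}`. -/
noncomputable def opair (a b : Superstructure S) : Superstructure S := upair a (upair a b)

theorem rank_lt {X y : Superstructure S} (h : y ∈ X) (n : ℕ) (hX : X ∈ Set.range (mk (S := S) n)) :
    ∃ m, m < n ∧ y ∈ Set.range (mk (S := S) m) := by
  obtain ⟨x, rfl⟩ := hX
  change y ∈ levelElems n x at h
  cases n with
  | zero => exact absurd h (Set.notMem_empty y)
  | succ n =>
    rcases x with s | A
    · exact absurd h (Set.notMem_empty y)
    · obtain ⟨z, -, rfl⟩ := h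
      exact ⟨n, Nat.lt_succ_self n, z, rfl⟩

theorem not_mem_mem {a b : Superstructure S} (h₁ : a ∈ b) (h₂ : b ∈ a) : False := by
  obtain ⟨n, hn⟩ := exists_rep a
  obtain ⟨x, hx⟩ := hn n le_rfl
  have key : ∀ n : ℕ, a ∉ Set.range (mk (S := S) n) := by
    intro n
    induction n using Nat.strong_induction_on with
    | _ n ih =>
      intro ha
      obtain ⟨m, hm, hb⟩ := rank_lt h₂ n ha
      obtain ⟨k, hk, ha'⟩ := rank_lt h₁ m hb
      exact ih k (hk.trans hm) ha'
  exact key n ⟨x, hx⟩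

theorem opair_inj {a b c d : Superstructure S} (h : opair a b = opair c d) : a = c ∧ b = d := by
  have hac : a = c := by
    have h₁ : a = c ∨ a = upair c d := by
      rw [← mem_upair, show upair c (upair c d) = opair c d from rfl, ← h]
      exact (mem_upair _ _ _).2 (Or.inl rfl)
    have h₂ : c = a ∨ c = upair a b := by
      rw [← mem_upair, show upair a (upair a b) = opair a b from rfl, h]
      exact (mem_upair _ _ _).2 (Or.inl rfl)
    rcases h₁ with h₁ | h₁
    · exact h₁
    · rcases h₂ with h₂ | h₂
      · exact h₂.symm
      · exfalso
        refine not_mem_mem (a := a) (b := c) ?_ ?_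
        · rw [h₂]
          exact (mem_upair _ _ _).2 (Or.inl rfl)
        · rw [h₁]
          exact (mem_upair _ _ _).2 (Or.inl rfl)
  subst hac
  have hp : upair a b = upair a d := by
    have h₁ : upair a b = a ∨ upair a b = upair a d := by
      rw [← mem_upair, show upair a (upair a d) = opair a d from rfl, ← h]
      exact (mem_upair _ _ _).2 (Or.inr rfl)
    rcases h₁ with h₁ | h₁
    · have ha : a ∈ upair a b := (mem_upair _ _ _).2 (Or.inl rfl)
      rw [h₁] at ha
      exact (not_mem_mem ha ha).elim
    · exact h₁
  refine ⟨rfl, ?_⟩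
  have hb : b = a ∨ b = d := by
    rw [← mem_upair, ← hp]
    exact (mem_upair _ _ _).2 (Or.inr rfl)
  have hd : d = a ∨ d = b := by
    rw [← mem_upair, hp]
    exact (mem_upair _ _ _).2 (Or.inr rfl)
  rcases hb with rfl | hb
  · rcases hd with hd | hd <;> exact hd.symm
  · exact hb

/-- `⟨a, b, c⟩ = ⟨⟨a, b⟩, c⟩`. -/
noncomputable def triple (a b c : Superstructure S) : Superstructure S := opair (opair a b) c

open Classical in
/-- `f ∠ x`: the only `y` with `⟨x, y⟩ ∈ f` if there is exactly one, and `∅` otherwise. -/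
noncomputable def app (f x : Superstructure S) : Superstructure S :=
  if h : ∃! y, opair x y ∈ f then h.choose else empty

theorem app_eq {f x y : Superstructure S} (h : ∃! y, opair x y ∈ f) (hy : opair x y ∈ f) :
    app f x = y := by
  rw [app, dif_pos h]
  exact h.unique h.choose_spec.1 hy

/-- `f` is (the graph of) a map from the set `A` to the set `B`. -/
structure IsFun (f A B : Superstructure S) : Prop where
  isSet : IsSet f
  sub : ∀ z ∈ f, ∃ a ∈ A, ∃ b ∈ B, z = opair a b
  existsUnique : ∀ a ∈ A, ∃! b, opair a b ∈ f

/-- `R` is a subset of `A × A × A`. -/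
def IsTernary (R A : Superstructure S) : Prop :=
  IsSet R ∧ ∀ z ∈ R, ∃ a ∈ A, ∃ b ∈ A, ∃ c ∈ A, z = triple a b c

end Superstructure

open Superstructure

/-! ### Formulas and enlargements -/

/-- Terms with constants in `X` and `n` free variables. -/
inductive STerm (X : Type u) (n : ℕ) : Type u
  | const : X → STerm X n
  | var : Fin n → STerm X n
  | pair : STerm X n → STerm X n → STerm X n
  | app : STerm X n → STerm X n → STerm X n

/-- Formulas with constants in `X` and `n` free variables. In `all t ψ`, which is `(∀ x ∈ t) ψ`,
the quantified variable is the last variable of `ψ` and cannot appear in `t`. -/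
inductive SFormula (X : Type u) : ℕ → Type u
  | eq {n : ℕ} : STerm X n → STerm X n → SFormula X n
  | mem {n : ℕ} : STerm X n → STerm X n → SFormula X n
  | not {n : ℕ} : SFormula X n → SFormula X n
  | and {n : ℕ} : SFormula X n → SFormula X n → SFormula X n
  | all {n : ℕ} : STerm X n → SFormula X (n + 1) → SFormula X n

/-- Replace every constant `τ` of a term by `F τ`. -/
def STerm.map {X Y : Type u} (F : X → Y) {n : ℕ} : STerm X n → STerm Y n
  | .const x => .const (F x)
  | .var i => .var i
  | .pair a b => .pair (a.map F) (b.map F)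
  | .app a b => .app (a.map F) (b.map F)

/-- Replace every constant `τ` of a formula by `F τ`. -/
def SFormula.map {X Y : Type u} (F : X → Y) : {n : ℕ} → SFormula X n → SFormula Y n
  | _, .eq a b => .eq (a.map F) (b.map F)
  | _, .mem a b => .mem (a.map F) (b.map F)
  | _, .not φ => .not (φ.map F)
  | _, .and φ ψ => .and (φ.map F) (ψ.map F)
  | _, .all t ψ => .all (t.map F) (ψ.map F)

/-- The value of a term. -/
noncomputable def STerm.eval {S : Type u} {n : ℕ} (v : Fin n → Superstructure S) :
    STerm (Superstructure S) n → Superstructure S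
  | .const x => x
  | .var i => v i
  | .pair a b => opair (a.eval v) (b.eval v)
  | .app a b => Superstructure.app (a.eval v) (b.eval v)

/-- Truth of a formula in the superstructure, for given values of its free variables. -/
def SFormula.Holds {S : Type u} :
    {n : ℕ} → SFormula (Superstructure S) n → (Fin n → Superstructure S) → Prop
  | _, .eq a b, v => a.eval v = b.eval v
  | _, .mem a b, v => a.eval v ∈ b.eval v
  | _, .not φ, v => ¬ φ.Holds v
  | _, .and φ ψ, v => φ.Holds v ∧ ψ.Holds v
  | _, .all t ψ, v => ∀ x ∈ t.eval v, ψ.Holds (Fin.snoc v x)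

/-- An element of the superstructure over `W` is internal (for `star`) if it is an element of
`*A` for some set `A` in the superstructure over `S`. -/
def IsInternal {S W : Type u} (star : Superstructure S → Superstructure W)
    (x : Superstructure W) : Prop :=
  ∃ A : Superstructure S, IsSet A ∧ x ∈ star A

/-- `star` is an enlargement, where `S` is regarded as a subset of `W` through `ι`. -/
structure IsEnlargement {S W : Type u} (ι : S ↪ W)
    (star : Superstructure S → Superstructure W) : Prop where
  star_base : star base = base
  star_atom : ∀ s : S, star (atom s) = atom (ι s)
  transfer : ∀ φ : SFormula (Superstructure S) 0,
    φ.Holds Fin.elim0 ↔ (φ.map star).Holds Fin.elim0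
  saturation : ∀ (I : Type u) (_ : Nonempty I)
    (_ : Cardinal.mk I ≤ Cardinal.mk (Superstructure S)) (U : I → Superstructure W),
    (∀ i, IsSet (U i) ∧ (∃ x, x ∈ U i) ∧ IsInternal star (U i)) →
    (∀ J : Finset I, ∃ x, ∀ j ∈ J, x ∈ U j) → ∃ x, ∀ i, x ∈ U i

/-! ### Small categories inside a superstructure -/

/-- A quadruple `⟨M, s, t, c⟩` of elements of the superstructure: the set of morphisms, source,
target (as identity morphisms) and the composition relation. -/
structure CatData (S : Type u) where
  mor : Superstructure S
  src : Superstructure S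
  tgt : Superstructure S
  comp : Superstructure S

/-- `⟨M, s, t, c⟩` is a category. Here `⟨f, g, h⟩ ∈ c` means `f ∘ g = h`. -/
structure CatData.IsCat {S : Type u} (C : CatData S) : Prop where
  isSet_mor : IsSet C.mor
  isFun_src : IsFun C.src C.mor C.mor
  isFun_tgt : IsFun C.tgt C.mor C.mor
  comp_sub : IsTernary C.comp C.mor
  src_src : ∀ f ∈ C.mor, app C.src (app C.src f) = app C.src f
  tgt_src : ∀ f ∈ C.mor, app C.tgt (app C.src f) = app C.src f
  src_tgt : ∀ f ∈ C.mor, app C.src (app C.tgt f) = app C.tgt f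
  tgt_tgt : ∀ f ∈ C.mor, app C.tgt (app C.tgt f) = app C.tgt f
  comp_ends : ∀ f ∈ C.mor, ∀ g ∈ C.mor, ∀ h ∈ C.mor, triple f g h ∈ C.comp →
    app C.src f = app C.tgt g ∧ app C.tgt f = app C.tgt h ∧ app C.src g = app C.src h
  comp_existsUnique : ∀ f ∈ C.mor, ∀ g ∈ C.mor, app C.src f = app C.tgt g →
    ∃! h, h ∈ C.mor ∧ triple f g h ∈ C.comp
  comp_src : ∀ f ∈ C.mor, triple f (app C.src f) f ∈ C.comp
  tgt_comp : ∀ f ∈ C.mor, triple (app C.tgt f) f f ∈ C.comp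
  comp_assoc : ∀ f₁ ∈ C.mor, ∀ f₂ ∈ C.mor, ∀ f₃ ∈ C.mor, ∀ f₁₂ ∈ C.mor, ∀ f₂₃ ∈ C.mor,
    ∀ f₁₂₃ ∈ C.mor, triple f₁ f₂ f₁₂ ∈ C.comp → triple f₁₂ f₃ f₁₂₃ ∈ C.comp →
    triple f₂ f₃ f₂₃ ∈ C.comp → triple f₁ f₂₃ f₁₂₃ ∈ C.comp

/-- The objects of a category: its identity morphisms, i.e. the `x ∈ M` with `s x = x`
(equivalently, the elements of `s(M) = t(M)`). -/
def CatData.IsCat.Obj {S : Type u} {C : CatData S} (_ : C.IsCat) : Type u :=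
  {x : Superstructure S // x ∈ C.mor ∧ app C.src x = x}

/-- The morphisms `X ⟶ Y`: the `f ∈ M` with `s f = X` and `t f = Y`. -/
def CatData.Hom {S : Type u} (C : CatData S) (X Y : Superstructure S) : Type u :=
  {f : Superstructure S // f ∈ C.mor ∧ app C.src f = X ∧ app C.tgt f = Y}


theorem app_mem {S : Type u} {F A B x : Superstructure S} (hF : IsFun F A B) (hx : x ∈ A) :
    app F x ∈ B := by
  obtain ⟨y, hy, -⟩ := hF.existsUnique x hx
  rw [app_eq (hF.existsUnique x hx) hy]
  obtain ⟨a, -, b, hb, e⟩ := hF.sub _ hy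
  rwa [(opair_inj e).2]

/-- The composite `f ∘ g` is `c ∠ ⟨f, g⟩`. -/
theorem CatData.IsCat.comp_spec {S : Type u} {C : CatData S} (hC : C.IsCat)
    {f g : Superstructure S} (hf : f ∈ C.mor) (hg : g ∈ C.mor) (hfg : app C.src f = app C.tgt g) :
    app C.comp (opair f g) ∈ C.mor ∧ triple f g (app C.comp (opair f g)) ∈ C.comp := by
  obtain ⟨k, ⟨hk, hk'⟩, hu⟩ := hC.comp_existsUnique f hf g hg hfg
  have e : app C.comp (opair f g) = k := by
    refine app_eq ⟨k, hk', fun y hy => hu y ⟨?_, hy⟩⟩ hk'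
    obtain ⟨a, -, b, -, c, hc, e⟩ := hC.comp_sub.2 _ hy
    rwa [(opair_inj e).2]
  rw [e]
  exact ⟨hk, hk'⟩

theorem CatData.IsCat.comp_eq {S : Type u} {C : CatData S} (hC : C.IsCat)
    {f g k : Superstructure S} (h : triple f g k ∈ C.comp) : app C.comp (opair f g) = k := by
  obtain ⟨a, ha, b, hb, c, hc, e⟩ := hC.comp_sub.2 _ h
  obtain ⟨e₁, rfl⟩ := opair_inj e
  obtain ⟨rfl, rfl⟩ := opair_inj e₁
  have hfg := (hC.comp_ends _ ha _ hb _ hc h).1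
  have := hC.comp_spec ha hb hfg
  exact (hC.comp_existsUnique _ ha _ hb hfg).unique this ⟨hc, h⟩

/-- The category, in the usual sense, of a category inside the superstructure. -/
noncomputable instance {S : Type u} {C : CatData S} (hC : C.IsCat) : Category.{u} hC.Obj where
  Hom X Y := C.Hom X.1 Y.1
  id X := ⟨X.1, X.2.1, X.2.2, by rw [← X.2.2, hC.tgt_src _ X.2.1]⟩
  comp {X Y Z} f g := ⟨app C.comp (opair g.1 f.1), by
    have hs := hC.comp_spec g.2.1 f.2.1 (g.2.2.1.trans f.2.2.2.symm)
    have he := hC.comp_ends _ g.2.1 _ f.2.1 _ hs.1 hs.2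
    exact ⟨hs.1, he.2.2.symm.trans f.2.2.1, he.2.1.symm.trans g.2.2.2⟩⟩
  id_comp {X Y} f := Subtype.ext (hC.comp_eq (by
    have := hC.comp_src _ f.2.1
    rwa [f.2.2.1] at this))
  comp_id {X Y} f := Subtype.ext (hC.comp_eq (by
    have := hC.tgt_comp _ f.2.1
    rwa [f.2.2.2] at this))
  assoc {X Y Z V} f g k := Subtype.ext (by
    have h₁ := hC.comp_spec g.2.1 f.2.1 (g.2.2.1.trans f.2.2.2.symm)
    have h₂ := hC.comp_spec k.2.1 g.2.1 (k.2.2.1.trans g.2.2.2.symm)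
    have e₂ := hC.comp_ends _ k.2.1 _ g.2.1 _ h₂.1 h₂.2
    have h₃ := hC.comp_spec h₂.1 f.2.1
      ((e₂.2.2.symm.trans g.2.2.1).trans f.2.2.2.symm)
    exact hC.comp_eq (hC.comp_assoc _ k.2.1 _ g.2.1 _ f.2.1 _ h₂.1 _ h₁.1 _ h₃.1
      h₂.2 h₃.2 h₁.2))

/-- `F` is a functor from `C` to `D`: a map of the sets of morphisms that respects source, target
and composition. -/
structure IsFunctor {S : Type u} (C D : CatData S) (F : Superstructure S) : Prop where
  isFun : IsFun F C.mor D.mor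
  map_src : ∀ f ∈ C.mor, app F (app C.src f) = app D.src (app F f)
  map_tgt : ∀ f ∈ C.mor, app F (app C.tgt f) = app D.tgt (app F f)
  map_comp : ∀ f ∈ C.mor, ∀ g ∈ C.mor, ∀ h ∈ C.mor, triple f g h ∈ C.comp →
    triple (app F f) (app F g) (app F h) ∈ D.comp

/-- The functor, in the usual sense, of a functor inside the superstructure. -/
noncomputable def IsFunctor.functor {S : Type u} {C D : CatData S} {F : Superstructure S}
    (hF : IsFunctor C D F) (hC : C.IsCat) (hD : D.IsCat) : hC.Obj ⥤ hD.Obj where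
  obj X := ⟨app F X.1, app_mem hF.isFun X.2.1, by rw [← hF.map_src _ X.2.1, X.2.2]⟩
  map f := ⟨app F f.1, app_mem hF.isFun f.2.1, by rw [← hF.map_src _ f.2.1, f.2.2.1],
    by rw [← hF.map_tgt _ f.2.1, f.2.2.2]⟩
  map_id _ := rfl
  map_comp {X Y Z} f g := Subtype.ext (hD.comp_eq (by
    have hs := hC.comp_spec g.2.1 f.2.1 (g.2.2.1.trans f.2.2.2.symm)
    exact hF.map_comp _ g.2.1 _ f.2.1 _ hs.1 hs.2)).symm

/-- The quadruple `⟨*M, *s, *t, *c⟩`. -/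
def CatData.enlarge {S W : Type u} (star : Superstructure S → Superstructure W) (C : CatData S) :
    CatData W :=
  ⟨star C.mor, star C.src, star C.tgt, star C.comp⟩

/-! ### Triangulated categories -/

/-- A small category with a translation functor `Σ` and a class of triangles
`X ⟶ Y ⟶ Z ⟶ Σ X`. -/
structure Triangles (C : Type u) [Category.{u} C] where
  shift : C ⥤ C
  dist : ∀ ⦃X Y Z : C⦄, (X ⟶ Y) → (Y ⟶ Z) → (Z ⟶ shift.obj X) → Prop

/-- The axioms of a triangulated category: `C` is additive, the translation functor is an
automorphism, and the class of (distinguished) triangles satisfies Verdier's axioms. -/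
structure Triangles.IsTriangulated {C : Type u} [Category.{u} C] [Preadditive C]
    (T : Triangles C) : Prop where
  hasZeroObject : HasZeroObject C
  hasFiniteCoproducts : HasFiniteCoproducts C
  shift_automorphism : ∃ G : C ⥤ C, T.shift ⋙ G = 𝟭 C ∧ G ⋙ T.shift = 𝟭 C
  dist_of_iso : ∀ ⦃X Y Z X' Y' Z' : C⦄ (f : X ⟶ Y) (g : Y ⟶ Z) (h : Z ⟶ T.shift.obj X)
    (f' : X' ⟶ Y') (g' : Y' ⟶ Z') (h' : Z' ⟶ T.shift.obj X') (a : X ≅ X') (b : Y ≅ Y')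
    (c : Z ≅ Z'), f ≫ b.hom = a.hom ≫ f' → g ≫ c.hom = b.hom ≫ g' →
    h ≫ T.shift.map a.hom = c.hom ≫ h' → T.dist f g h → T.dist f' g' h'
  dist_id : ∀ (X Z : C), IsZero Z → ∀ (g : X ⟶ Z) (h : Z ⟶ T.shift.obj X), T.dist (𝟙 X) g h
  exists_dist : ∀ ⦃X Y : C⦄ (f : X ⟶ Y), ∃ (Z : C) (g : Y ⟶ Z) (h : Z ⟶ T.shift.obj X),
    T.dist f g h
  rotate : ∀ ⦃X Y Z : C⦄ (f : X ⟶ Y) (g : Y ⟶ Z) (h : Z ⟶ T.shift.obj X),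
    T.dist f g h ↔ T.dist g h (-T.shift.map f)
  complete : ∀ ⦃X Y Z X' Y' Z' : C⦄ (f : X ⟶ Y) (g : Y ⟶ Z) (h : Z ⟶ T.shift.obj X)
    (f' : X' ⟶ Y') (g' : Y' ⟶ Z') (h' : Z' ⟶ T.shift.obj X') (a : X ⟶ X') (b : Y ⟶ Y'),
    T.dist f g h → T.dist f' g' h' → f ≫ b = a ≫ f' →
    ∃ c : Z ⟶ Z', g ≫ c = b ≫ g' ∧ h ≫ T.shift.map a = c ≫ h'
  octahedron : ∀ ⦃X Y Z A B E : C⦄ (f : X ⟶ Y) (f₁ : Y ⟶ A) (f₂ : A ⟶ T.shift.obj X)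
    (g : Y ⟶ Z) (g₁ : Z ⟶ B) (g₂ : B ⟶ T.shift.obj Y)
    (k₁ : Z ⟶ E) (k₂ : E ⟶ T.shift.obj X),
    T.dist f f₁ f₂ → T.dist g g₁ g₂ → T.dist (f ≫ g) k₁ k₂ →
    ∃ (u : A ⟶ E) (v : E ⟶ B), T.dist u v (g₂ ≫ T.shift.map f₁) ∧
      f₁ ≫ u = g ≫ k₁ ∧ u ≫ k₂ = f₂ ∧ k₁ ≫ v = g₁ ∧ v ≫ g₂ = k₂ ≫ T.shift.map f

/-- A small triangulated category. -/
structure TriCat : Type (u + 1) where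
  Obj : Type u
  [category : Category.{u} Obj]
  [preadditive : Preadditive Obj]
  tri : Triangles Obj
  isTriangulated : tri.IsTriangulated

attribute [instance] TriCat.category TriCat.preadditive

/-- The pair `(F, θ)` of a functor and a natural isomorphism `F Σ ≅ Σ F` is a functor of
triangulated categories. -/
structure IsTriangulatedFunctor {T T' : TriCat.{u}} (F : T.Obj ⥤ T'.Obj)
    (θ : T.tri.shift ⋙ F ≅ F ⋙ T'.tri.shift) : Prop where
  additive : F.Additive
  map_dist : ∀ ⦃X Y Z : T.Obj⦄ (f : X ⟶ Y) (g : Y ⟶ Z) (h : Z ⟶ T.tri.shift.obj X),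
    T.tri.dist f g h → T'.tri.dist (F.map f) (F.map g) (F.map h ≫ θ.hom.app X)

/-- A functor of triangulated categories that strictly commutes with the translations. -/
def IsStrictTriangulatedFunctor {T T' : TriCat.{u}} (F : T.Obj ⥤ T'.Obj) : Prop :=
  ∃ e : T.tri.shift ⋙ F = F ⋙ T'.tri.shift, IsTriangulatedFunctor F (eqToIso e)

/-- An isomorphism of triangulated categories. -/
def IsTriangulatedIso {T T' : TriCat.{u}} (F : T.Obj ⥤ T'.Obj) : Prop :=
  IsStrictTriangulatedFunctor F ∧
    ∃ G : T'.Obj ⥤ T.Obj, IsStrictTriangulatedFunctor G ∧ F ⋙ G = 𝟭 _ ∧ G ⋙ F = 𝟭 _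

/-- The morphisms of `T` that have a cone in `D`. -/
def TriCat.coneIn (T : TriCat.{u}) (D : ObjectProperty T.Obj) : MorphismProperty T.Obj :=
  fun X Y f => ∃ (Z : T.Obj) (g : Y ⟶ Z) (h : Z ⟶ T.tri.shift.obj X), T.tri.dist f g h ∧ D Z

/-- `q : T ⥤ Q` is the quotient `T / D` of `T` by the full triangulated subcategory on `D`: a
triangulated category with a functor of triangulated categories from `T` that is the localization
of `T` at the morphisms with cone in `D`. -/
structure IsVerdierQuotient (T : TriCat.{u}) (D : ObjectProperty T.Obj) (Q : TriCat.{u})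
    (q : T.Obj ⥤ Q.Obj) : Prop where
  isTriangulated : IsStrictTriangulatedFunctor q
  inverts : (T.coneIn D).IsInvertedBy q
  existsUnique_lift : ∀ (E : Type u) [Category.{u} E] (G : T.Obj ⥤ E),
    (T.coneIn D).IsInvertedBy G → ∃! G' : Q.Obj ⥤ E, q ⋙ G' = G

/-! ### Triangulated categories inside a superstructure -/

/-- `(T, Σ, Δ)`, where `T` comes with the graph `P` of the addition of morphisms. -/
structure TriData (S : Type u) extends CatData S where
  add : Superstructure S
  shift : Superstructure S
  dist : Superstructure S

/-- The enlargement `(*T, *Σ, *Δ)`. -/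
def TriData.enlarge {S W : Type u} (star : Superstructure S → Superstructure W) (T : TriData S) :
    TriData W :=
  ⟨T.toCatData.enlarge star, star T.add, star T.shift, star T.dist⟩

/-- The translation functor and the class of triangles, in the usual sense. -/
noncomputable def TriData.triangles {S : Type u} (T : TriData S) (hC : T.IsCat)
    (hs : IsFunctor T.toCatData T.toCatData T.shift) : Triangles hC.Obj where
  shift := hs.functor hC hC
  dist _ _ _ f g h := triple f.1 g.1 h.1 ∈ T.dist

/-- `(T, Σ, Δ)` is a triangulated category inside the superstructure: `P` makes `T` an additive
category, `Σ` is an automorphism, and `Δ` is a set of triangles that satisfies the axioms. -/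
structure TriData.IsTriangulated {S : Type u} (T : TriData S) : Prop where
  isCat : T.IsCat
  add_sub : IsTernary T.add T.mor
  isFunctor_shift : IsFunctor T.toCatData T.toCatData T.shift
  dist_sub : IsTernary T.dist T.mor
  dist_triangle : ∀ f ∈ T.mor, ∀ g ∈ T.mor, ∀ h ∈ T.mor, triple f g h ∈ T.dist →
    app T.tgt f = app T.src g ∧ app T.tgt g = app T.src h ∧
      app T.tgt h = app T.shift (app T.src f)
  exists_preadditive : ∃ _ : Preadditive isCat.Obj,
    (∀ (X Y : isCat.Obj) (f g k : X ⟶ Y), triple f.1 g.1 k.1 ∈ T.add ↔ f + g = k) ∧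
      (T.triangles isCat isFunctor_shift).IsTriangulated

/-- The triangulated category in the usual sense. Its addition of morphisms is given by `P`. -/
noncomputable def TriData.IsTriangulated.triCat {S : Type u} {T : TriData S}
    (hT : T.IsTriangulated) : TriCat.{u} :=
  letI := hT.exists_preadditive.choose
  { Obj := hT.isCat.Obj
    tri := T.triangles hT.isCat hT.isFunctor_shift
    isTriangulated := hT.exists_preadditive.choose_spec.2 }

/-- The functor between the triangulated categories in the usual sense. -/
noncomputable def IsFunctor.triFunctor {S : Type u} {T T' : TriData S} {F : Superstructure S}
    (hF : IsFunctor T.toCatData T'.toCatData F) (hT : T.IsTriangulated) (hT' : T'.IsTriangulated) :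
    hT.triCat.Obj ⥤ hT'.triCat.Obj :=
  hF.functor hT.isCat hT'.isCat

/-- `F : T → T'` is a functor of triangulated categories that strictly commutes with the
translations. -/
def IsStrictTriFunctor {S : Type u} (T T' : TriData S) (F : Superstructure S) : Prop :=
  ∃ (hT : T.IsTriangulated) (hT' : T'.IsTriangulated)
    (hF : IsFunctor T.toCatData T'.toCatData F), IsStrictTriangulatedFunctor (hF.triFunctor hT hT')

/-- `(F, θ)` is a functor of triangulated categories from `T` to `T'`, where `θ ∠ X` is the
component at `X` of the natural isomorphism `F Σ ≅ Σ F`. -/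
def IsTriFunctor {S : Type u} (T T' : TriData S) (F θ : Superstructure S) : Prop :=
  ∃ (hT : T.IsTriangulated) (hT' : T'.IsTriangulated)
    (hF : IsFunctor T.toCatData T'.toCatData F)
    (τ : hT.triCat.tri.shift ⋙ hF.triFunctor hT hT' ≅
      hF.triFunctor hT hT' ⋙ hT'.triCat.tri.shift),
    (∀ X : hT.isCat.Obj, (show CatData.Hom _ _ _ from τ.hom.app X).1 = app θ X.1) ∧
      IsTriangulatedFunctor (hF.triFunctor hT hT') τ

/-- `D` is a (full) triangulated subcategory of `T`, with the restricted structure. -/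
structure IsTriangulatedSubcategory {S : Type u} (T D : TriData S) : Prop where
  isTriangulated : T.IsTriangulated
  isTriangulated_sub : D.IsTriangulated
  mor_sub : ∀ f ∈ D.mor, f ∈ T.mor
  src_eq : ∀ f ∈ D.mor, app D.src f = app T.src f
  tgt_eq : ∀ f ∈ D.mor, app D.tgt f = app T.tgt f
  comp_iff : ∀ f ∈ D.mor, ∀ g ∈ D.mor, ∀ h ∈ D.mor, triple f g h ∈ D.comp ↔ triple f g h ∈ T.comp
  full : ∀ f ∈ T.mor, app T.src f ∈ D.mor → app T.tgt f ∈ D.mor → f ∈ D.mor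
  add_iff : ∀ f ∈ D.mor, ∀ g ∈ D.mor, ∀ h ∈ D.mor, app T.src f = app T.src g →
    app T.tgt f = app T.tgt g → app T.src f = app T.src h → app T.tgt f = app T.tgt h →
    (triple f g h ∈ D.add ↔ triple f g h ∈ T.add)
  shift_eq : ∀ f ∈ D.mor, app D.shift f = app T.shift f
  dist_iff : ∀ f ∈ D.mor, ∀ g ∈ D.mor, ∀ h ∈ D.mor, triple f g h ∈ D.dist ↔ triple f g h ∈ T.dist

/-- The objects of `T` that lie in `D`. -/
def TriData.objectsOf {S : Type u} {T : TriData S} (hT : T.IsTriangulated) (D : TriData S) :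
    ObjectProperty hT.triCat.Obj :=
  fun X : hT.isCat.Obj => X.1 ∈ D.mor

/-- `D` is a thick subcategory of `T`: if a direct sum `Z` of `X` and `Y` lies in `D`, so does
`X`. -/
structure IsThick {S : Type u} (T D : TriData S) : Prop extends IsTriangulatedSubcategory T D where
  thick : ∀ (X Y Z : isTriangulated.triCat.Obj) (i : X ⟶ Z) (j : Y ⟶ Z),
    Nonempty (IsColimit (BinaryCofan.mk i j)) →
    TriData.objectsOf isTriangulated D Z → TriData.objectsOf isTriangulated D X

/-- `Q`, with the functor `q : T → Q`, is the quotient `T / D` by the thick subcategory `D`. -/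
def IsQuotient {S : Type u} (T D Q : TriData S) (q : Superstructure S) : Prop :=
  ∃ (hD : IsThick T D) (hQ : Q.IsTriangulated) (hq : IsFunctor T.toCatData Q.toCatData q),
    IsVerdierQuotient hD.isTriangulated.triCat (TriData.objectsOf hD.isTriangulated D) hQ.triCat
      (hq.triFunctor hD.isTriangulated hQ)

/-- For every triangulated category `V` that is a quotient of `T` by `D` (and that need not lie in
the superstructure), with functor `p`, the functor `q : T → Q` induces an isomorphism of
triangulated categories `V ≅ Q` that is compatible with `p` and `q`, and only one functor `V → Q`
is compatible with `p` and `q`. -/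
def IsCanonicallyIsoToQuotient {S : Type u} (T D Q : TriData S) (q : Superstructure S) : Prop :=
  ∃ (hD : IsThick T D) (hQ : Q.IsTriangulated) (hq : IsFunctor T.toCatData Q.toCatData q),
    ∀ (V : TriCat.{u}) (p : hD.isTriangulated.triCat.Obj ⥤ V.Obj),
      IsVerdierQuotient hD.isTriangulated.triCat (TriData.objectsOf hD.isTriangulated D) V p →
      ∃ Φ : V.Obj ⥤ hQ.triCat.Obj, IsTriangulatedIso Φ ∧
        p ⋙ Φ = hq.triFunctor hD.isTriangulated hQ ∧
        ∀ Ψ : V.Obj ⥤ hQ.triCat.Obj, p ⋙ Ψ = hq.triFunctor hD.isTriangulated hQ → Ψ = Φ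

end Enlarge

open Enlarge

/-!
The axioms of triangulated categories, of their functors, of thick subcategories and of quotients
are shown to be expressible by bounded formulas; the transfer principle then carries them over to
the enlargement.

To avoid writing formulas by hand, `DefTm` and `DefFm` say that a pair of families, one on each side
of `star`, is given by one term or formula and its image under `star`. They are closed under the
logical operations and under quantifiers over objects and over morphisms with given source and
target (`DefFm.forall_obj`, `DefFm.forall_hom`), so that every axiom is broken up mechanically.
`DefFm.transfer` is the transfer principle for such pairs.

Some notions first have to be put into a form without existential quantifiers over structures.
A triangulated category is described by the graph of its addition
(`Triangles.IsBoundedTriangulated`), a functor of triangulated categories by its values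
(`isStrictTriFunctor_iff`, `isTriFunctor_iff`). The essential case is the quotient, whose universal
property refers to all categories. For a thick subcategory the morphisms with cone in it admit a
left calculus of fractions, and then a functor has the strict universal property of the localization
if and only if it inverts these morphisms, is bijective on objects, every morphism in its target is
a left fraction, and morphisms with equal images are equalized by a morphism that is inverted
(`IsFractionLocalization`, `isVerdierQuotient_iff`). This is a bounded statement
(`IsFractionLocalization.enlarge`), which gives `IsQuotient.enlarge`.

For the calculus of fractions and for the triangulated structure on the localization, a strict
triangulated category is made into a pretriangulated category in the sense of Mathlib, with the
powers of the translation functor as shifts. Since the localization is bijective on objects, the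
translation descends to a strict automorphism
(`TriCat.exists_triangles_of_isStrictLocalization`). The uniqueness of quotients,
`IsVerdierQuotient.exists_iso`, follows from the universal property and from the fact that every
triangle of a quotient is isomorphic to the image of a triangle.

A quotient exists inside the superstructure (`IsThick.exists_isQuotient`): morphisms of the
localization are determined by pairs of morphisms, so they embed into a stage of the superstructure,
which is infinite and hence as large as its square. The superstructure contains all relations and
maps between its sets, so the whole structure can be moved there.
-/

/-! ### Definable families and transfer -/

namespace Enlarge

open Superstructure

variable {S W : Type u}

/-- The sequence `v` with `a` put in front of it. -/
@[reducible]
def push {α : Type*} (a : α) (v : ℕ → α) : ℕ → α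
  | 0 => a
  | k + 1 => v k

/-- A context for formulas with `n` free variables: two types of tuples, one on the side of `S`
and one on the side of `W`, together with the values that a tuple gives to the free variables.
The variables are counted backwards: the value of the last one comes first. -/
structure Ctx (star : Superstructure S → Superstructure W) where
  n : ℕ
  Γ : Type u
  Γ' : Type u
  val : Γ → ℕ → Superstructure S
  val' : Γ' → ℕ → Superstructure W

namespace Ctx

variable {star : Superstructure S → Superstructure W}

/-- The context without variables. -/
@[reducible]
def nil (star : Superstructure S → Superstructure W) : Ctx star :=
  ⟨0, PUnit, PUnit, fun _ _ => Superstructure.empty, fun _ _ => Superstructure.empty⟩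

/-- A context extended by a variable whose values are named by `A γ` and `A' γ`. -/
@[reducible]
def ext (c : Ctx star) (A : c.Γ → Type u) (v : ∀ γ, A γ → Superstructure S)
    (A' : c.Γ' → Type u) (v' : ∀ γ, A' γ → Superstructure W) : Ctx star :=
  ⟨c.n + 1, Σ γ, A γ, Σ γ, A' γ, fun p => push (v p.1 p.2) (c.val p.1),
    fun p => push (v' p.1 p.2) (c.val' p.1)⟩

/-- A context extended by a variable for an arbitrary element. -/
abbrev elem (c : Ctx star) : Ctx star :=
  c.ext (fun _ => Superstructure S) (fun _ x => x) (fun _ => Superstructure W) (fun _ x => x)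

/-- The values of the free variables, in the order in which formulas count them. -/
def env (c : Ctx star) (γ : c.Γ) : Fin c.n → Superstructure S :=
  fun i => c.val γ (c.n - 1 - i)

/-- The values of the free variables on the side of `W`. -/
def env' (c : Ctx star) (γ : c.Γ') : Fin c.n → Superstructure W :=
  fun i => c.val' γ (c.n - 1 - i)

end Ctx

/-- Formulas append the value of a quantified variable at the end, contexts put it in front;
counting backwards reconciles the two. -/
theorem snoc_push {α : Type*} (n : ℕ) (v : ℕ → α) (a : α) :
    (Fin.snoc (fun i : Fin n => v (n - 1 - i)) a : Fin (n + 1) → α) =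
      fun i : Fin (n + 1) => push a v (n + 1 - 1 - i) := by
  funext i
  refine Fin.lastCases ?_ (fun i => ?_) i
  · simp [push]
  · have h : n + 1 - 1 - (i.castSucc : ℕ) = (n - 1 - i) + 1 := by
      simp only [Fin.val_castSucc]; omega
    simp only [Fin.snoc_castSucc, h, push]

variable {star : Superstructure S → Superstructure W}

/-- The families `t` and `t'` of elements are the values of one term and of its image under
`star`. -/
def DefTm (c : Ctx star) (t : c.Γ → Superstructure S) (t' : c.Γ' → Superstructure W) : Prop :=
  ∃ τ : STerm (Superstructure S) c.n,
    (∀ γ, τ.eval (c.env γ) = t γ) ∧ ∀ γ, (τ.map star).eval (c.env' γ) = t' γ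

/-- The families `P` and `P'` of propositions are expressed by one bounded formula and by its image
under `star`. -/
def DefFm (c : Ctx star) (P : c.Γ → Prop) (P' : c.Γ' → Prop) : Prop :=
  ∃ φ : SFormula (Superstructure S) c.n,
    (∀ γ, φ.Holds (c.env γ) ↔ P γ) ∧ ∀ γ, (φ.map star).Holds (c.env' γ) ↔ P' γ

/-- A formula in an extended context is the body of a quantifier over the new variable. -/
theorem DefFm.of_ext {c : Ctx star} {A : c.Γ → Type u} {v : ∀ γ, A γ → Superstructure S}
    {A' : c.Γ' → Type u} {v' : ∀ γ, A' γ → Superstructure W} {P : ∀ γ, A γ → Prop}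
    {P' : ∀ γ, A' γ → Prop}
    (h : DefFm (c.ext A v A' v') (fun p => P p.1 p.2) (fun p => P' p.1 p.2)) :
    ∃ φ : SFormula (Superstructure S) (c.n + 1),
      (∀ γ a, φ.Holds (Fin.snoc (c.env γ) (v γ a)) ↔ P γ a) ∧
        ∀ γ a, (φ.map star).Holds (Fin.snoc (c.env' γ) (v' γ a)) ↔ P' γ a := by
  obtain ⟨φ, h₁, h₂⟩ := h
  refine ⟨φ, fun γ a => ?_, fun γ a => ?_⟩
  · exact (iff_of_eq (congrArg (SFormula.Holds (n := c.n + 1) φ) (snoc_push c.n _ _))).trans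
      (h₁ ⟨γ, a⟩)
  · exact (iff_of_eq (congrArg (SFormula.Holds (n := c.n + 1) (φ.map star))
      (snoc_push c.n _ _))).trans (h₂ ⟨γ, a⟩)

/-- The transfer principle for propositions that one bounded formula expresses on both sides. -/
theorem DefFm.transfer {ι : S ↪ W} (hstar : IsEnlargement ι star) {P P' : Prop}
    (h : DefFm (Ctx.nil star) (fun _ => P) (fun _ => P')) : P ↔ P' := by
  obtain ⟨φ, h₁, h₂⟩ := h
  have e : (Ctx.nil star).env ⟨⟩ = Fin.elim0 := funext fun i => i.elim0
  have e' : (Ctx.nil star).env' ⟨⟩ = Fin.elim0 := funext fun i => i.elim0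
  exact ((h₁ ⟨⟩).symm.trans (iff_of_eq (congrArg (SFormula.Holds φ) e))).trans
    ((hstar.transfer φ).trans
      ((iff_of_eq (congrArg (SFormula.Holds (φ.map star)) e'.symm)).trans (h₂ ⟨⟩)))

/-- A term with one more variable, which it does not use. -/
def STerm.weaken {X : Type u} {n : ℕ} : STerm X n → STerm X (n + 1)
  | .const x => .const x
  | .var i => .var i.castSucc
  | .pair a b => .pair a.weaken b.weaken
  | .app a b => .app a.weaken b.weaken

theorem STerm.eval_weaken {n : ℕ} (v : Fin n → Superstructure S) (x : Superstructure S) :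
    ∀ τ : STerm (Superstructure S) n,
      (τ.weaken).eval (Fin.snoc v x : Fin (n + 1) → Superstructure S) = τ.eval v
  | .const _ => rfl
  | .var i => by simp [STerm.weaken, STerm.eval]
  | .pair a b => by simp [STerm.weaken, STerm.eval, eval_weaken v x a, eval_weaken v x b]
  | .app a b => by simp [STerm.weaken, STerm.eval, eval_weaken v x a, eval_weaken v x b]

theorem STerm.map_weaken {X Y : Type u} (F : X → Y) {n : ℕ} :
    ∀ τ : STerm X n, (τ.weaken).map F = (τ.map F).weaken
  | .const _ => rfl
  | .var _ => rfl
  | .pair a b => by simp [STerm.weaken, STerm.map, map_weaken F a, map_weaken F b]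
  | .app a b => by simp [STerm.weaken, STerm.map, map_weaken F a, map_weaken F b]

namespace DefTm

variable {c : Ctx star}

theorem const (a : Superstructure S) : DefTm c (fun _ => a) (fun _ => star a) :=
  ⟨.const a, fun _ => rfl, fun _ => rfl⟩

theorem base {ι : S ↪ W} (hstar : IsEnlargement ι star) :
    DefTm c (fun _ => Superstructure.base) (fun _ => Superstructure.base) :=
  ⟨.const Superstructure.base, fun _ => rfl, fun _ => hstar.star_base⟩

theorem var (k : ℕ) (hk : k < c.n) : DefTm c (fun γ => c.val γ k) (fun γ => c.val' γ k) := by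
  refine ⟨.var ⟨c.n - 1 - k, by omega⟩, fun γ => ?_, fun γ => ?_⟩ <;>
  · simp only [STerm.map, STerm.eval, Ctx.env, Ctx.env']
    congr 1
    omega

theorem pair {a b : c.Γ → Superstructure S} {a' b' : c.Γ' → Superstructure W}
    (ha : DefTm c a a') (hb : DefTm c b b') :
    DefTm c (fun γ => opair (a γ) (b γ)) (fun γ => opair (a' γ) (b' γ)) := by
  obtain ⟨α, h₁, h₂⟩ := ha
  obtain ⟨β, h₃, h₄⟩ := hb
  exact ⟨.pair α β, fun γ => by simp [STerm.eval, h₁, h₃],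
    fun γ => by simp [STerm.map, STerm.eval, h₂, h₄]⟩

theorem triple {a b d : c.Γ → Superstructure S} {a' b' d' : c.Γ' → Superstructure W}
    (ha : DefTm c a a') (hb : DefTm c b b') (hd : DefTm c d d') :
    DefTm c (fun γ => triple (a γ) (b γ) (d γ))
      (fun γ => Superstructure.triple (a' γ) (b' γ) (d' γ)) :=
  (ha.pair hb).pair hd

theorem app {a b : c.Γ → Superstructure S} {a' b' : c.Γ' → Superstructure W}
    (ha : DefTm c a a') (hb : DefTm c b b') :
    DefTm c (fun γ => app (a γ) (b γ)) (fun γ => Superstructure.app (a' γ) (b' γ)) := by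
  obtain ⟨α, h₁, h₂⟩ := ha
  obtain ⟨β, h₃, h₄⟩ := hb
  exact ⟨.app α β, fun γ => by simp [STerm.eval, h₁, h₃],
    fun γ => by simp [STerm.map, STerm.eval, h₂, h₄]⟩

theorem weaken {t : c.Γ → Superstructure S} {t' : c.Γ' → Superstructure W} (h : DefTm c t t')
    (A : c.Γ → Type u) (v : ∀ γ, A γ → Superstructure S) (A' : c.Γ' → Type u)
    (v' : ∀ γ, A' γ → Superstructure W) :
    DefTm (c.ext A v A' v') (fun p => t p.1) (fun p => t' p.1) := by
  obtain ⟨τ, h₁, h₂⟩ := h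
  refine ⟨τ.weaken, fun p => ?_, fun p => ?_⟩
  · exact ((congrArg (fun w => STerm.eval w τ.weaken) (snoc_push c.n _ _)).symm.trans
      (STerm.eval_weaken (c.env p.1) (v p.1 p.2) τ)).trans (h₁ p.1)
  · exact (congrArg (STerm.eval (n := c.n + 1) _) (STerm.map_weaken star τ)).trans
      (((congrArg (fun w => STerm.eval w (τ.map star).weaken) (snoc_push c.n _ _)).symm.trans
        (STerm.eval_weaken (c.env' p.1) (v' p.1 p.2) (τ.map star))).trans (h₂ p.1))

end DefTm

namespace DefFm

variable {c : Ctx star} {P Q : c.Γ → Prop} {P' Q' : c.Γ' → Prop}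

theorem congr (h : DefFm c P P') (e : ∀ γ, P γ ↔ Q γ) (e' : ∀ γ, P' γ ↔ Q' γ) : DefFm c Q Q' := by
  obtain ⟨φ, h₁, h₂⟩ := h
  exact ⟨φ, fun γ => (h₁ γ).trans (e γ), fun γ => (h₂ γ).trans (e' γ)⟩

theorem mem {a b : c.Γ → Superstructure S} {a' b' : c.Γ' → Superstructure W}
    (ha : DefTm c a a') (hb : DefTm c b b') :
    DefFm c (fun γ => a γ ∈ b γ) (fun γ => a' γ ∈ b' γ) := by
  obtain ⟨α, h₁, h₂⟩ := ha
  obtain ⟨β, h₃, h₄⟩ := hb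
  exact ⟨.mem α β, fun γ => by simp [SFormula.Holds, h₁, h₃],
    fun γ => by simp [SFormula.map, SFormula.Holds, h₂, h₄]⟩

theorem eq {a b : c.Γ → Superstructure S} {a' b' : c.Γ' → Superstructure W}
    (ha : DefTm c a a') (hb : DefTm c b b') :
    DefFm c (fun γ => a γ = b γ) (fun γ => a' γ = b' γ) := by
  obtain ⟨α, h₁, h₂⟩ := ha
  obtain ⟨β, h₃, h₄⟩ := hb
  exact ⟨.eq α β, fun γ => by simp [SFormula.Holds, h₁, h₃],
    fun γ => by simp [SFormula.map, SFormula.Holds, h₂, h₄]⟩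

theorem not (h : DefFm c P P') : DefFm c (fun γ => ¬ P γ) (fun γ => ¬ P' γ) := by
  obtain ⟨φ, h₁, h₂⟩ := h
  exact ⟨.not φ, fun γ => not_congr (h₁ γ), fun γ => not_congr (h₂ γ)⟩

theorem and (h : DefFm c P P') (k : DefFm c Q Q') :
    DefFm c (fun γ => P γ ∧ Q γ) (fun γ => P' γ ∧ Q' γ) := by
  obtain ⟨φ, h₁, h₂⟩ := h
  obtain ⟨ψ, h₃, h₄⟩ := k
  exact ⟨.and φ ψ, fun γ => and_congr (h₁ γ) (h₃ γ), fun γ => and_congr (h₂ γ) (h₄ γ)⟩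

theorem imp (h : DefFm c P P') (k : DefFm c Q Q') :
    DefFm c (fun γ => P γ → Q γ) (fun γ => P' γ → Q' γ) :=
  (h.and k.not).not.congr (fun _ => by tauto) (fun _ => by tauto)

theorem iff (h : DefFm c P P') (k : DefFm c Q Q') :
    DefFm c (fun γ => P γ ↔ Q γ) (fun γ => P' γ ↔ Q' γ) :=
  ((h.imp k).and (k.imp h)).congr (fun _ => by tauto) (fun _ => by tauto)

/-- A quantifier over types of names can be expressed if the named elements are those that have a
property expressed by a formula, within a bound given by a term. -/
theorem forall_names {A : c.Γ → Type u} {v : ∀ γ, A γ → Superstructure S} {A' : c.Γ' → Type u}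
    {v' : ∀ γ, A' γ → Superstructure W} {t : c.Γ → Superstructure S} {t' : c.Γ' → Superstructure W}
    {R : ∀ _ : c.Γ, Superstructure S → Prop} {R' : ∀ _ : c.Γ', Superstructure W → Prop}
    {P : ∀ γ, A γ → Prop} {P' : ∀ γ, A' γ → Prop}
    (ht : DefTm c t t') (hR : DefFm c.elem (fun p => R p.1 p.2) (fun p => R' p.1 p.2))
    (hv : ∀ γ x, (x ∈ t γ ∧ R γ x) ↔ ∃ a, v γ a = x)
    (hv' : ∀ γ x, (x ∈ t' γ ∧ R' γ x) ↔ ∃ a, v' γ a = x)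
    (h : DefFm (c.ext A v A' v') (fun p => P p.1 p.2) (fun p => P' p.1 p.2)) :
    DefFm c (fun γ => ∀ a, P γ a) (fun γ => ∀ a, P' γ a) := by
  obtain ⟨τ, t₁, t₂⟩ := ht
  obtain ⟨ρ, r₁, r₂⟩ := hR.of_ext
  obtain ⟨φ, h₁, h₂⟩ := h.of_ext
  refine ⟨.all τ (.not (.and ρ (.not φ))), fun γ => ?_, fun γ => ?_⟩
  · simp only [SFormula.Holds, t₁, r₁ γ, not_and, not_not]
    refine ⟨fun H a => ?_, fun H x hx hr => ?_⟩
    · have hx := (hv γ (v γ a)).2 ⟨a, rfl⟩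
      exact (h₁ γ a).1 (H _ hx.1 hx.2)
    · obtain ⟨a, rfl⟩ := (hv γ x).1 ⟨hx, hr⟩
      exact (h₁ γ a).2 (H a)
  · simp only [SFormula.map, SFormula.Holds, t₂, r₂ γ, not_and, not_not]
    refine ⟨fun H a => ?_, fun H x hx hr => ?_⟩
    · have hx := (hv' γ (v' γ a)).2 ⟨a, rfl⟩
      exact (h₂ γ a).1 (H _ hx.1 hx.2)
    · obtain ⟨a, rfl⟩ := (hv' γ x).1 ⟨hx, hr⟩
      exact (h₂ γ a).2 (H a)

theorem exists_of_forall_not {A : c.Γ → Type u} {A' : c.Γ' → Type u}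
    {P : ∀ γ, A γ → Prop} {P' : ∀ γ, A' γ → Prop}
    (h : DefFm c (fun γ => ∀ a, ¬ P γ a) (fun γ => ∀ a, ¬ P' γ a)) :
    DefFm c (fun γ => ∃ a, P γ a) (fun γ => ∃ a, P' γ a) :=
  h.not.congr (fun _ => by push Not; rfl) (fun _ => by push Not; rfl)

theorem forall_mem {t : c.Γ → Superstructure S} {t' : c.Γ' → Superstructure W}
    {P : ∀ _ : c.Γ, Superstructure S → Prop} {P' : ∀ _ : c.Γ', Superstructure W → Prop}
    (ht : DefTm c t t') (h : DefFm c.elem (fun p => P p.1 p.2) (fun p => P' p.1 p.2)) :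
    DefFm c (fun γ => ∀ x ∈ t γ, P γ x) (fun γ => ∀ x ∈ t' γ, P' γ x) := by
  obtain ⟨τ, t₁, t₂⟩ := ht
  obtain ⟨φ, h₁, h₂⟩ := h.of_ext
  refine ⟨.all τ φ, fun γ => ?_, fun γ => ?_⟩
  · simp only [SFormula.Holds, t₁, h₁ γ]
  · simp only [SFormula.map, SFormula.Holds, t₂, h₂ γ]

theorem exists_mem {t : c.Γ → Superstructure S} {t' : c.Γ' → Superstructure W}
    {P : ∀ _ : c.Γ, Superstructure S → Prop} {P' : ∀ _ : c.Γ', Superstructure W → Prop}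
    (ht : DefTm c t t') (h : DefFm c.elem (fun p => P p.1 p.2) (fun p => P' p.1 p.2)) :
    DefFm c (fun γ => ∃ x ∈ t γ, P γ x) (fun γ => ∃ x ∈ t' γ, P' γ x) :=
  (forall_mem (P := fun γ x => ¬ P γ x) (P' := fun γ x => ¬ P' γ x) ht h.not).not.congr
    (fun _ => by push Not; rfl) (fun _ => by push Not; rfl)

theorem existsUnique_mem {t : c.Γ → Superstructure S} {t' : c.Γ' → Superstructure W}
    {P : ∀ _ : c.Γ, Superstructure S → Prop} {P' : ∀ _ : c.Γ', Superstructure W → Prop}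
    (ht : DefTm c t t') (h : DefFm c.elem (fun p => P p.1 p.2) (fun p => P' p.1 p.2))
    (h₂ : DefFm c.elem.elem (fun p => P p.1.1 p.2) (fun p => P' p.1.1 p.2)) :
    DefFm c (fun γ => ∃! x, x ∈ t γ ∧ P γ x) (fun γ => ∃! x, x ∈ t' γ ∧ P' γ x) := by
  have e : DefFm c.elem.elem (fun p => p.2 = p.1.2) (fun p => p.2 = p.1.2) :=
    eq (DefTm.var (c := c.elem.elem) 0 (by simp)) (DefTm.var (c := c.elem.elem) 1 (by simp))
  have u : DefFm c.elem (fun p => ∀ y ∈ t p.1, P p.1 y → y = p.2)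
      (fun p => ∀ y ∈ t' p.1, P' p.1 y → y = p.2) :=
    forall_mem (c := c.elem) (P := fun p y => P p.1 y → y = p.2)
      (P' := fun p y => P' p.1 y → y = p.2)
      (ht.weaken _ _ _ _) (h₂.imp e)
  refine (exists_mem (P := fun γ x => P γ x ∧ ∀ y ∈ t γ, P γ y → y = x)
    (P' := fun γ x => P' γ x ∧ ∀ y ∈ t' γ, P' γ y → y = x) ht (h.and u)).congr
    (fun γ => ?_) (fun γ => ?_) <;>
  simp only [ExistsUnique, and_assoc, and_imp]

theorem isSet {ι : S ↪ W} (hstar : IsEnlargement ι star) {a : c.Γ → Superstructure S}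
    {a' : c.Γ' → Superstructure W} (ha : DefTm c a a') :
    DefFm c (fun γ => IsSet (a γ)) (fun γ => IsSet (a' γ)) := by
  -- Being a set is not an atomic formula: it means not to lie in the base set, which `star` maps to
  -- the base set.
  have key : ∀ {V : Type u} (x : Superstructure V), ¬ x ∈ base ↔ IsSet x := by
    intro V x
    rw [base, mem_ofLevelSet]
    exact ⟨fun h s e => h ⟨s, trivial, e.symm⟩, fun h ⟨s, _, e⟩ => h s e.symm⟩
  exact ((mem ha (DefTm.base hstar)).not).congr (fun _ => key _) (fun _ => key _)

end DefFm
end Enlarge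

/-! ### Bounded axioms for triangulated categories -/

namespace Enlarge

/-- A ternary relation on the morphisms with given source and target. -/
abbrev HomRel₃ (C : Type u) [Category.{u} C] : Type u :=
  ∀ ⦃X Y : C⦄, (X ⟶ Y) → (X ⟶ Y) → (X ⟶ Y) → Prop

/-- The relation `A f g k` is the graph `f + g = k` of an addition of morphisms that makes `C` a
preadditive category. -/
structure IsAddition {C : Type u} [Category.{u} C] (A : HomRel₃ C) : Prop where
  exists_sum : ∀ (X Y : C) (f g : X ⟶ Y), ∃ k : X ⟶ Y, A f g k
  unique : ∀ (X Y : C) (f g k k' : X ⟶ Y), A f g k → A f g k' → k = k'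
  comm : ∀ (X Y : C) (f g k : X ⟶ Y), A f g k → A g f k
  assoc : ∀ (X Y : C) (f g h a b d : X ⟶ Y), A f g a → A a h b → A g h d → A f d b
  exists_zero : ∀ X Y : C, ∃ z : X ⟶ Y, ∀ f : X ⟶ Y, A z f f ∧ ∃ g : X ⟶ Y, A g f z
  add_comp : ∀ (X Y Z : C) (f g k : X ⟶ Y) (h : Y ⟶ Z), A f g k → A (f ≫ h) (g ≫ h) (k ≫ h)
  comp_add : ∀ (X Y Z : C) (h : X ⟶ Y) (f g k : Y ⟶ Z), A f g k → A (h ≫ f) (h ≫ g) (h ≫ k)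

/-- The preadditive structure with a given graph of the addition. -/
@[reducible]
noncomputable def IsAddition.preadditive {C : Type u} [Category.{u} C] {A : HomRel₃ C}
    (hA : IsAddition A) : Preadditive C where
  homGroup X Y :=
    letI : Add (X ⟶ Y) := ⟨fun f g => (hA.exists_sum X Y f g).choose⟩
    letI : Zero (X ⟶ Y) := ⟨(hA.exists_zero X Y).choose⟩
    letI : Neg (X ⟶ Y) := ⟨fun f => ((hA.exists_zero X Y).choose_spec f).2.choose⟩
    have hs : ∀ f g : X ⟶ Y, A f g (f + g) := fun f g => (hA.exists_sum X Y f g).choose_spec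
    have hu : ∀ {f g k : X ⟶ Y}, A f g k → f + g = k := fun h => hA.unique _ _ _ _ _ _ (hs _ _) h
    have hz : ∀ f : X ⟶ Y, 0 + f = f := fun f => hu ((hA.exists_zero X Y).choose_spec f).1
    have hc : ∀ f g : X ⟶ Y, f + g = g + f := fun f g => hu (hA.comm _ _ _ _ _ (hs g f))
    { add_assoc := fun f g h => (hu (hA.assoc _ _ _ _ _ _ _ _ (hs f g) (hs _ h) (hs g h))).symm
      zero_add := hz
      add_zero := fun f => (hc f 0).trans (hz f)
      nsmul := nsmulRec
      zsmul := zsmulRec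
      neg_add_cancel := fun f => hu ((hA.exists_zero X Y).choose_spec f).2.choose_spec
      add_comm := hc }
  add_comp X Y Z f g h := hA.unique _ _ _ _ _ _
    (hA.add_comp _ _ _ _ _ _ h (hA.exists_sum X Y f g).choose_spec)
    (hA.exists_sum X Z (f ≫ h) (g ≫ h)).choose_spec
  comp_add X Y Z h f g := hA.unique _ _ _ _ _ _
    (hA.comp_add _ _ _ h _ _ _ (hA.exists_sum Y Z f g).choose_spec)
    (hA.exists_sum X Z (h ≫ f) (h ≫ g)).choose_spec

theorem IsAddition.add_iff {C : Type u} [Category.{u} C] {A : HomRel₃ C} (hA : IsAddition A)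
    (X Y : C) (f g k : X ⟶ Y) :
    letI := hA.preadditive
    A f g k ↔ f + g = k :=
  ⟨fun h => hA.unique _ _ _ _ _ _ (hA.exists_sum X Y f g).choose_spec h,
    fun h => h ▸ (hA.exists_sum X Y f g).choose_spec⟩

theorem IsAddition.of_preadditive {C : Type u} [Category.{u} C] [Preadditive C] {A : HomRel₃ C}
    (h : ∀ (X Y : C) (f g k : X ⟶ Y), A f g k ↔ f + g = k) : IsAddition A where
  exists_sum X Y f g := ⟨f + g, (h _ _ _ _ _).2 rfl⟩
  unique X Y f g k k' h₁ h₂ := by rw [← (h _ _ _ _ _).1 h₁, (h _ _ _ _ _).1 h₂]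
  comm X Y f g k h₁ := by rw [h] at h₁ ⊢; rw [add_comm, h₁]
  assoc X Y f g k a b d h₁ h₂ h₃ := by rw [h] at *; rw [← h₃, ← h₂, ← h₁, add_assoc]
  exists_zero X Y := ⟨0, fun f => ⟨(h _ _ _ _ _).2 (zero_add f), -f,
    (h _ _ _ _ _).2 (neg_add_cancel f)⟩⟩
  add_comp X Y Z f g k l h₁ := by rw [h] at *; rw [← h₁, Preadditive.add_comp]
  comp_add X Y Z l f g k h₁ := by rw [h] at *; rw [← h₁, Preadditive.comp_add]

/-- The axioms of a triangulated category in terms of the graph of the addition. All quantifiers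
run over objects and morphisms: isomorphisms are given together with their inverses, zero objects
are those whose only endomorphism is the identity, the automorphism property of the translation
functor is bijectivity on objects and morphisms, and `k = -Σ f` is written as `k + Σ f = z` with
`z + z = z`. -/
structure Triangles.IsBoundedTriangulated {C : Type u} [Category.{u} C] (T : Triangles C)
    (A : HomRel₃ C) : Prop extends IsAddition A where
  exists_zero_obj : ∃ Z : C, ∀ f : Z ⟶ Z, f = 𝟙 Z
  exists_coproduct : ∀ X Y : C, ∃ (Z : C) (i : X ⟶ Z) (j : Y ⟶ Z),
    ∀ (V : C) (f : X ⟶ V) (g : Y ⟶ V), ∃ h : Z ⟶ V, (i ≫ h = f ∧ j ≫ h = g) ∧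
      ∀ k : Z ⟶ V, i ≫ k = f → j ≫ k = g → k = h
  shift_surj : ∀ Y : C, ∃ X : C, T.shift.obj X = Y
  shift_inj : ∀ X Y : C, T.shift.obj X = T.shift.obj Y → X = Y
  shift_full : ∀ (X Y : C) (f : T.shift.obj X ⟶ T.shift.obj Y), ∃ g : X ⟶ Y, T.shift.map g = f
  shift_faithful : ∀ (X Y : C) (f g : X ⟶ Y), T.shift.map f = T.shift.map g → f = g
  dist_of_iso : ∀ (X Y Z X' Y' Z' : C) (f : X ⟶ Y) (g : Y ⟶ Z) (h : Z ⟶ T.shift.obj X)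
    (f' : X' ⟶ Y') (g' : Y' ⟶ Z') (h' : Z' ⟶ T.shift.obj X') (a : X ⟶ X') (a' : X' ⟶ X)
    (b : Y ⟶ Y') (b' : Y' ⟶ Y) (c : Z ⟶ Z') (c' : Z' ⟶ Z),
    a ≫ a' = 𝟙 X → a' ≫ a = 𝟙 X' → b ≫ b' = 𝟙 Y → b' ≫ b = 𝟙 Y' → c ≫ c' = 𝟙 Z → c' ≫ c = 𝟙 Z' →
    f ≫ b = a ≫ f' → g ≫ c = b ≫ g' → h ≫ T.shift.map a = c ≫ h' → T.dist f g h → T.dist f' g' h'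
  dist_id : ∀ X Z : C, (∀ f : Z ⟶ Z, f = 𝟙 Z) → ∀ (g : X ⟶ Z) (h : Z ⟶ T.shift.obj X),
    T.dist (𝟙 X) g h
  exists_dist : ∀ (X Y : C) (f : X ⟶ Y), ∃ (Z : C) (g : Y ⟶ Z) (h : Z ⟶ T.shift.obj X),
    T.dist f g h
  rotate : ∀ (X Y Z : C) (f : X ⟶ Y) (g : Y ⟶ Z) (h : Z ⟶ T.shift.obj X)
    (k z : T.shift.obj X ⟶ T.shift.obj Y), A z z z → A k (T.shift.map f) z →
    (T.dist f g h ↔ T.dist g h k)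
  complete : ∀ (X Y Z X' Y' Z' : C) (f : X ⟶ Y) (g : Y ⟶ Z) (h : Z ⟶ T.shift.obj X)
    (f' : X' ⟶ Y') (g' : Y' ⟶ Z') (h' : Z' ⟶ T.shift.obj X') (a : X ⟶ X') (b : Y ⟶ Y'),
    T.dist f g h → T.dist f' g' h' → f ≫ b = a ≫ f' →
    ∃ c : Z ⟶ Z', g ≫ c = b ≫ g' ∧ h ≫ T.shift.map a = c ≫ h'
  octahedron : ∀ (X Y Z A B E : C) (f : X ⟶ Y) (f₁ : Y ⟶ A) (f₂ : A ⟶ T.shift.obj X)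
    (g : Y ⟶ Z) (g₁ : Z ⟶ B) (g₂ : B ⟶ T.shift.obj Y)
    (k₁ : Z ⟶ E) (k₂ : E ⟶ T.shift.obj X),
    T.dist f f₁ f₂ → T.dist g g₁ g₂ → T.dist (f ≫ g) k₁ k₂ →
    ∃ (u : A ⟶ E) (v : E ⟶ B), T.dist u v (g₂ ≫ T.shift.map f₁) ∧
      f₁ ≫ u = g ≫ k₁ ∧ u ≫ k₂ = f₂ ∧ k₁ ≫ v = g₁ ∧ v ≫ g₂ = k₂ ≫ T.shift.map f

/-- A fully faithful functor that is bijective on objects is an isomorphism of categories. -/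
theorem exists_inverse_functor {C D : Type u} [Category.{u} C] [Category.{u} D] (F : C ⥤ D)
    [F.Full] [F.Faithful] (hF : Function.Bijective F.obj) :
    ∃ G : D ⥤ C, F ⋙ G = 𝟭 C ∧ G ⋙ F = 𝟭 D := by
  let e := Equiv.ofBijective F.obj hF
  have he : ∀ Y, F.obj (e.symm Y) = Y := fun Y => e.apply_symm_apply Y
  let G : D ⥤ C :=
    { obj := e.symm
      map := fun {X Y} f => F.preimage (eqToHom (he X) ≫ f ≫ eqToHom (he Y).symm)
      map_id := fun X => F.map_injective (by simp)
      map_comp := fun f g => F.map_injective (by simp) }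
  have hGF : G ⋙ F = 𝟭 D := CategoryTheory.Functor.ext he fun X Y f => by simp [G]
  refine ⟨G, CategoryTheory.Functor.ext (fun X => e.symm_apply_apply X) fun X Y f => ?_, hGF⟩
  apply F.map_injective
  have h₁ := eqToHom_map F (e.symm_apply_apply X)
  have h₂ := eqToHom_map F (e.symm_apply_apply Y).symm
  refine (F.map_preimage _).trans ?_
  rw [F.map_comp, F.map_comp]
  exact congrArg₂ (· ≫ ·) h₁.symm (congrArg₂ (· ≫ ·) rfl h₂.symm)

theorem isZero_iff_forall_eq_id {C : Type u} [Category.{u} C] [Preadditive C] (Z : C) :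
    IsZero Z ↔ ∀ f : Z ⟶ Z, f = 𝟙 Z :=
  ⟨fun h _ => h.eq_of_src _ _, fun h => (IsZero.iff_id_eq_zero Z).2 (h 0).symm⟩

/-- If `F ⋙ G` and `G ⋙ F` are identities, `F` is an equivalence. -/
theorem isEquivalence_of_inverse {C D : Type u} [Category.{u} C] [Category.{u} D] {F : C ⥤ D}
    {G : D ⥤ C} (h₁ : F ⋙ G = 𝟭 C) (h₂ : G ⋙ F = 𝟭 D) : F.IsEquivalence :=
  (CategoryTheory.Equivalence.mk F G (eqToIso h₁.symm) (eqToIso h₂)).isEquivalence_functor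

theorem hasFiniteCoproducts_of_exists {C : Type u} [Category.{u} C] [HasZeroObject C]
    (h : ∀ X Y : C, ∃ (Z : C) (i : X ⟶ Z) (j : Y ⟶ Z),
    ∀ (V : C) (f : X ⟶ V) (g : Y ⟶ V), ∃ h : Z ⟶ V, (i ≫ h = f ∧ j ≫ h = g) ∧
      ∀ k : Z ⟶ V, i ≫ k = f → j ≫ k = g → k = h) : HasFiniteCoproducts C := by
  have : HasBinaryCoproducts C := by
    refine @hasBinaryCoproducts_of_hasColimit_pair C _ (fun {X Y} => ?_)
    obtain ⟨Z, i, j, hZ⟩ := h X Y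
    choose d hd hu using hZ
    exact ⟨⟨⟨BinaryCofan.mk i j, BinaryCofan.isColimitMk (fun s => d _ s.inl s.inr)
      (fun s => (hd _ _ _).1) (fun s => (hd _ _ _).2) (fun s m h₁ h₂ => hu _ _ _ _ h₁ h₂)⟩⟩⟩
  exact hasFiniteCoproducts_of_has_binary_and_initial

theorem Triangles.IsBoundedTriangulated.isTriangulated {C : Type u} [Category.{u} C]
    {T : Triangles C} {A : HomRel₃ C} (h : T.IsBoundedTriangulated A) :
    letI := h.toIsAddition.preadditive
    T.IsTriangulated := by
  let _ := h.toIsAddition.preadditive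
  have hz : HasZeroObject C := by
    obtain ⟨Z, hZ⟩ := h.exists_zero_obj
    exact ⟨Z, (isZero_iff_forall_eq_id Z).2 hZ⟩
  exact
  { hasZeroObject := hz
    hasFiniteCoproducts := hasFiniteCoproducts_of_exists h.exists_coproduct
    shift_automorphism := by
      have : T.shift.Full := ⟨fun {X Y} f => h.shift_full X Y f⟩
      have : T.shift.Faithful := ⟨fun {X Y} f g e => h.shift_faithful X Y f g e⟩
      exact exists_inverse_functor _ ⟨fun X Y e => h.shift_inj X Y e, h.shift_surj⟩
    dist_of_iso := fun X Y Z X' Y' Z' f g k f' g' k' a b c =>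
      h.dist_of_iso X Y Z X' Y' Z' f g k f' g' k' a.hom a.inv b.hom b.inv c.hom c.inv
        (by simp) (by simp) (by simp) (by simp) (by simp) (by simp)
    dist_id := fun X Z hZ => h.dist_id X Z ((isZero_iff_forall_eq_id Z).1 hZ)
    exists_dist := fun X Y f => h.exists_dist X Y f
    rotate := fun X Y Z f g k => h.rotate X Y Z f g k _ 0
      ((h.toIsAddition.add_iff _ _ _ _ _).2 (add_zero _))
      ((h.toIsAddition.add_iff _ _ _ _ _).2 (neg_add_cancel _))
    complete := h.complete
    octahedron := h.octahedron }

theorem Triangles.IsTriangulated.isBoundedTriangulated {C : Type u} [Category.{u} C]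
    [Preadditive C] {T : Triangles C} (h : T.IsTriangulated) {A : HomRel₃ C}
    (hA : ∀ (X Y : C) (f g k : X ⟶ Y), A f g k ↔ f + g = k) : T.IsBoundedTriangulated A where
  toIsAddition := .of_preadditive hA
  exists_zero_obj := by
    obtain ⟨Z, hZ⟩ := h.hasZeroObject
    exact ⟨Z, (isZero_iff_forall_eq_id Z).1 hZ⟩
  exists_coproduct X Y := by
    have := h.hasFiniteCoproducts
    exact ⟨X ⨿ Y, coprod.inl, coprod.inr, fun V f g =>
      ⟨coprod.desc f g, ⟨coprod.inl_desc f g, coprod.inr_desc f g⟩,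
      fun k h₁ h₂ => coprod.hom_ext (h₁.trans (coprod.inl_desc f g).symm)
        (h₂.trans (coprod.inr_desc f g).symm)⟩⟩
  shift_surj Y := by
    obtain ⟨G, -, h₂⟩ := h.shift_automorphism
    exact ⟨G.obj Y, Functor.congr_obj h₂ Y⟩
  shift_inj X Y e := by
    obtain ⟨G, h₁, -⟩ := h.shift_automorphism
    exact (Functor.congr_obj h₁ X).symm.trans
      ((congrArg G.obj e).trans (Functor.congr_obj h₁ Y))
  shift_full X Y f := by
    obtain ⟨G, h₁, h₂⟩ := h.shift_automorphism
    have := isEquivalence_of_inverse h₁ h₂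
    exact T.shift.map_surjective f
  shift_faithful X Y f g e := by
    obtain ⟨G, h₁, h₂⟩ := h.shift_automorphism
    have := isEquivalence_of_inverse h₁ h₂
    exact T.shift.map_injective e
  dist_of_iso X Y Z X' Y' Z' f g k f' g' k' a a' b b' c c' a₁ a₂ b₁ b₂ c₁ c₂ :=
    h.dist_of_iso f g k f' g' k' ⟨a, a', a₁, a₂⟩ ⟨b, b', b₁, b₂⟩ ⟨c, c', c₁, c₂⟩
  dist_id X Z hZ := h.dist_id X Z ((isZero_iff_forall_eq_id Z).2 hZ)
  exists_dist X Y f := h.exists_dist f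
  rotate X Y Z f g k l z hz hl := by
    have hz' : z = 0 := by simpa using (hA _ _ _ _ _).1 hz
    have hl' : l = -T.shift.map f := by
      rw [hA, hz'] at hl
      exact eq_neg_of_add_eq_zero_left hl
    rw [hl']
    exact h.rotate f g k
  complete := h.complete
  octahedron := h.octahedron

end Enlarge

/-! ### Enlargement of categories, functors and the bounded axioms -/

namespace Enlarge
open Superstructure
variable {S W : Type u} {star : Superstructure S → Superstructure W}

/-- A family that is the value of the `k`-th variable is definable. In proofs by `repeat' first` the
positions `k` are tried in turn; checking `h` and `h'` at reducible transparency makes the wrong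
ones fail fast. -/
theorem DefTm.of_val {c : Ctx star} (k : ℕ) (hk : k < c.n) {t : c.Γ → Superstructure S}
    {t' : c.Γ' → Superstructure W} (h : ∀ γ, c.val γ k = t γ) (h' : ∀ γ, c.val' γ k = t' γ) :
    DefTm c t t' := by
  obtain rfl : (fun γ => c.val γ k) = t := funext h
  obtain rfl : (fun γ => c.val' γ k) = t' := funext h'
  exact DefTm.var k hk

namespace DefFm
variable {c : Ctx star}

theorem isFun {ι : S ↪ W} (hstar : IsEnlargement ι star) (f A B : Superstructure S) :
    DefFm c (fun _ => IsFun f A B) (fun _ => IsFun (star f) (star A) (star B)) := by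
  -- The quantifier over the values of `f` becomes bounded by `B`.
  have e : ∀ {V : Type u} (f A B : Superstructure V),
      (IsSet f ∧ (∀ z ∈ f, ∃ a ∈ A, ∃ b ∈ B, z = opair a b) ∧
        ∀ a ∈ A, ∃! b, b ∈ B ∧ opair a b ∈ f) ↔ IsFun f A B := by
    intro V f A B
    have hB : (∀ z ∈ f, ∃ a ∈ A, ∃ b ∈ B, z = opair a b) → ∀ a b, opair a b ∈ f → b ∈ B := by
      intro h a b hab
      obtain ⟨a', -, b', hb', e⟩ := h _ hab
      rwa [(opair_inj e).2]
    constructor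
    · rintro ⟨h₁, h₂, h₃⟩
      refine ⟨h₁, h₂, fun a ha => ?_⟩
      obtain ⟨b, ⟨-, hb⟩, hu⟩ := h₃ a ha
      exact ⟨b, hb, fun y hy => hu y ⟨hB h₂ a y hy, hy⟩⟩
    · rintro ⟨h₁, h₂, h₃⟩
      refine ⟨h₁, h₂, fun a ha => ?_⟩
      obtain ⟨b, hb, hu⟩ := h₃ a ha
      exact ⟨b, ⟨hB h₂ a b hb, hb⟩, fun y hy => hu y hy.2⟩
  refine DefFm.congr ?_ (fun _ => e _ _ _) (fun _ => e _ _ _)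
  repeat' first
    | (refine DefTm.of_val 0 (Nat.le_add_left _ _) ?_ ?_ <;> intro _ <;> with_reducible rfl)
    | (refine DefTm.of_val 1 (Nat.le_add_left _ _) ?_ ?_ <;> intro _ <;> with_reducible rfl)
    | (refine DefTm.of_val 2 (Nat.le_add_left _ _) ?_ ?_ <;> intro _ <;> with_reducible rfl)
    | apply DefTm.const
    | apply DefFm.isSet hstar
    | apply DefFm.existsUnique_mem
    | apply DefFm.exists_mem
    | apply DefFm.forall_mem
    | apply DefFm.mem
    | apply DefFm.eq
    | apply DefFm.and
    | apply DefTm.pair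

end DefFm

theorem Superstructure.IsFun.enlarge {ι : S ↪ W} (hstar : IsEnlargement ι star)
    {f A B : Superstructure S} (h : IsFun f A B) : IsFun (star f) (star A) (star B) :=
  (DefFm.transfer hstar (DefFm.isFun hstar f A B)).1 h

theorem Superstructure.IsTernary.enlarge {ι : S ↪ W} (hstar : IsEnlargement ι star)
    {R A : Superstructure S} (h : IsTernary R A) : IsTernary (star R) (star A) := by
  refine (DefFm.transfer hstar ?_).1 h
  repeat' first
    | (refine DefTm.of_val 0 (Nat.le_add_left _ _) ?_ ?_ <;> intro _ <;> with_reducible rfl)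
    | (refine DefTm.of_val 1 (Nat.le_add_left _ _) ?_ ?_ <;> intro _ <;> with_reducible rfl)
    | (refine DefTm.of_val 2 (Nat.le_add_left _ _) ?_ ?_ <;> intro _ <;> with_reducible rfl)
    | (refine DefTm.of_val 3 (Nat.le_add_left _ _) ?_ ?_ <;> intro _ <;> with_reducible rfl)
    | apply DefTm.const
    | apply DefFm.isSet hstar
    | apply DefFm.exists_mem
    | apply DefFm.forall_mem
    | apply DefFm.mem
    | apply DefFm.eq
    | apply DefFm.and
    | apply DefTm.triple

theorem CatData.IsCat.enlarge {ι : S ↪ W} (hstar : IsEnlargement ι star) {C : CatData S}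
    (h : C.IsCat) : (C.enlarge star).IsCat := by
  refine ⟨(DefFm.transfer hstar ?_).1 h.isSet_mor, h.isFun_src.enlarge hstar,
    h.isFun_tgt.enlarge hstar, IsTernary.enlarge hstar h.comp_sub,
    (DefFm.transfer hstar ?_).1 h.src_src, (DefFm.transfer hstar ?_).1 h.tgt_src,
    (DefFm.transfer hstar ?_).1 h.src_tgt, (DefFm.transfer hstar ?_).1 h.tgt_tgt,
    (DefFm.transfer hstar ?_).1 h.comp_ends, (DefFm.transfer hstar ?_).1 h.comp_existsUnique,
    (DefFm.transfer hstar ?_).1 h.comp_src, (DefFm.transfer hstar ?_).1 h.tgt_comp,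
    (DefFm.transfer hstar ?_).1 h.comp_assoc⟩
  repeat' first
    | (refine DefTm.of_val 0 (Nat.le_add_left _ _) ?_ ?_ <;> intro _ <;> with_reducible rfl)
    | (refine DefTm.of_val 1 (Nat.le_add_left _ _) ?_ ?_ <;> intro _ <;> with_reducible rfl)
    | (refine DefTm.of_val 2 (Nat.le_add_left _ _) ?_ ?_ <;> intro _ <;> with_reducible rfl)
    | (refine DefTm.of_val 3 (Nat.le_add_left _ _) ?_ ?_ <;> intro _ <;> with_reducible rfl)
    | (refine DefTm.of_val 4 (Nat.le_add_left _ _) ?_ ?_ <;> intro _ <;> with_reducible rfl)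
    | (refine DefTm.of_val 5 (Nat.le_add_left _ _) ?_ ?_ <;> intro _ <;> with_reducible rfl)
    | apply DefTm.const
    | apply DefFm.isSet hstar
    | apply DefFm.existsUnique_mem
    | apply DefFm.exists_mem
    | apply DefFm.forall_mem
    | apply DefFm.mem
    | apply DefFm.eq
    | apply DefFm.and
    | apply DefFm.imp
    | apply DefTm.triple
    | apply DefTm.app

theorem IsFunctor.enlarge {ι : S ↪ W} (hstar : IsEnlargement ι star) {C D : CatData S}
    {F : Superstructure S} (h : IsFunctor C D F) :
    IsFunctor (C.enlarge star) (D.enlarge star) (star F) := by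
  refine ⟨h.isFun.enlarge hstar, (DefFm.transfer hstar ?_).1 h.map_src,
    (DefFm.transfer hstar ?_).1 h.map_tgt, (DefFm.transfer hstar ?_).1 h.map_comp⟩
  repeat' first
    | (refine DefTm.of_val 0 (Nat.le_add_left _ _) ?_ ?_ <;> intro _ <;> with_reducible rfl)
    | (refine DefTm.of_val 1 (Nat.le_add_left _ _) ?_ ?_ <;> intro _ <;> with_reducible rfl)
    | (refine DefTm.of_val 2 (Nat.le_add_left _ _) ?_ ?_ <;> intro _ <;> with_reducible rfl)
    | apply DefTm.const
    | apply DefFm.forall_mem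
    | apply DefFm.mem
    | apply DefFm.eq
    | apply DefFm.imp
    | apply DefTm.triple
    | apply DefTm.app

/-! ### Quantifiers over objects and morphisms -/

section typed
variable {c : Ctx star} {C D : CatData S} {hC : C.IsCat} {hC' : (C.enlarge star).IsCat}
  {hD : D.IsCat} {hD' : (D.enlarge star).IsCat}

namespace DefFm

theorem forall_obj {P : c.Γ → hC.Obj → Prop} {P' : c.Γ' → hC'.Obj → Prop}
    (h : DefFm (c.ext (fun _ => hC.Obj) (fun _ X => X.1) (fun _ => hC'.Obj) (fun _ X => X.1))
      (fun p => P p.1 p.2) (fun p => P' p.1 p.2)) :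
    DefFm c (fun γ => ∀ X : hC.Obj, P γ X) (fun γ => ∀ X : hC'.Obj, P' γ X) := by
  refine forall_names (t := fun _ => C.mor) (t' := fun _ => star C.mor)
    (R := fun _ x => Superstructure.app C.src x = x)
    (R' := fun _ x => Superstructure.app (star C.src) x = x)
    (DefTm.const _) ?_ (fun γ x => ?_) (fun γ x => ?_) h
  · exact DefFm.eq ((DefTm.const _).app (DefTm.of_val 0 (Nat.zero_lt_succ _) (fun _ => rfl)
      (fun _ => rfl))) (DefTm.of_val 0 (Nat.zero_lt_succ _) (fun _ => rfl) (fun _ => rfl))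
  · exact ⟨fun hx => ⟨⟨x, hx⟩, rfl⟩, fun ⟨a, ha⟩ => ha ▸ a.2⟩
  · exact ⟨fun hx => ⟨⟨x, hx⟩, rfl⟩, fun ⟨a, ha⟩ => ha ▸ a.2⟩

theorem exists_obj {P : c.Γ → hC.Obj → Prop} {P' : c.Γ' → hC'.Obj → Prop}
    (h : DefFm (c.ext (fun _ => hC.Obj) (fun _ X => X.1) (fun _ => hC'.Obj) (fun _ X => X.1))
      (fun p => P p.1 p.2) (fun p => P' p.1 p.2)) :
    DefFm c (fun γ => ∃ X : hC.Obj, P γ X) (fun γ => ∃ X : hC'.Obj, P' γ X) :=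
  exists_of_forall_not (forall_obj h.not)

theorem forall_hom {X Y : c.Γ → hC.Obj} {X' Y' : c.Γ' → hC'.Obj} {P : ∀ γ, (X γ ⟶ Y γ) → Prop}
    {P' : ∀ γ, (X' γ ⟶ Y' γ) → Prop}
    (hX : DefTm c (fun γ => (X γ).1) (fun γ => (X' γ).1))
    (hY : DefTm c (fun γ => (Y γ).1) (fun γ => (Y' γ).1))
    (h : DefFm (c.ext (fun γ => (X γ ⟶ Y γ)) (fun _ f => f.1) (fun γ => (X' γ ⟶ Y' γ))
      (fun _ f => f.1)) (fun p => P p.1 p.2) (fun p => P' p.1 p.2)) :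
    DefFm c (fun γ => ∀ f : X γ ⟶ Y γ, P γ f) (fun γ => ∀ f : X' γ ⟶ Y' γ, P' γ f) := by
  refine forall_names (t := fun _ => C.mor) (t' := fun _ => star C.mor)
    (R := fun γ f => Superstructure.app C.src f = (X γ).1 ∧ Superstructure.app C.tgt f = (Y γ).1)
    (R' := fun γ f => Superstructure.app (star C.src) f = (X' γ).1 ∧
      Superstructure.app (star C.tgt) f = (Y' γ).1)
    (DefTm.const _) ?_ (fun γ x => ?_) (fun γ x => ?_) h
  · have h₀ : DefTm c.elem (fun p => p.2) (fun p => p.2) :=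
      DefTm.of_val 0 (Nat.zero_lt_succ _) (fun _ => rfl) (fun _ => rfl)
    exact (eq ((DefTm.const _).app h₀) (hX.weaken _ _ _ _)).and
      (eq ((DefTm.const _).app h₀) (hY.weaken _ _ _ _))
  · exact ⟨fun hx => ⟨⟨x, hx⟩, rfl⟩, fun ⟨a, ha⟩ => ha ▸ a.2⟩
  · exact ⟨fun hx => ⟨⟨x, hx⟩, rfl⟩, fun ⟨a, ha⟩ => ha ▸ a.2⟩

theorem exists_hom {X Y : c.Γ → hC.Obj} {X' Y' : c.Γ' → hC'.Obj} {P : ∀ γ, (X γ ⟶ Y γ) → Prop}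
    {P' : ∀ γ, (X' γ ⟶ Y' γ) → Prop}
    (hX : DefTm c (fun γ => (X γ).1) (fun γ => (X' γ).1))
    (hY : DefTm c (fun γ => (Y γ).1) (fun γ => (Y' γ).1))
    (h : DefFm (c.ext (fun γ => (X γ ⟶ Y γ)) (fun _ f => f.1) (fun γ => (X' γ ⟶ Y' γ))
      (fun _ f => f.1)) (fun p => P p.1 p.2) (fun p => P' p.1 p.2)) :
    DefFm c (fun γ => ∃ f : X γ ⟶ Y γ, P γ f) (fun γ => ∃ f : X' γ ⟶ Y' γ, P' γ f) :=
  exists_of_forall_not (forall_hom hX hY h.not)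

theorem eq_obj {X Y : c.Γ → hC.Obj} {X' Y' : c.Γ' → hC'.Obj}
    (hX : DefTm c (fun γ => (X γ).1) (fun γ => (X' γ).1))
    (hY : DefTm c (fun γ => (Y γ).1) (fun γ => (Y' γ).1)) :
    DefFm c (fun γ => X γ = Y γ) (fun γ => X' γ = Y' γ) :=
  (eq hX hY).congr (fun _ => Subtype.ext_iff.symm) (fun _ => Subtype.ext_iff.symm)

theorem eq_hom {X Y : c.Γ → hC.Obj} {X' Y' : c.Γ' → hC'.Obj} {f g : ∀ γ, X γ ⟶ Y γ}
    {f' g' : ∀ γ, X' γ ⟶ Y' γ} (hf : DefTm c (fun γ => (f γ).1) (fun γ => (f' γ).1))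
    (hg : DefTm c (fun γ => (g γ).1) (fun γ => (g' γ).1)) :
    DefFm c (fun γ => f γ = g γ) (fun γ => f' γ = g' γ) :=
  (eq hf hg).congr (fun _ => Subtype.ext_iff.symm) (fun _ => Subtype.ext_iff.symm)

end DefFm

namespace DefTm

/-- An identity morphism is, as an element of the superstructure, its object. -/
theorem id {X : c.Γ → hC.Obj} {X' : c.Γ' → hC'.Obj}
    (hX : DefTm c (fun γ => (X γ).1) (fun γ => (X' γ).1)) :
    DefTm c (fun γ => Subtype.val (𝟙 (X γ))) (fun γ => Subtype.val (𝟙 (X' γ))) :=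
  hX

theorem comp {X Y Z : c.Γ → hC.Obj} {X' Y' Z' : c.Γ' → hC'.Obj} {f : ∀ γ, X γ ⟶ Y γ}
    {g : ∀ γ, Y γ ⟶ Z γ} {f' : ∀ γ, X' γ ⟶ Y' γ} {g' : ∀ γ, Y' γ ⟶ Z' γ}
    (hf : DefTm c (fun γ => (f γ).1) (fun γ => (f' γ).1))
    (hg : DefTm c (fun γ => (g γ).1) (fun γ => (g' γ).1)) :
    DefTm c (fun γ => Subtype.val (f γ ≫ g γ)) (fun γ => Subtype.val (f' γ ≫ g' γ)) :=
  (DefTm.const C.comp).app (hg.pair hf)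

variable {F : Superstructure S} {hF : IsFunctor C D F}
  {hF' : IsFunctor (C.enlarge star) (D.enlarge star) (star F)}

theorem functor_obj {X : c.Γ → hC.Obj} {X' : c.Γ' → hC'.Obj}
    (hX : DefTm c (fun γ => (X γ).1) (fun γ => (X' γ).1)) :
    DefTm c (fun γ => ((hF.functor hC hD).obj (X γ)).1)
      (fun γ => ((hF'.functor hC' hD').obj (X' γ)).1) :=
  (DefTm.const F).app hX

theorem functor_map {X Y : c.Γ → hC.Obj} {X' Y' : c.Γ' → hC'.Obj} {f : ∀ γ, X γ ⟶ Y γ}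
    {f' : ∀ γ, X' γ ⟶ Y' γ} (hf : DefTm c (fun γ => (f γ).1) (fun γ => (f' γ).1)) :
    DefTm c (fun γ => ((hF.functor hC hD).map (f γ)).1)
      (fun γ => ((hF'.functor hC' hD').map (f' γ)).1) :=
  (DefTm.const F).app hf

end DefTm
end typed

/-- A ternary relation inside the superstructure, as a relation on the morphisms with given source
and target. -/
def CatData.IsCat.rel {C : CatData S} (hC : C.IsCat) (R : Superstructure S) : HomRel₃ hC.Obj :=
  fun _ _ f g k => triple f.1 g.1 k.1 ∈ R

/-- The translation functor and the class of triangles given by two elements of the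
superstructure. -/
noncomputable def CatData.IsCat.triangles {C : CatData S} (hC : C.IsCat) {s : Superstructure S}
    (hs : IsFunctor C C s) (R : Superstructure S) : Triangles hC.Obj where
  shift := hs.functor hC hC
  dist _ _ _ f g h := triple f.1 g.1 h.1 ∈ R

section
variable {C : CatData S} {hC : C.IsCat} {hC' : (C.enlarge star).IsCat} {c : Ctx star}
  {R : Superstructure S}

theorem DefFm.rel {X Y : c.Γ → hC.Obj} {X' Y' : c.Γ' → hC'.Obj} {f g k : ∀ γ, X γ ⟶ Y γ}
    {f' g' k' : ∀ γ, X' γ ⟶ Y' γ} (hf : DefTm c (fun γ => (f γ).1) (fun γ => (f' γ).1))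
    (hg : DefTm c (fun γ => (g γ).1) (fun γ => (g' γ).1))
    (hk : DefTm c (fun γ => (k γ).1) (fun γ => (k' γ).1)) :
    DefFm c (fun γ => hC.rel R (f γ) (g γ) (k γ))
      (fun γ => hC'.rel (star R) (f' γ) (g' γ) (k' γ)) :=
  DefFm.mem (hf.triple hg hk) (DefTm.const R)

variable {s : Superstructure S} {hs : IsFunctor C C s}
  {hs' : IsFunctor (C.enlarge star) (C.enlarge star) (star s)}

theorem DefFm.dist {X Y Z : c.Γ → hC.Obj} {X' Y' Z' : c.Γ' → hC'.Obj} {f : ∀ γ, X γ ⟶ Y γ}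
    {g : ∀ γ, Y γ ⟶ Z γ} {h : ∀ γ, Z γ ⟶ (hC.triangles hs R).shift.obj (X γ)}
    {f' : ∀ γ, X' γ ⟶ Y' γ} {g' : ∀ γ, Y' γ ⟶ Z' γ}
    {h' : ∀ γ, Z' γ ⟶ (hC'.triangles hs' (star R)).shift.obj (X' γ)}
    (hf : DefTm c (fun γ => (f γ).1) (fun γ => (f' γ).1))
    (hg : DefTm c (fun γ => (g γ).1) (fun γ => (g' γ).1))
    (hh : DefTm c (fun γ => (h γ).1) (fun γ => (h' γ).1)) :
    DefFm c (fun γ => (hC.triangles hs R).dist (f γ) (g γ) (h γ))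
      (fun γ => (hC'.triangles hs' (star R)).dist (f' γ) (g' γ) (h' γ)) :=
  DefFm.mem (hf.triple hg hh) (DefTm.const R)

theorem DefTm.shift_obj {X : c.Γ → hC.Obj} {X' : c.Γ' → hC'.Obj}
    (hX : DefTm c (fun γ => (X γ).1) (fun γ => (X' γ).1)) :
    DefTm c (fun γ => ((hC.triangles hs R).shift.obj (X γ)).1)
      (fun γ => ((hC'.triangles hs' (star R)).shift.obj (X' γ)).1) :=
  (DefTm.const s).app hX

theorem DefTm.shift_map {X Y : c.Γ → hC.Obj} {X' Y' : c.Γ' → hC'.Obj} {f : ∀ γ, X γ ⟶ Y γ}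
    {f' : ∀ γ, X' γ ⟶ Y' γ} (hf : DefTm c (fun γ => (f γ).1) (fun γ => (f' γ).1)) :
    DefTm c (fun γ => ((hC.triangles hs R).shift.map (f γ)).1)
      (fun γ => ((hC'.triangles hs' (star R)).shift.map (f' γ)).1) :=
  (DefTm.const s).app hf

set_option maxHeartbeats 2000000 in
/-- Each of the bounded axioms is expressed by a bounded formula, so it holds in the enlargement. -/
theorem Triangles.IsBoundedTriangulated.enlarge {ι : S ↪ W} (hstar : IsEnlargement ι star)
    {A : Superstructure S} (h : (hC.triangles hs R).IsBoundedTriangulated (hC.rel A)) :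
    (hC'.triangles hs' (star R)).IsBoundedTriangulated (hC'.rel (star A)) := by
  refine ⟨⟨(DefFm.transfer hstar ?_).1 h.exists_sum, (DefFm.transfer hstar ?_).1 h.unique,
    (DefFm.transfer hstar ?_).1 h.comm, (DefFm.transfer hstar ?_).1 h.assoc,
    (DefFm.transfer hstar ?_).1 h.exists_zero, (DefFm.transfer hstar ?_).1 h.add_comp,
    (DefFm.transfer hstar ?_).1 h.comp_add⟩, (DefFm.transfer hstar ?_).1 h.exists_zero_obj,
    (DefFm.transfer hstar ?_).1 h.exists_coproduct, (DefFm.transfer hstar ?_).1 h.shift_surj,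
    (DefFm.transfer hstar ?_).1 h.shift_inj, (DefFm.transfer hstar ?_).1 h.shift_full,
    (DefFm.transfer hstar ?_).1 h.shift_faithful, (DefFm.transfer hstar ?_).1 h.dist_of_iso,
    (DefFm.transfer hstar ?_).1 h.dist_id, (DefFm.transfer hstar ?_).1 h.exists_dist,
    (DefFm.transfer hstar ?_).1 h.rotate, (DefFm.transfer hstar ?_).1 h.complete,
    (DefFm.transfer hstar ?_).1 h.octahedron⟩
  repeat' first
    | with_reducible apply DefFm.rel
    | with_reducible apply DefFm.dist
    | with_reducible apply DefFm.forall_obj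
    | with_reducible apply DefFm.exists_obj
    | with_reducible apply DefFm.forall_hom
    | with_reducible apply DefFm.exists_hom
    | with_reducible apply DefFm.eq_hom
    | with_reducible apply DefFm.eq_obj
    | with_reducible apply DefFm.and
    | with_reducible apply DefFm.iff
    | with_reducible apply DefFm.imp
    | with_reducible apply DefTm.shift_map
    | with_reducible apply DefTm.comp
    | with_reducible apply DefTm.shift_obj
    | (refine DefTm.of_val 0 (Nat.le_add_left _ _) ?_ ?_ <;> intro _ <;> with_reducible rfl)
    | (refine DefTm.of_val 1 (Nat.le_add_left _ _) ?_ ?_ <;> intro _ <;> with_reducible rfl)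
    | (refine DefTm.of_val 2 (Nat.le_add_left _ _) ?_ ?_ <;> intro _ <;> with_reducible rfl)
    | (refine DefTm.of_val 3 (Nat.le_add_left _ _) ?_ ?_ <;> intro _ <;> with_reducible rfl)
    | (refine DefTm.of_val 4 (Nat.le_add_left _ _) ?_ ?_ <;> intro _ <;> with_reducible rfl)
    | (refine DefTm.of_val 5 (Nat.le_add_left _ _) ?_ ?_ <;> intro _ <;> with_reducible rfl)
    | (refine DefTm.of_val 6 (Nat.le_add_left _ _) ?_ ?_ <;> intro _ <;> with_reducible rfl)
    | (refine DefTm.of_val 7 (Nat.le_add_left _ _) ?_ ?_ <;> intro _ <;> with_reducible rfl)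
    | (refine DefTm.of_val 8 (Nat.le_add_left _ _) ?_ ?_ <;> intro _ <;> with_reducible rfl)
    | (refine DefTm.of_val 9 (Nat.le_add_left _ _) ?_ ?_ <;> intro _ <;> with_reducible rfl)
    | (refine DefTm.of_val 10 (Nat.le_add_left _ _) ?_ ?_ <;> intro _ <;> with_reducible rfl)
    | (refine DefTm.of_val 11 (Nat.le_add_left _ _) ?_ ?_ <;> intro _ <;> with_reducible rfl)
    | (refine DefTm.of_val 12 (Nat.le_add_left _ _) ?_ ?_ <;> intro _ <;> with_reducible rfl)
    | (refine DefTm.of_val 13 (Nat.le_add_left _ _) ?_ ?_ <;> intro _ <;> with_reducible rfl)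
    | (refine DefTm.of_val 14 (Nat.le_add_left _ _) ?_ ?_ <;> intro _ <;> with_reducible rfl)
    | (refine DefTm.of_val 15 (Nat.le_add_left _ _) ?_ ?_ <;> intro _ <;> with_reducible rfl)
    | (refine DefTm.of_val 16 (Nat.le_add_left _ _) ?_ ?_ <;> intro _ <;> with_reducible rfl)
    | (refine DefTm.of_val 17 (Nat.le_add_left _ _) ?_ ?_ <;> intro _ <;> with_reducible rfl)
    | with_reducible apply DefTm.id

end
end Enlarge

/-! ### Enlargement of triangulated categories -/

namespace Enlarge
open Superstructure
variable {S W : Type u} {star : Superstructure S → Superstructure W}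

theorem TriData.IsTriangulated.isBounded {T : TriData S} (h : T.IsTriangulated) :
    (h.isCat.triangles h.isFunctor_shift T.dist).IsBoundedTriangulated (h.isCat.rel T.add) := by
  obtain ⟨_, h₁, h₂⟩ := h.exists_preadditive
  exact Triangles.IsTriangulated.isBoundedTriangulated h₂ h₁

theorem TriData.IsTriangulated.of_isBounded {T : TriData S} (hC : T.IsCat)
    (h₁ : IsTernary T.add T.mor) (hs : IsFunctor T.toCatData T.toCatData T.shift)
    (h₂ : IsTernary T.dist T.mor)
    (h₃ : ∀ f ∈ T.mor, ∀ g ∈ T.mor, ∀ h ∈ T.mor, triple f g h ∈ T.dist →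
      app T.tgt f = app T.src g ∧ app T.tgt g = app T.src h ∧
        app T.tgt h = app T.shift (app T.src f))
    (h : (hC.triangles hs T.dist).IsBoundedTriangulated (hC.rel T.add)) : T.IsTriangulated :=
  ⟨hC, h₁, hs, h₂, h₃, h.toIsAddition.preadditive, h.toIsAddition.add_iff, h.isTriangulated⟩

theorem TriData.IsTriangulated.enlarge {ι : S ↪ W} (hstar : IsEnlargement ι star) {T : TriData S}
    (h : T.IsTriangulated) : (T.enlarge star).IsTriangulated := by
  refine .of_isBounded (h.isCat.enlarge hstar) (IsTernary.enlarge hstar h.add_sub)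
    (h.isFunctor_shift.enlarge hstar) (IsTernary.enlarge hstar h.dist_sub)
    ((DefFm.transfer hstar ?_).1 h.dist_triangle) (h.isBounded.enlarge hstar)
  repeat' first
    | exact DefTm.of_val 0 (Nat.zero_lt_succ _) (fun _ => rfl) (fun _ => rfl)
    | exact DefTm.of_val 1 (Nat.le_add_left _ _) (fun _ => rfl) (fun _ => rfl)
    | exact DefTm.of_val 2 (Nat.le_add_left _ _) (fun _ => rfl) (fun _ => rfl)
    | apply DefTm.const
    | apply DefFm.forall_mem
    | apply DefFm.mem
    | apply DefFm.eq
    | apply DefFm.and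
    | apply DefFm.imp
    | apply DefTm.triple
    | apply DefTm.app

/-- Composition with the morphism given by an equality of objects does not change the underlying
element of the superstructure. -/
theorem comp_eqToHom_val {C : CatData S} {hC : C.IsCat} {X Y Z : hC.Obj} (f : X ⟶ Y) (e : Y = Z) :
    Subtype.val (f ≫ eqToHom e) = f.1 := by
  subst e
  simp

theorem eqToHom_comp_val {C : CatData S} {hC : C.IsCat} {X Y Z : hC.Obj} (e : X = Y) (f : Y ⟶ Z) :
    Subtype.val (eqToHom e ≫ f) = f.1 := by
  subst e
  simp

/-- Functors between categories inside the superstructure agree if they agree on all morphisms as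
elements of the superstructure. -/
theorem functor_ext_val {E : Type*} [Category E] {C : CatData S} {hC : C.IsCat} {F G : E ⥤ hC.Obj}
    (h : ∀ {X Y : E} (f : X ⟶ Y), (F.map f).1 = (G.map f).1) : F = G := by
  have ho : ∀ X, F.obj X = G.obj X := fun X => Subtype.ext (by
    have := h (𝟙 X)
    rwa [F.map_id, G.map_id] at this)
  refine CategoryTheory.Functor.ext ho fun X Y f => Subtype.ext ?_
  rw [eqToHom_comp_val, comp_eqToHom_val, h]

theorem TriData.IsTriangulated.add_iff {T : TriData S} (hT : T.IsTriangulated)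
    {X Y : hT.triCat.Obj} (f g k : X ⟶ Y) :
    triple (Subtype.val (show CatData.Hom _ _ _ from f))
      (Subtype.val (show CatData.Hom _ _ _ from g))
      (Subtype.val (show CatData.Hom _ _ _ from k)) ∈ T.add ↔ f + g = k :=
  hT.exists_preadditive.choose_spec.1 X Y f g k

end Enlarge

/-! ### Enlargement of functors of triangulated categories -/

namespace Enlarge
open Superstructure
variable {S W : Type u} {star : Superstructure S → Superstructure W}

section
variable {C C' : CatData S} {F θ : Superstructure S}

/-- Additivity of a functor in terms of the graphs of the additions. -/
def PreservesAdd (hC : C.IsCat) (hC' : C'.IsCat) (hF : IsFunctor C C' F)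
    (A A' : Superstructure S) : Prop :=
  ∀ (X Y : hC.Obj) (f g k : X ⟶ Y), hC.rel A f g k →
    hC'.rel A' ((hF.functor hC hC').map f) ((hF.functor hC hC').map g)
      ((hF.functor hC hC').map k)

/-- The values of `θ` at the objects `X` are isomorphisms from `F s X` to `s' F X`. -/
def IsIsoFamily (hC : C.IsCat) (hC' : C'.IsCat) (hF : IsFunctor C C' F)
    {s s' : Superstructure S} (hs : IsFunctor C C s) (hs' : IsFunctor C' C' s')
    (θ : Superstructure S) : Prop :=
  ∀ X : hC.Obj, ∃ (t : (hF.functor hC hC').obj ((hs.functor hC hC).obj X) ⟶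
      (hs'.functor hC' hC').obj ((hF.functor hC hC').obj X))
    (t' : (hs'.functor hC' hC').obj ((hF.functor hC hC').obj X) ⟶
      (hF.functor hC hC').obj ((hs.functor hC hC).obj X)),
    Subtype.val t = app θ (Subtype.val X) ∧ t ≫ t' = 𝟙 _ ∧ t' ≫ t = 𝟙 _

theorem PreservesAdd.enlarge {ι : S ↪ W} (hstar : IsEnlargement ι star) {hC : C.IsCat}
    {hC' : C'.IsCat} {hF : IsFunctor C C' F} {A A' : Superstructure S}
    (h : PreservesAdd hC hC' hF A A') :
    PreservesAdd (hC.enlarge hstar) (hC'.enlarge hstar) (hF.enlarge hstar) (star A) (star A') := by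
  refine (DefFm.transfer hstar ?_).1 h
  repeat' first
    | exact DefTm.of_val 0 (Nat.zero_lt_succ _) (fun _ => rfl) (fun _ => rfl)
    | exact DefTm.of_val 1 (Nat.le_add_left _ _) (fun _ => rfl) (fun _ => rfl)
    | exact DefTm.of_val 2 (Nat.le_add_left _ _) (fun _ => rfl) (fun _ => rfl)
    | exact DefTm.of_val 3 (Nat.le_add_left _ _) (fun _ => rfl) (fun _ => rfl)
    | exact DefTm.of_val 4 (Nat.le_add_left _ _) (fun _ => rfl) (fun _ => rfl)
    | with_reducible apply DefTm.functor_map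
    | with_reducible apply DefFm.rel
    | apply DefFm.imp
    | apply DefFm.forall_obj
    | apply DefFm.forall_hom

theorem IsIsoFamily.enlarge {ι : S ↪ W} (hstar : IsEnlargement ι star) {hC : C.IsCat}
    {hC' : C'.IsCat} {hF : IsFunctor C C' F} {s s' : Superstructure S} {hs : IsFunctor C C s}
    {hs' : IsFunctor C' C' s'} (h : IsIsoFamily hC hC' hF hs hs' θ) :
    IsIsoFamily (hC.enlarge hstar) (hC'.enlarge hstar) (hF.enlarge hstar) (hs.enlarge hstar)
      (hs'.enlarge hstar) (star θ) := by
  refine (DefFm.transfer hstar ?_).1 h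
  repeat' first
    | exact DefTm.of_val 0 (Nat.zero_lt_succ _) (fun _ => rfl) (fun _ => rfl)
    | exact DefTm.of_val 1 (Nat.le_add_left _ _) (fun _ => rfl) (fun _ => rfl)
    | exact DefTm.of_val 2 (Nat.le_add_left _ _) (fun _ => rfl) (fun _ => rfl)
    | with_reducible apply DefTm.const
    | apply DefFm.forall_obj
    | with_reducible apply DefFm.exists_hom
    | with_reducible apply DefFm.eq_hom
    | with_reducible apply DefFm.eq
    | with_reducible apply DefFm.and
    | with_reducible apply DefTm.comp
    | with_reducible apply DefTm.functor_obj
    | with_reducible apply DefTm.app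
    | with_reducible apply DefTm.id

end

section
variable {T T' : TriData S} {F θ : Superstructure S}

theorem preservesAdd_iff (hT : T.IsTriangulated) (hT' : T'.IsTriangulated)
    (hF : IsFunctor T.toCatData T'.toCatData F) :
    PreservesAdd hT.isCat hT'.isCat hF T.add T'.add ↔ (hF.triFunctor hT hT').Additive := by
  constructor
  · intro h
    refine ⟨fun {X Y f g} => ?_⟩
    exact ((hT'.add_iff _ _ _).1 (h X Y f g _ ((hT.add_iff f g _).2 rfl))).symm
  · intro h X Y f g k hk
    refine (hT'.add_iff (X := (hF.triFunctor hT hT').obj X) (Y := (hF.triFunctor hT hT').obj Y)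
      ((hF.triFunctor hT hT').map f) ((hF.triFunctor hT hT').map g)
      ((hF.triFunctor hT hT').map k)).2 ?_
    rw [← (hT.add_iff (X := X) (Y := Y) f g k).1 hk]
    exact ((hF.triFunctor hT hT').map_add (X := X) (Y := Y) (f := f) (g := g)).symm

theorem comp_eqToIso_app_val {E : Type*} [Category E] {C : CatData S} {hC : C.IsCat}
    {G H : E ⥤ hC.Obj} (e : G = H) (X : E) {Z : hC.Obj} (f : Z ⟶ G.obj X) :
    Subtype.val (f ≫ (eqToIso e).hom.app X) = f.1 := by
  subst e
  simp

/-- The translation functors commute with `F` in the strict sense. -/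
theorem shift_comp_iff (hT : T.IsTriangulated) (hT' : T'.IsTriangulated)
    (hF : IsFunctor T.toCatData T'.toCatData F) :
    (hT.triCat.tri.shift ⋙ hF.triFunctor hT hT' =
      hF.triFunctor hT hT' ⋙ hT'.triCat.tri.shift) ↔
    ∀ f ∈ T.mor, app F (app T.shift f) = app T'.shift (app F f) := by
  constructor
  · intro h f hf
    have hsrc : app T.src f ∈ T.mor := app_mem hT.isCat.isFun_src hf
    have htgt : app T.tgt f ∈ T.mor := app_mem hT.isCat.isFun_tgt hf
    let X : hT.isCat.Obj := ⟨app T.src f, hsrc, hT.isCat.src_src f hf⟩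
    let Y : hT.isCat.Obj := ⟨app T.tgt f, htgt, hT.isCat.src_tgt f hf⟩
    let f' : X ⟶ Y := ⟨f, hf, rfl, rfl⟩
    have e := Functor.congr_hom h f'
    have e' := congrArg Subtype.val e
    refine e'.trans ?_
    exact (eqToHom_comp_val _ _).trans (comp_eqToHom_val _ _)
  · intro h
    exact functor_ext_val (C := T'.toCatData) (hC := hT'.isCat) (fun {X Y} f => h f.1 f.2.1)

/-- A strict functor of triangulated categories in terms of elements of the superstructure; all
quantifiers are bounded. -/
theorem isStrictTriFunctor_iff : IsStrictTriFunctor T T' F ↔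
    ∃ (hT : T.IsTriangulated) (hT' : T'.IsTriangulated)
      (hF : IsFunctor T.toCatData T'.toCatData F), PreservesAdd hT.isCat hT'.isCat hF T.add T'.add ∧
      (∀ f ∈ T.mor, app F (app T.shift f) = app T'.shift (app F f)) ∧
      ∀ f ∈ T.mor, ∀ g ∈ T.mor, ∀ h ∈ T.mor, triple f g h ∈ T.dist →
        triple (app F f) (app F g) (app F h) ∈ T'.dist := by
  constructor
  · rintro ⟨hT, hT', hF, e, hadd, hd⟩
    refine ⟨hT, hT', hF, (preservesAdd_iff hT hT' hF).2 hadd, (shift_comp_iff hT hT' hF).1 e,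
      fun f hf g hg h hh hfgh => ?_⟩
    obtain ⟨h₁, h₂, h₃⟩ := hT.dist_triangle f hf g hg h hh hfgh
    let X : hT.isCat.Obj := ⟨app T.src f, app_mem hT.isCat.isFun_src hf, hT.isCat.src_src f hf⟩
    let Y : hT.isCat.Obj := ⟨app T.tgt f, app_mem hT.isCat.isFun_tgt hf, hT.isCat.src_tgt f hf⟩
    let Z : hT.isCat.Obj := ⟨app T.tgt g, app_mem hT.isCat.isFun_tgt hg, hT.isCat.src_tgt g hg⟩
    have := hd (X := X) (Y := Y) (Z := Z) ⟨f, hf, rfl, rfl⟩ ⟨g, hg, h₁.symm, rfl⟩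
      ⟨h, hh, h₂.symm, h₃⟩ hfgh
    have e' := comp_eqToIso_app_val (hC := hT'.isCat) e X
      ((hF.triFunctor hT hT').map (X := Z) (Y := hT.triCat.tri.shift.obj X) ⟨h, hh, h₂.symm, h₃⟩)
    change triple (app F f) (app F g) (Subtype.val _) ∈ T'.dist at this
    exact Eq.mp (congrArg (fun x => triple (app F f) (app F g) x ∈ T'.dist) e') this
  · rintro ⟨hT, hT', hF, hadd, e, hd⟩
    refine ⟨hT, hT', hF, (shift_comp_iff hT hT' hF).2 e, (preservesAdd_iff hT hT' hF).1 hadd,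
      fun X Y Z f g h hfgh => ?_⟩
    have e' := comp_eqToIso_app_val (hC := hT'.isCat) ((shift_comp_iff hT hT' hF).2 e) X
      ((hF.triFunctor hT hT').map h)
    change triple (app F f.1) (app F g.1) (Subtype.val _) ∈ T'.dist
    exact e'.symm ▸ hd _ f.2.1 _ g.2.1 _ h.2.1 hfgh

/-- A functor of triangulated categories with its natural isomorphism in terms of elements of the
superstructure. Instead of the natural isomorphism, only its components are mentioned, and their
naturality is an equation between composites. -/
theorem isTriFunctor_iff : IsTriFunctor T T' F θ ↔
    ∃ (hT : T.IsTriangulated) (hT' : T'.IsTriangulated)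
      (hF : IsFunctor T.toCatData T'.toCatData F), PreservesAdd hT.isCat hT'.isCat hF T.add T'.add ∧
      IsIsoFamily hT.isCat hT'.isCat hF hT.isFunctor_shift hT'.isFunctor_shift θ ∧
      (∀ f ∈ T.mor, app T'.comp (opair (app θ (app T.tgt f)) (app F (app T.shift f))) =
          app T'.comp (opair (app T'.shift (app F f)) (app θ (app T.src f)))) ∧
      ∀ f ∈ T.mor, ∀ g ∈ T.mor, ∀ h ∈ T.mor, triple f g h ∈ T.dist →
        triple (app F f) (app F g) (app T'.comp (opair (app θ (app T.src f)) (app F h))) ∈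
          T'.dist := by
  constructor
  · rintro ⟨hT, hT', hF, τ, hτ, hadd, hd⟩
    refine ⟨hT, hT', hF, (preservesAdd_iff hT hT' hF).2 hadd, fun X => ?_, fun f hf => ?_,
      fun f hf g hg h hh hfgh => ?_⟩
    · exact ⟨τ.hom.app X, τ.inv.app X, hτ X, τ.hom_inv_id_app X, τ.inv_hom_id_app X⟩
    · let X : hT.isCat.Obj := ⟨app T.src f, app_mem hT.isCat.isFun_src hf, hT.isCat.src_src f hf⟩
      let Y : hT.isCat.Obj := ⟨app T.tgt f, app_mem hT.isCat.isFun_tgt hf, hT.isCat.src_tgt f hf⟩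
      let f' : X ⟶ Y := ⟨f, hf, rfl, rfl⟩
      have := congrArg Subtype.val (τ.hom.naturality f')
      change app T'.comp (opair (Subtype.val (τ.hom.app Y)) (app F (app T.shift f))) =
        app T'.comp (opair (app T'.shift (app F f)) (Subtype.val (τ.hom.app X))) at this
      have e₁ := hτ X
      have e₂ := hτ Y
      rwa [e₁, e₂] at this
    · obtain ⟨h₁, h₂, h₃⟩ := hT.dist_triangle f hf g hg h hh hfgh
      let X : hT.isCat.Obj := ⟨app T.src f, app_mem hT.isCat.isFun_src hf, hT.isCat.src_src f hf⟩
      let Y : hT.isCat.Obj := ⟨app T.tgt f, app_mem hT.isCat.isFun_tgt hf, hT.isCat.src_tgt f hf⟩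
      let Z : hT.isCat.Obj := ⟨app T.tgt g, app_mem hT.isCat.isFun_tgt hg, hT.isCat.src_tgt g hg⟩
      have := hd (X := X) (Y := Y) (Z := Z) ⟨f, hf, rfl, rfl⟩ ⟨g, hg, h₁.symm, rfl⟩
        ⟨h, hh, h₂.symm, h₃⟩ hfgh
      have e := hτ X
      change triple (app F f) (app F g)
        (app T'.comp (opair (Subtype.val (τ.hom.app X)) (app F h))) ∈ T'.dist at this
      rwa [e] at this
  · rintro ⟨hT, hT', hF, hadd, hθ, hn, hd⟩
    choose t t' ht h₁ h₂ using hθ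
    let τ : hT.triCat.tri.shift ⋙ hF.triFunctor hT hT' ≅
        hF.triFunctor hT hT' ⋙ hT'.triCat.tri.shift :=
      NatIso.ofComponents (fun X => ⟨t X, t' X, h₁ X, h₂ X⟩) (fun {X Y} f => by
        refine Subtype.ext ?_
        change app T'.comp (opair (Subtype.val (t Y)) (app F (app T.shift f.1))) =
          app T'.comp (opair (app T'.shift (app F f.1)) (Subtype.val (t X)))
        rw [ht X, ht Y]
        have := hn f.1 f.2.1
        rwa [f.2.2.1, f.2.2.2] at this)
    refine ⟨hT, hT', hF, τ, ht, (preservesAdd_iff hT hT' hF).1 hadd, fun X Y Z f g h hfgh => ?_⟩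
    have := hd _ f.2.1 _ g.2.1 _ h.2.1 hfgh
    change triple (app F f.1) (app F g.1)
        (app T'.comp (opair (Subtype.val (t X)) (app F h.1))) ∈ T'.dist
    rw [f.2.2.1, ← ht X] at this
    exact this

theorem IsStrictTriFunctor.enlarge {ι : S ↪ W} (hstar : IsEnlargement ι star)
    (h : IsStrictTriFunctor T T' F) :
    IsStrictTriFunctor (T.enlarge star) (T'.enlarge star) (star F) := by
  rw [isStrictTriFunctor_iff] at h ⊢
  obtain ⟨hT, hT', hF, hadd, e, hd⟩ := h
  refine ⟨hT.enlarge hstar, hT'.enlarge hstar, hF.enlarge hstar, hadd.enlarge hstar,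
    (DefFm.transfer hstar ?_).1 e, (DefFm.transfer hstar ?_).1 hd⟩
  repeat' first
    | exact DefTm.of_val 0 (Nat.zero_lt_succ _) (fun _ => rfl) (fun _ => rfl)
    | exact DefTm.of_val 1 (Nat.le_add_left _ _) (fun _ => rfl) (fun _ => rfl)
    | exact DefTm.of_val 2 (Nat.le_add_left _ _) (fun _ => rfl) (fun _ => rfl)
    | apply DefTm.const
    | apply DefFm.forall_mem
    | apply DefFm.mem
    | apply DefFm.eq
    | apply DefFm.imp
    | apply DefTm.triple
    | apply DefTm.app

theorem IsTriFunctor.enlarge {ι : S ↪ W} (hstar : IsEnlargement ι star)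
    (h : IsTriFunctor T T' F θ) :
    IsTriFunctor (T.enlarge star) (T'.enlarge star) (star F) (star θ) := by
  rw [isTriFunctor_iff] at h ⊢
  obtain ⟨hT, hT', hF, hadd, hθ, hn, hd⟩ := h
  refine ⟨hT.enlarge hstar, hT'.enlarge hstar, hF.enlarge hstar, hadd.enlarge hstar,
    hθ.enlarge hstar, (DefFm.transfer hstar ?_).1 hn, (DefFm.transfer hstar ?_).1 hd⟩
  repeat' first
    | exact DefTm.of_val 0 (Nat.zero_lt_succ _) (fun _ => rfl) (fun _ => rfl)
    | exact DefTm.of_val 1 (Nat.le_add_left _ _) (fun _ => rfl) (fun _ => rfl)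
    | exact DefTm.of_val 2 (Nat.le_add_left _ _) (fun _ => rfl) (fun _ => rfl)
    | apply DefTm.const
    | apply DefFm.forall_mem
    | apply DefFm.mem
    | apply DefFm.eq
    | apply DefFm.imp
    | apply DefTm.triple
    | apply DefTm.pair
    | apply DefTm.app

end
end Enlarge

/-! ### Comparison with pretriangulated categories with shift -/

namespace Enlarge
open Superstructure

section
variable {C : Type u} [Category.{u} C]

/-- Coherence data for a shift by `ℤ` whose functors compose strictly. -/
def shiftMkCoreOfEq (F : ℤ → C ⥤ C) (h₀ : F 0 = 𝟭 C) (hF : ∀ n m, F (n + m) = F n ⋙ F m) :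
    ShiftMkCore C ℤ where
  F := F
  zero := eqToIso h₀
  add n m := eqToIso (hF n m)
  assoc_hom_app m₁ m₂ m₃ X := by simp [eqToHom_app, eqToHom_map]
  zero_add_hom_app n X := by simp [eqToHom_app, eqToHom_map]
  add_zero_hom_app n X := by simp [eqToHom_app]

/-- The powers of a strict automorphism of a category. -/
theorem exists_shiftMkCore {F G : C ⥤ C} (h₁ : F ⋙ G = 𝟭 C) (h₂ : G ⋙ F = 𝟭 C) :
    ∃ s : ShiftMkCore C ℤ, s.F 1 = F := by
  let e : Aut (Cat.of C) :=
    ⟨F.toCatHom, G.toCatHom, Cat.Hom.ext h₁, Cat.Hom.ext h₂⟩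
  refine ⟨shiftMkCoreOfEq (fun n => (e ^ n).hom.toFunctor) ?_ fun n m => ?_, ?_⟩
  · rw [zpow_zero]; rfl
  · rw [add_comm, zpow_add]; rfl
  · exact congrArg (fun x : Aut (Cat.of C) => x.hom.toFunctor) (zpow_one e)
end

section
variable (T : TriCat.{u})

theorem TriCat.exists_shift :
    ∃ s : ShiftMkCore T.Obj ℤ, s.F 1 = T.tri.shift := by
  obtain ⟨G, h₁, h₂⟩ := T.isTriangulated.shift_automorphism
  exact exists_shiftMkCore h₁ h₂

instance : HasZeroObject T.Obj := T.isTriangulated.hasZeroObject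

/-- The shifts by integers are the powers of the translation functor. -/
noncomputable instance : HasShift T.Obj ℤ := hasShiftMk T.Obj ℤ T.exists_shift.choose

/-- The shift by `1` is the translation functor. -/
noncomputable def TriCat.shiftIso : shiftFunctor T.Obj (1 : ℤ) ≅ T.tri.shift :=
  eqToIso T.exists_shift.choose_spec

instance : HasFiniteBiproducts T.Obj :=
  have := T.isTriangulated.hasFiniteCoproducts
  HasFiniteBiproducts.of_hasFiniteCoproducts

instance (n : ℤ) : (shiftFunctor T.Obj n).Additive :=
  Functor.additive_of_preserves_binary_products _

open Pretriangulated

theorem TriCat.dist_rotate_iff (X : Triangle T.Obj) :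
    T.tri.dist X.mor₁ X.mor₂ (X.mor₃ ≫ T.shiftIso.hom.app X.obj₁) ↔
      T.tri.dist X.mor₂ X.mor₃ ((-(shiftFunctor T.Obj (1 : ℤ)).map X.mor₁) ≫
        T.shiftIso.hom.app X.obj₂) := by
  rw [T.isTriangulated.rotate]
  constructor
  · refine T.isTriangulated.dist_of_iso _ _ _ _ _ _ (Iso.refl _) (Iso.refl _)
      (T.shiftIso.symm.app X.obj₁) ?_ ?_ ?_
    · simp
    · simp
    · simp
  · refine T.isTriangulated.dist_of_iso _ _ _ _ _ _ (Iso.refl _) (Iso.refl _)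
      (T.shiftIso.app X.obj₁) ?_ ?_ ?_
    · simp
    · simp
    · simp

/-- The triangles of `T`, with the translation functor replaced by the shift by `1`. -/
noncomputable instance : Pretriangulated T.Obj where
  distinguishedTriangles :=
    {X | T.tri.dist X.mor₁ X.mor₂ (X.mor₃ ≫ T.shiftIso.hom.app X.obj₁)}
  isomorphic_distinguished X hX Y e := by
    refine T.isTriangulated.dist_of_iso _ _ _ _ _ _ (Triangle.π₁.mapIso e.symm)
      (Triangle.π₂.mapIso e.symm) (Triangle.π₃.mapIso e.symm) ?_ ?_ ?_ hX
    · exact e.inv.comm₁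
    · exact e.inv.comm₂
    · have h : X.mor₃ ≫ (shiftFunctor T.Obj (1 : ℤ)).map e.inv.hom₁ = e.inv.hom₃ ≫ Y.mor₃ :=
        e.inv.comm₃
      change (X.mor₃ ≫ T.shiftIso.hom.app X.obj₁) ≫ T.tri.shift.map e.inv.hom₁ =
        e.inv.hom₃ ≫ Y.mor₃ ≫ T.shiftIso.hom.app Y.obj₁
      rw [Category.assoc, ← NatTrans.naturality, reassoc_of% h]
  contractible_distinguished X := T.isTriangulated.dist_id X _ (isZero_zero _) _ _
  distinguished_cocone_triangle {X Y} f := by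
    obtain ⟨Z, g, h, H⟩ := T.isTriangulated.exists_dist f
    refine ⟨Z, g, h ≫ T.shiftIso.inv.app X, ?_⟩
    change T.tri.dist f g ((h ≫ T.shiftIso.inv.app X) ≫ T.shiftIso.hom.app X)
    rwa [Category.assoc, Iso.inv_hom_id_app, Category.comp_id]
  rotate_distinguished_triangle X := by
    refine (T.dist_rotate_iff X).trans ?_
    rfl
  complete_distinguished_triangle_morphism X Y hX hY a b h := by
    obtain ⟨c, h₁, h₂⟩ := T.isTriangulated.complete _ _ _ _ _ _ a b hX hY h
    refine ⟨c, h₁, ?_⟩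
    rw [← cancel_mono (T.shiftIso.hom.app _), Category.assoc, Category.assoc]
    refine Eq.trans ?_ h₂
    rw [Category.assoc, NatTrans.naturality]

theorem TriCat.dist_iff {X Y Z : T.Obj} (f : X ⟶ Y) (g : Y ⟶ Z) (h : Z ⟶ T.tri.shift.obj X) :
    T.tri.dist f g h ↔ Triangle.mk f g (h ≫ T.shiftIso.inv.app X) ∈ distTriang T.Obj := by
  change _ ↔ T.tri.dist f g ((h ≫ T.shiftIso.inv.app X) ≫ T.shiftIso.hom.app X)
  rw [Category.assoc, Iso.inv_hom_id_app, Category.comp_id]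

instance : IsTriangulated T.Obj where
  octahedron_axiom {X₁ X₂ X₃ _ _ _ u₁₂ u₂₃ _} comm {v₁₂ w₁₂} h₁₂ {v₂₃ w₂₃} h₂₃ {v₁₃ w₁₃} h₁₃ := by
    subst comm
    obtain ⟨u, v, h, e₁, e₂, e₃, e₄⟩ := T.isTriangulated.octahedron u₁₂ v₁₂
      (w₁₂ ≫ T.shiftIso.hom.app X₁) u₂₃ v₂₃ (w₂₃ ≫ T.shiftIso.hom.app X₂) v₁₃
      (w₁₃ ≫ T.shiftIso.hom.app X₁) h₁₂ h₂₃ h₁₃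
    refine ⟨⟨u, v, e₁, ?_, e₃, ?_, ?_⟩⟩
    · rw [← cancel_mono (T.shiftIso.hom.app _), Category.assoc]
      exact e₂
    · rw [← cancel_mono (T.shiftIso.hom.app _), Category.assoc, Category.assoc, NatTrans.naturality]
      rw [Category.assoc] at e₄
      exact e₄.symm
    · change T.tri.dist u v ((w₂₃ ≫ (shiftFunctor T.Obj (1 : ℤ)).map v₁₂) ≫ T.shiftIso.hom.app _)
      rw [Category.assoc] at h ⊢
      rwa [NatTrans.naturality]

end

section
open Pretriangulated
variable {D : Type u} [Category.{u} D] [HasShift D ℤ] [Preadditive D] [HasZeroObject D]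
  [∀ n : ℤ, (shiftFunctor D n).Additive] [Pretriangulated D]

/-- A translation functor isomorphic to the shift by `1`, with the corresponding triangles. -/
@[reducible] def trianglesOfIso {F : D ⥤ D} (ε : shiftFunctor D (1 : ℤ) ≅ F) : Triangles D where
  shift := F
  dist X _ _ f g h := Triangle.mk f g (h ≫ ε.inv.app X) ∈ distTriang D

theorem trianglesOfIso_isTriangulated [IsTriangulated D] {F G : D ⥤ D}
    (ε : shiftFunctor D (1 : ℤ) ≅ F) (h₁ : F ⋙ G = 𝟭 D) (h₂ : G ⋙ F = 𝟭 D) :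
    (trianglesOfIso ε).IsTriangulated where
  hasZeroObject := inferInstance
  hasFiniteCoproducts := inferInstance
  shift_automorphism := ⟨G, h₁, h₂⟩
  dist_of_iso X Y Z X' Y' Z' f g h f' g' h' a b c e₁ e₂ e₃ H := by
    refine isomorphic_distinguished _ H _ (Iso.symm (Triangle.isoMk _ _ a b c e₁ e₂ ?_))
    change (h ≫ ε.inv.app X) ≫ (shiftFunctor D (1 : ℤ)).map a.hom = c.hom ≫ h' ≫ ε.inv.app X'
    rw [Category.assoc, ← ε.inv.naturality, ← Category.assoc, ← Category.assoc]
    exact congrArg (· ≫ ε.inv.app X') e₃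
  dist_id X Z hZ g h := by
    refine isomorphic_distinguished _ (contractible_distinguished X) _
      (Triangle.isoMk _ _ (Iso.refl _) (Iso.refl _) (hZ.iso (isZero_zero D)) ?_ ?_ ?_)
    · rfl
    · exact (isZero_zero D).eq_of_tgt _ _
    · exact hZ.eq_of_src _ _
  exists_dist X Y f := by
    obtain ⟨Z, g, h, H⟩ := distinguished_cocone_triangle f
    refine ⟨Z, g, h ≫ ε.hom.app X, ?_⟩
    change Triangle.mk f g ((h ≫ ε.hom.app X) ≫ ε.inv.app X) ∈ distTriang D
    rwa [Category.assoc, Iso.hom_inv_id_app, Category.comp_id]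
  rotate X Y Z f g h := by
    refine (rotate_distinguished_triangle _).trans ?_
    refine distinguished_iff_of_iso
      (Triangle.isoMk _ _ (Iso.refl _) (Iso.refl _) (ε.app X) ?_ ?_ ?_)
    · exact (Category.comp_id _).trans (Category.id_comp _).symm
    · change (h ≫ ε.inv.app X) ≫ ε.hom.app X = 𝟙 _ ≫ h
      simp
    · change (-(shiftFunctor D (1 : ℤ)).map f) ≫ (shiftFunctor D (1 : ℤ)).map (𝟙 _) =
        ε.hom.app X ≫ (-F.map f) ≫ ε.inv.app Y
      simp
  complete X Y Z X' Y' Z' f g h f' g' h' a b H H' e := by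
    obtain ⟨c, h₁, h₂⟩ := complete_distinguished_triangle_morphism _ _ H H' a b e
    refine ⟨c, h₁, ?_⟩
    change (h ≫ ε.inv.app X) ≫ (shiftFunctor D (1 : ℤ)).map a = c ≫ h' ≫ ε.inv.app X' at h₂
    change h ≫ F.map a = _
    rw [← cancel_mono (ε.inv.app X'), Category.assoc, ε.inv.naturality, ← Category.assoc]
    exact h₂.trans (Category.assoc _ _ _).symm
  octahedron X Y Z A B E f f₁ f₂ g g₁ g₂ k₁ k₂ H₁ H₂ H₃ := by
    let o := Triangulated.someOctahedron rfl H₁ H₂ H₃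
    refine ⟨o.m₁, o.m₃, ?_, o.comm₁, ?_, o.comm₃, ?_⟩
    · have := o.mem
      change Triangle.mk o.m₁ o.m₃ ((g₂ ≫ F.map f₁) ≫ ε.inv.app A) ∈ distTriang D
      rwa [Category.assoc, ε.inv.naturality, ← Category.assoc]
    · have := o.comm₂
      change o.m₁ ≫ k₂ ≫ ε.inv.app X = f₂ ≫ ε.inv.app X at this
      rwa [← cancel_mono (ε.inv.app X), Category.assoc]
    · have := o.comm₄
      change (k₂ ≫ ε.inv.app X) ≫ (shiftFunctor D (1 : ℤ)).map f = o.m₃ ≫ g₂ ≫ ε.inv.app Y at this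
      change o.m₃ ≫ g₂ = k₂ ≫ F.map f
      rw [← cancel_mono (ε.inv.app Y), Category.assoc, Category.assoc, ε.inv.naturality,
        ← Category.assoc k₂]
      exact this.symm

end
end Enlarge

/-! ### Strict localizations and fractions -/

namespace Enlarge
open Superstructure

section
variable {C E : Type u} [Category.{u} C] [Category.{u} E] (W : MorphismProperty C) (q : C ⥤ E)

/-- The strict universal property of the localization: functors that invert `W` factor uniquely
through `q`, up to equality of functors. -/
structure IsStrictLocalization : Prop where
  inverts : W.IsInvertedBy q
  existsUnique_lift : ∀ (E' : Type u) [Category.{u} E'] (G : C ⥤ E'),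
    W.IsInvertedBy G → ∃! G' : E ⥤ E', q ⋙ G' = G

/-- The description of a localization by left fractions. Unlike the universal property, it only
quantifies over objects and morphisms of the two categories. -/
structure IsFractionLocalization : Prop where
  inverts : ∀ ⦃X Y : C⦄ (f : X ⟶ Y), W f → ∃ g : q.obj Y ⟶ q.obj X,
    q.map f ≫ g = 𝟙 _ ∧ g ≫ q.map f = 𝟙 _
  obj_injective : ∀ X Y : C, q.obj X = q.obj Y → X = Y
  obj_surjective : ∀ Y : E, ∃ X : C, q.obj X = Y
  exists_fraction : ∀ (X Y : C) (φ : q.obj X ⟶ q.obj Y), ∃ (Z : C) (f : X ⟶ Z) (s : Y ⟶ Z),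
    W s ∧ φ ≫ q.map s = q.map f
  exists_comp_eq : ∀ (X Y : C) (f g : X ⟶ Y), q.map f = q.map g →
    ∃ (Z : C) (s : Y ⟶ Z), W s ∧ f ≫ s = g ≫ s

variable {W q}

theorem IsStrictLocalization.hom_ext (h : IsStrictLocalization W q) {E' : Type u}
    [Category.{u} E'] {G G' : E ⥤ E'} (e : q ⋙ G = q ⋙ G') : G = G' :=
  (h.existsUnique_lift E' (q ⋙ G) (.of_comp _ _ h.inverts _)).unique rfl e.symm

theorem isStrictLocalization_Q : IsStrictLocalization W W.Q where
  inverts := W.Q_inverts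
  existsUnique_lift _ _ G hG := ⟨Localization.Construction.lift G hG,
    Localization.Construction.fac G hG, fun _ hG' => Localization.Construction.uniq _ _
      (hG'.trans (Localization.Construction.fac G hG).symm)⟩

theorem IsStrictLocalization.comp_iso (h : IsStrictLocalization W q) {E' : Type u}
    [Category.{u} E'] {K : E ⥤ E'} {L : E' ⥤ E} (h₁ : K ⋙ L = 𝟭 _) (h₂ : L ⋙ K = 𝟭 _) :
    IsStrictLocalization W (q ⋙ K) where
  inverts := .of_comp _ _ h.inverts _
  existsUnique_lift E'' _ G hG := by
    obtain ⟨G', rfl, -⟩ := h.existsUnique_lift E'' G hG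
    refine ⟨L ⋙ G', ?_, fun G'' e => ?_⟩
    · change q ⋙ (K ⋙ L) ⋙ G' = q ⋙ G'
      rw [h₁, Functor.id_comp]
    · have : K ⋙ G'' = G' := h.hom_ext e
      rw [← this, ← Functor.assoc, h₂, Functor.id_comp]

/-- Two strict localizations are isomorphic, compatibly with the functors. -/
theorem IsStrictLocalization.exists_iso (h : IsStrictLocalization W q) {E' : Type u}
    [Category.{u} E'] {p : C ⥤ E'} (h' : IsStrictLocalization W p) :
    ∃ (K : E ⥤ E') (L : E' ⥤ E), q ⋙ K = p ∧ p ⋙ L = q ∧ K ⋙ L = 𝟭 _ ∧ L ⋙ K = 𝟭 _ := by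
  obtain ⟨K, hK, -⟩ := h.existsUnique_lift _ p h'.inverts
  obtain ⟨L, hL, -⟩ := h'.existsUnique_lift _ q h.inverts
  refine ⟨K, L, hK, hL, h.hom_ext ?_, h'.hom_ext ?_⟩
  · rw [← Functor.assoc, hK, hL, Functor.comp_id]
  · rw [← Functor.assoc, hL, hK, Functor.comp_id]

theorem IsStrictLocalization.isLocalization (h : IsStrictLocalization W q) :
    q.IsLocalization W := by
  obtain ⟨K, L, hK, -, h₁, h₂⟩ := (isStrictLocalization_Q (W := W)).exists_iso h
  have := isEquivalence_of_inverse h₁ h₂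
  exact Functor.IsLocalization.of_equivalence_target W.Q W q K.asEquivalence (eqToIso hK)

theorem bijective_obj_of_inverse {K : C ⥤ E} {L : E ⥤ C} (h₁ : K ⋙ L = 𝟭 _) (h₂ : L ⋙ K = 𝟭 _) :
    Function.Bijective K.obj :=
  Function.bijective_iff_has_inverse.2
    ⟨L.obj, fun X => Functor.congr_obj h₁ X, fun X => Functor.congr_obj h₂ X⟩

/-- If there is a left calculus of fractions, a strict localization has a description by fractions.
It is bijective on objects, because the standard localization is. -/
theorem IsStrictLocalization.isFractionLocalization [W.HasLeftCalculusOfFractions]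
    (h : IsStrictLocalization W q) : IsFractionLocalization W q := by
  have := h.isLocalization
  obtain ⟨K, L, hK, -, h₁, h₂⟩ := (isStrictLocalization_Q (W := W)).exists_iso h
  have hbij : Function.Bijective q.obj := by
    subst hK
    exact (bijective_obj_of_inverse h₁ h₂).comp (Localization.Construction.objEquiv W).bijective
  refine ⟨fun X Y f hf => ?_, fun X Y e => hbij.1 e, hbij.2, fun X Y φ => ?_, fun X Y f g e => ?_⟩
  · have := h.inverts f hf
    exact ⟨inv (q.map f), by simp, by simp⟩
  · obtain ⟨α, rfl⟩ := Localization.exists_leftFraction q W φ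
    exact ⟨α.Y', α.f, α.s, α.hs, α.map_comp_map_s q _⟩
  · obtain ⟨Z, s, hs, e'⟩ := (MorphismProperty.map_eq_iff_postcomp q W f g).1 e
    exact ⟨Z, s, hs, e'⟩

/-- If there is a left calculus of fractions, a functor that has a description by fractions is a
strict localization: the functor from the standard localization is fully faithful and bijective on
objects. -/
theorem IsFractionLocalization.isStrictLocalization [W.HasLeftCalculusOfFractions]
    (h : IsFractionLocalization W q) : IsStrictLocalization W q := by
  have hinv : W.IsInvertedBy q := fun X Y f hf => by
    obtain ⟨g, h₁, h₂⟩ := h.inverts f hf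
    exact ⟨g, h₁, h₂⟩
  let K := Localization.Construction.lift q hinv
  have hK : W.Q ⋙ K = q := Localization.Construction.fac q hinv
  have hobj : ∀ X : W.Localization, ∃ Y, W.Q.obj Y = X :=
    (Localization.Construction.objEquiv W).surjective
  have hmap : ∀ {X Y : C} (f : X ⟶ Y), K.map (W.Q.map f) = q.map f := fun {X Y} f => by
    have := Functor.congr_hom hK f
    exact this.trans ((Category.id_comp _).trans (Category.comp_id _))
  have hQ : W.IsInvertedBy W.Q := W.Q_inverts
  have hfull : K.Full := ⟨fun {A B} ψ => by
    obtain ⟨X, rfl⟩ := hobj A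
    obtain ⟨Y, rfl⟩ := hobj B
    obtain ⟨Z, f, s, hs, e⟩ := h.exists_fraction X Y ψ
    have := hQ s hs
    have := hinv s hs
    refine ⟨W.Q.map f ≫ inv (W.Q.map s), ?_⟩
    have e₁ : K.map (W.Q.map f ≫ inv (W.Q.map s)) ≫ K.map (W.Q.map s) = K.map (W.Q.map f) := by
      rw [← K.map_comp]; simp
    rw [hmap, hmap, ← e] at e₁
    exact (cancel_mono (q.map s)).1 e₁⟩
  have hfaith : K.Faithful := ⟨fun {A B} a b e => by
    obtain ⟨X, rfl⟩ := hobj A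
    obtain ⟨Y, rfl⟩ := hobj B
    obtain ⟨φ, rfl, rfl⟩ := Localization.exists_leftFraction₂ W.Q W a b
    have := hQ φ.s φ.hs
    have e₁ := congrArg (fun x => x ≫ K.map (W.Q.map φ.s)) e
    have e₂ : K.map (W.Q.map φ.f) = K.map (W.Q.map φ.f') := by
      have h₁ := φ.fst.map_comp_map_s W.Q hQ
      have h₂ := φ.snd.map_comp_map_s W.Q hQ
      exact (congrArg K.map h₁.symm).trans ((K.map_comp _ _).trans (e₁.trans
        ((K.map_comp _ _).symm.trans (congrArg K.map h₂))))
    rw [hmap, hmap] at e₂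
    obtain ⟨Z, t, ht, e₃⟩ := h.exists_comp_eq _ _ _ _ e₂
    have := hQ t ht
    have e₄ : W.Q.map φ.f = W.Q.map φ.f' := by
      rw [← cancel_mono (W.Q.map t), ← W.Q.map_comp, ← W.Q.map_comp, e₃]
    rw [← cancel_mono (W.Q.map φ.s)]
    exact (φ.fst.map_comp_map_s W.Q hQ).trans (e₄.trans (φ.snd.map_comp_map_s W.Q hQ).symm)⟩
  have hbij : Function.Bijective K.obj := by
    constructor
    · intro A B e
      obtain ⟨X, rfl⟩ := hobj A
      obtain ⟨Y, rfl⟩ := hobj B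
      exact congrArg W.Q.obj (h.obj_injective X Y e)
    · intro Y
      obtain ⟨X, hX⟩ := h.obj_surjective Y
      exact ⟨W.Q.obj X, hX⟩
  obtain ⟨L, h₁, h₂⟩ := exists_inverse_functor K hbij
  rw [← hK]
  exact isStrictLocalization_Q.comp_iso h₁ h₂

end
end Enlarge

/-! ### Verdier quotients and fractions -/

namespace Enlarge
open Superstructure

section
open Pretriangulated
variable (T : TriCat.{u}) (D : ObjectProperty T.Obj)

/-- The morphisms with cone in `D` are the same for the given translation functor and for the shift
by `1`. -/
theorem TriCat.coneIn_eq_trW : T.coneIn D = D.trW := by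
  ext X Y f
  constructor
  · rintro ⟨Z, g, h, H, hZ⟩
    exact ⟨Z, g, h ≫ T.shiftIso.inv.app X, (T.dist_iff f g h).1 H, hZ⟩
  · rintro ⟨Z, g, h, H, hZ⟩
    exact ⟨Z, g, h ≫ T.shiftIso.hom.app X, H, hZ⟩

variable [D.IsTriangulated]

theorem TriCat.trW_shift_iff {X Y : T.Obj} (f : X ⟶ Y) :
    D.trW (T.tri.shift.map f) ↔ D.trW f := by
  rw [← MorphismProperty.IsCompatibleWithShift.iff D.trW f (1 : ℤ)]
  exact D.trW.arrow_mk_iso_iff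
    (Arrow.isoMk (T.shiftIso.symm.app X) (T.shiftIso.symm.app Y)
      (T.shiftIso.inv.naturality f).symm)

/-- The translation functor induces an automorphism of every strict localization. -/
theorem TriCat.exists_localizedShift {E : Type u} [Category.{u} E] {L : T.Obj ⥤ E}
    (hL : IsStrictLocalization D.trW L) :
    ∃ F G : E ⥤ E, T.tri.shift ⋙ L = L ⋙ F ∧ F ⋙ G = 𝟭 E ∧ G ⋙ F = 𝟭 E := by
  obtain ⟨G, h₁, h₂⟩ := T.isTriangulated.shift_automorphism
  have hF : D.trW.IsInvertedBy (T.tri.shift ⋙ L) :=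
    fun _ _ f hf => hL.inverts _ ((T.trW_shift_iff D f).2 hf)
  have hG : D.trW.IsInvertedBy (G ⋙ L) := fun X Y f hf => by
    refine hL.inverts _ ((T.trW_shift_iff D (G.map f)).1 ?_)
    have e := Functor.congr_hom h₂ f
    refine (D.trW.arrow_mk_iso_iff (Arrow.isoMk (eqToIso (Functor.congr_obj h₂ X))
      (eqToIso (Functor.congr_obj h₂ Y)) ?_)).2 hf
    change eqToHom (Functor.congr_obj h₂ X) ≫ f =
      (G ⋙ T.tri.shift).map f ≫ eqToHom (Functor.congr_obj h₂ Y)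
    rw [e]
    simp
  obtain ⟨F', hF', -⟩ := hL.existsUnique_lift _ _ hF
  obtain ⟨G', hG', -⟩ := hL.existsUnique_lift _ _ hG
  refine ⟨F', G', hF'.symm, hL.hom_ext ?_, hL.hom_ext ?_⟩
  · rw [← Functor.assoc, hF', Functor.assoc, hG', ← Functor.assoc, h₁]
    rfl
  · rw [← Functor.assoc, hG', Functor.assoc, hF', ← Functor.assoc, h₂]
    rfl

/-- A strict localization of `T` at the morphisms with cone in `D` is a triangulated category, and
the localization functor strictly commutes with the translations. -/
theorem TriCat.exists_triangles_of_isStrictLocalization {E : Type u} [Category.{u} E]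
    {L : T.Obj ⥤ E} (hL : IsStrictLocalization D.trW L) :
    ∃ (_ : Preadditive E) (t : Triangles E) (e : T.tri.shift ⋙ L = L ⋙ t.shift),
      t.IsTriangulated ∧ L.Additive ∧
      ∀ ⦃X Y Z : T.Obj⦄ (f : X ⟶ Y) (g : Y ⟶ Z) (h : Z ⟶ T.tri.shift.obj X),
        T.tri.dist f g h → t.dist (L.map f) (L.map g) (L.map h ≫ (eqToIso e).hom.app X) := by
  have := hL.isLocalization
  let _ : Preadditive E := Localization.preadditive L D.trW
  have : L.Additive := Localization.functor_additive L D.trW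
  have : HasZeroObject E := L.hasZeroObject_of_additive
  let _ : HasShift E ℤ := HasShift.localized L D.trW ℤ
  let _ : L.CommShift ℤ := Functor.CommShift.localized L D.trW ℤ
  have : ∀ n : ℤ, (shiftFunctor E n).Additive := fun n => by
    rw [Localization.functor_additive_iff L D.trW]
    exact Functor.additive_of_iso (L.commShiftIso n)
  let _ : Pretriangulated E := Triangulated.Localization.pretriangulated L D.trW
  have : L.IsTriangulated := Triangulated.Localization.isTriangulated_functor L D.trW
  have : IsTriangulated E := Triangulated.Localization.isTriangulated L D.trW
  obtain ⟨F, G, e, h₁, h₂⟩ := T.exists_localizedShift D hL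
  -- The shift by `1` that the localization inherits is isomorphic to the strict translation.
  let ε : shiftFunctor E (1 : ℤ) ≅ F :=
    Localization.liftNatIso L D.trW (L ⋙ shiftFunctor _ (1 : ℤ)) (L ⋙ F) _ _
      ((L.commShiftIso (1 : ℤ)).symm ≪≫ Functor.isoWhiskerRight T.shiftIso L ≪≫ eqToIso e)
  have hε : ∀ X, ε.inv.app (L.obj X) = (eqToIso e).inv.app X ≫ L.map (T.shiftIso.inv.app X) ≫
      (L.commShiftIso (1 : ℤ)).hom.app X := fun X => by
    simp [ε]
  refine ⟨inferInstance, trianglesOfIso ε, e, trianglesOfIso_isTriangulated ε h₁ h₂, inferInstance,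
    fun X Y Z f g h H => ?_⟩
  have := L.map_distinguished _ ((T.dist_iff f g h).1 H)
  refine (congrArg (fun x => Triangle.mk (L.map f) (L.map g) x ∈ distTriang E) ?_).mp this
  change L.map (h ≫ T.shiftIso.inv.app X) ≫ (L.commShiftIso (1 : ℤ)).hom.app X =
    (L.map h ≫ (eqToIso e).hom.app X) ≫ ε.inv.app (L.obj X)
  rw [hε]
  simp

variable {T D}

/-- Verdier quotients are characterized by conditions on objects and morphisms. -/
theorem isVerdierQuotient_iff {Q : TriCat.{u}} {q : T.Obj ⥤ Q.Obj} :
    IsVerdierQuotient T D Q q ↔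
      IsStrictTriangulatedFunctor q ∧ IsFractionLocalization (T.coneIn D) q := by
  have : (T.coneIn D).HasLeftCalculusOfFractions := by
    rw [T.coneIn_eq_trW]
    infer_instance
  constructor
  · intro h
    exact ⟨h.isTriangulated,
      IsStrictLocalization.isFractionLocalization ⟨h.inverts, h.existsUnique_lift⟩⟩
  · rintro ⟨h₁, h₂⟩
    have := h₂.isStrictLocalization
    exact ⟨h₁, this.inverts, this.existsUnique_lift⟩

end

section
open Pretriangulated

/-- An isomorphism between the first maps of two triangles extends to the triangles. -/
theorem TriCat.exists_iso_of_iso (T : TriCat.{u}) {X Y Z X' Y' Z' : T.Obj} {f : X ⟶ Y} {g : Y ⟶ Z}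
    {h : Z ⟶ T.tri.shift.obj X} {f' : X' ⟶ Y'} {g' : Y' ⟶ Z'} {h' : Z' ⟶ T.tri.shift.obj X'}
    (H : T.tri.dist f g h) (H' : T.tri.dist f' g' h') (a : X ≅ X') (b : Y ≅ Y')
    (e : f ≫ b.hom = a.hom ≫ f') :
    ∃ c : Z ≅ Z', g ≫ c.hom = b.hom ≫ g' ∧ h ≫ T.tri.shift.map a.hom = c.hom ≫ h' := by
  obtain ⟨i, h₁, h₂⟩ := exists_iso_of_arrow_iso _ _ ((T.dist_iff f g h).1 H)
    ((T.dist_iff f' g' h').1 H') (Arrow.isoMk a b e.symm)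
  change i.hom.hom₁ = a.hom at h₁
  change i.hom.hom₂ = b.hom at h₂
  obtain ⟨c, hc⟩ : ∃ c : Z ≅ Z', c = Triangle.π₃.mapIso i := ⟨_, rfl⟩
  have e₂ : g ≫ c.hom = b.hom ≫ g' := by
    subst hc
    exact i.hom.comm₂.trans (congrArg (· ≫ g') h₂)
  have e₃ : (h ≫ T.shiftIso.inv.app X) ≫ (shiftFunctor T.Obj (1 : ℤ)).map a.hom =
      c.hom ≫ h' ≫ T.shiftIso.inv.app X' := by
    subst hc
    exact (congrArg (fun x : X ⟶ X' => (h ≫ T.shiftIso.inv.app X) ≫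
      (shiftFunctor T.Obj (1 : ℤ)).map x) h₁).symm.trans i.hom.comm₃
  refine ⟨c, e₂, ?_⟩
  rw [Category.assoc, ← NatTrans.naturality] at e₃
  rw [← cancel_mono (T.shiftIso.inv.app X'), Category.assoc, e₃, Category.assoc]

/-- A functor that makes one Verdier quotient isomorphic to another one is a functor of triangulated
categories: every triangle of a Verdier quotient is isomorphic to the image of a triangle. -/
theorem isStrictTriangulatedFunctor_of_comp {T V Q : TriCat.{u}} {D : ObjectProperty T.Obj}
    {p : T.Obj ⥤ V.Obj} {K : V.Obj ⥤ Q.Obj} {L : Q.Obj ⥤ V.Obj} (hp : IsVerdierQuotient T D V p)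
    (hq : IsStrictTriangulatedFunctor (p ⋙ K)) (h₁ : K ⋙ L = 𝟭 _) (h₂ : L ⋙ K = 𝟭 _)
    [D.IsTriangulated] :
    IsStrictTriangulatedFunctor K := by
  have hp' : IsStrictLocalization (T.coneIn D) p := ⟨hp.inverts, hp.existsUnique_lift⟩
  have := hp'.isLocalization
  have : (T.coneIn D).HasLeftCalculusOfFractions := by
    rw [T.coneIn_eq_trW]
    infer_instance
  have := isEquivalence_of_inverse h₁ h₂
  obtain ⟨ep, hp₁⟩ := hp.isTriangulated
  obtain ⟨eq, hq₁⟩ := hq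
  have eK : V.tri.shift ⋙ K = K ⋙ Q.tri.shift := by
    refine hp'.hom_ext ?_
    rw [← Functor.assoc, ← ep]
    exact eq
  refine ⟨eK, ⟨Functor.additive_of_preserves_binary_products K, ?_⟩⟩
  intro A B Z a b c H
  -- The first map of the triangle is isomorphic to `p.map f` for some `f`, so the triangle is
  -- isomorphic to the image of a triangle on `f`.
  have := Localization.essSurj_mapArrow p (T.coneIn D)
  let f := p.mapArrow.objPreimage (Arrow.mk a)
  let i : Arrow.mk a ≅ p.mapArrow.obj f := (p.mapArrow.objObjPreimageIso (Arrow.mk a)).symm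
  let u : A ≅ p.obj f.left := Arrow.leftFunc.mapIso i
  let v : B ≅ p.obj f.right := Arrow.rightFunc.mapIso i
  have huv : a ≫ v.hom = u.hom ≫ p.map f.hom := i.hom.w.symm
  obtain ⟨Z', g, h, H'⟩ := T.isTriangulated.exists_dist f.hom
  obtain ⟨w, w₁, w₂⟩ := V.exists_iso_of_iso H (hp₁.map_dist _ _ _ H') u v huv
  refine Q.isTriangulated.dist_of_iso _ _ _ _ _ _ (K.mapIso u).symm (K.mapIso v).symm
    (K.mapIso w).symm ?_ ?_ ?_ (hq₁.map_dist _ _ _ H')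
  · change K.map (p.map f.hom) ≫ K.map v.inv = K.map u.inv ≫ K.map a
    rw [← K.map_comp, ← K.map_comp]
    exact congrArg K.map (by rw [Iso.comp_inv_eq, Category.assoc, huv, Iso.inv_hom_id_assoc])
  · change K.map (p.map g) ≫ K.map w.inv = K.map v.inv ≫ K.map b
    rw [← K.map_comp, ← K.map_comp]
    exact congrArg K.map (by rw [Iso.comp_inv_eq, Category.assoc, w₁, Iso.inv_hom_id_assoc])
  · have e : (eqToIso eq).hom.app f.left =
        K.map ((eqToIso ep).hom.app f.left) ≫ (eqToIso eK).hom.app (p.obj f.left) := by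
      simp [eqToHom_app, eqToHom_map]
    change (K.map (p.map h) ≫ (eqToIso eq).hom.app f.left) ≫ Q.tri.shift.map (K.map u.inv) =
      K.map w.inv ≫ K.map c ≫ (eqToIso eK).hom.app A
    have n := (eqToIso eK).hom.naturality u.inv
    change K.map (V.tri.shift.map u.inv) ≫ _ = _ ≫ Q.tri.shift.map (K.map u.inv) at n
    rw [e, Category.assoc, Category.assoc, ← n, ← K.map_comp_assoc, ← K.map_comp_assoc,
      ← K.map_comp_assoc]
    congr 2
    have w₃ := congrArg (· ≫ V.tri.shift.map u.inv) w₂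
    simp only [Category.assoc, ← Functor.map_comp, Iso.hom_inv_id] at w₃
    rw [CategoryTheory.Functor.map_id, Category.comp_id] at w₃
    rw [Iso.eq_inv_comp, w₃, Category.assoc]

/-- Verdier quotients are unique up to a unique isomorphism of triangulated categories. -/
theorem IsVerdierQuotient.exists_iso {T V Q : TriCat.{u}} {D : ObjectProperty T.Obj}
    [D.IsTriangulated] {p : T.Obj ⥤ V.Obj} {q : T.Obj ⥤ Q.Obj} (hp : IsVerdierQuotient T D V p)
    (hq : IsVerdierQuotient T D Q q) :
    ∃ Φ : V.Obj ⥤ Q.Obj, IsTriangulatedIso Φ ∧ p ⋙ Φ = q ∧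
      ∀ Ψ : V.Obj ⥤ Q.Obj, p ⋙ Ψ = q → Ψ = Φ := by
  have hp' : IsStrictLocalization (T.coneIn D) p := ⟨hp.inverts, hp.existsUnique_lift⟩
  have hq' : IsStrictLocalization (T.coneIn D) q := ⟨hq.inverts, hq.existsUnique_lift⟩
  obtain ⟨K, L, hK, hL, h₁, h₂⟩ := hp'.exists_iso hq'
  refine ⟨K, ⟨isStrictTriangulatedFunctor_of_comp hp (hK.symm ▸ hq.isTriangulated) h₁ h₂, L,
    isStrictTriangulatedFunctor_of_comp hq (hL.symm ▸ hp.isTriangulated) h₂ h₁, h₁, h₂⟩, hK,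
    fun Ψ hΨ => hp'.hom_ext (hΨ.trans hK.symm)⟩

end
end Enlarge

/-! ### Enlargement of thick subcategories and quotients -/

namespace Enlarge
open Superstructure
variable {S W : Type u} {star : Superstructure S → Superstructure W}

section
open Pretriangulated
variable {T : TriCat.{u}} {P : ObjectProperty T.Obj}

theorem TriCat.isStableUnderShift [P.IsClosedUnderIsomorphisms]
    (h : ∀ X, P (T.tri.shift.obj X) ↔ P X) : P.IsStableUnderShift ℤ := by
  have h₁ : ∀ X : T.Obj, P ((shiftFunctor T.Obj (1 : ℤ)).obj X) ↔ P X := fun X =>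
    (P.prop_iff_of_iso (T.shiftIso.app X)).trans (h X)
  have h₂ : ∀ (n : ℤ) (X : T.Obj), P ((shiftFunctor T.Obj n).obj X) ↔ P X := by
    intro n X
    induction n using Int.induction_on with
    | zero => exact P.prop_iff_of_iso ((shiftFunctorZero T.Obj ℤ).app X)
    | succ n ih =>
      rw [← ih, ← h₁ ((shiftFunctor T.Obj (n : ℤ)).obj X)]
      exact P.prop_iff_of_iso ((shiftFunctorAdd T.Obj (n : ℤ) 1).app X)
    | pred n ih =>
      rw [← ih, ← h₁]
      exact P.prop_iff_of_iso ((shiftFunctorAdd' T.Obj (-n - 1 : ℤ) 1 (-n) (by ring)).symm.app X)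
  exact ⟨fun n => ⟨fun X hX => (h₂ n X).2 hX⟩⟩

/-- A full subcategory is triangulated if it is stable under the translations and every morphism in
it has some cone in it. -/
theorem TriCat.isTriangulated_of_cones [P.IsClosedUnderIsomorphisms] [P.ContainsZero]
    (h : ∀ X, P (T.tri.shift.obj X) ↔ P X)
    (hP : ∀ ⦃X Y : T.Obj⦄ (f : X ⟶ Y), P X → P Y →
      ∃ (Z : T.Obj) (g : Y ⟶ Z) (h : Z ⟶ T.tri.shift.obj X), T.tri.dist f g h ∧ P Z) :
    P.IsTriangulated := by
  have := T.isStableUnderShift h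
  have : P.IsTriangulatedClosed₃ := .mk' fun X hX h₁ h₂ => by
    obtain ⟨Z, g, k, H, hZ⟩ := hP X.mor₁ h₁ h₂
    obtain ⟨c, -⟩ := T.exists_iso_of_iso H hX (Iso.refl _) (Iso.refl _) (by simp)
    exact P.prop_of_iso c hZ
  have := ObjectProperty.IsTriangulatedClosed₂.of_isTriangulatedClosed₃ (P := P)
  exact { }

end

theorem isZero_of_id_add_id {C : Type u} [Category.{u} C] [Preadditive C] {X : C}
    (h : 𝟙 X + 𝟙 X = 𝟙 X) : IsZero X :=
  (IsZero.iff_id_eq_zero X).2 (left_eq_add.1 h.symm)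

theorem nonempty_isColimit_binaryCofan_iff {C : Type u} [Category.{u} C] {X Y Z : C} (i : X ⟶ Z)
    (j : Y ⟶ Z) : Nonempty (IsColimit (BinaryCofan.mk i j)) ↔
      ∀ (V : C) (f : X ⟶ V) (g : Y ⟶ V), ∃ h : Z ⟶ V, (i ≫ h = f ∧ j ≫ h = g) ∧
        ∀ k : Z ⟶ V, i ≫ k = f → j ≫ k = g → k = h := by
  constructor
  · rintro ⟨hc⟩ V f g
    obtain ⟨l, h₁, h₂⟩ := BinaryCofan.IsColimit.desc' hc f g
    refine ⟨l, ⟨h₁, h₂⟩, fun k k₁ k₂ => BinaryCofan.IsColimit.hom_ext hc ?_ ?_⟩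
    · exact k₁.trans h₁.symm
    · exact k₂.trans h₂.symm
  · intro h
    choose d hd hu using h
    exact ⟨BinaryCofan.isColimitMk (fun s => d _ s.inl s.inr)
      (fun s => (hd _ _ _).1) (fun s => (hd _ _ _).2) (fun s m h₁ h₂ => hu _ _ _ _ h₁ h₂)⟩

section
variable {T D : TriData S}

open ZeroObject in
/-- Thick subcategories are closed under isomorphisms. -/
theorem IsThick.isClosedUnderIsomorphisms (h : IsThick T D) :
    (TriData.objectsOf h.isTriangulated D).IsClosedUnderIsomorphisms where
  of_iso {X Y} e hX := by
    -- `X` is the direct sum of `Y` and a zero object.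
    refine h.thick Y (0 : h.isTriangulated.triCat.Obj) X e.inv 0
      ((nonempty_isColimit_binaryCofan_iff _ _).2 fun V f g => ⟨e.hom ≫ f, ⟨?_, ?_⟩, ?_⟩) hX
    · simp
    · exact (isZero_zero _).eq_of_src _ _
    · intro k h₁ _
      rw [← h₁, Iso.hom_inv_id_assoc]

theorem IsTriangulatedSubcategory.shift_obj_iff (h : IsTriangulatedSubcategory T D)
    (X : h.isTriangulated.triCat.Obj) :
    TriData.objectsOf h.isTriangulated D (h.isTriangulated.triCat.tri.shift.obj X) ↔
      TriData.objectsOf h.isTriangulated D X := by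
  have hT := h.isTriangulated
  have hD := h.isTriangulated_sub
  let X' : hT.isCat.Obj := X
  change app T.shift X'.1 ∈ D.mor ↔ X'.1 ∈ D.mor
  constructor
  · intro hX
    let Y : hD.isCat.Obj := ⟨app T.shift X'.1, hX, (h.src_eq _ hX).trans
      ((hT.isFunctor_shift.functor hT.isCat hT.isCat).obj X').2.2⟩
    obtain ⟨G, h₁, h₂⟩ := hD.triCat.isTriangulated.shift_automorphism
    obtain ⟨A, hA⟩ := (bijective_obj_of_inverse h₁ h₂).2 Y
    let A' : hD.isCat.Obj := A
    have hA' : app D.shift A'.1 = app T.shift X'.1 := congrArg Subtype.val hA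
    rw [h.shift_eq _ A'.2.1] at hA'
    let B : hT.isCat.Obj := ⟨A'.1, h.mor_sub _ A'.2.1, (h.src_eq _ A'.2.1).symm.trans A'.2.2⟩
    obtain ⟨G, h₁, h₂⟩ := hT.triCat.isTriangulated.shift_automorphism
    have e : B = X' := (bijective_obj_of_inverse h₁ h₂).1 (Subtype.ext hA')
    rw [← e]
    exact A'.2.1
  · intro hX
    rw [← h.shift_eq _ hX]
    exact app_mem hD.isFunctor_shift.isFun hX

theorem IsTriangulatedSubcategory.containsZero (h : IsTriangulatedSubcategory T D) :
    (TriData.objectsOf h.isTriangulated D).ContainsZero := by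
  have hT := h.isTriangulated
  have hD := h.isTriangulated_sub
  obtain ⟨A, hA⟩ := hD.triCat.isTriangulated.hasZeroObject
  let A' : hD.isCat.Obj := A
  have hA' := A'.2.1
  let B : hT.isCat.Obj := ⟨A'.1, h.mor_sub _ hA', (h.src_eq _ hA').symm.trans A'.2.2⟩
  -- An object is zero if its identity is idempotent for the addition, which `D` shares with `T`.
  have e : triple A'.1 A'.1 A'.1 ∈ D.add :=
    (hD.add_iff (X := A) (Y := A) (𝟙 A) (𝟙 A) (𝟙 A)).2 (hA.eq_of_src _ _)
  rw [h.add_iff _ hA' _ hA' _ hA' rfl rfl rfl rfl] at e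
  have e' := (hT.add_iff (X := B) (Y := B) (𝟙 _) (𝟙 _) (𝟙 _)).1 e
  exact ⟨⟨B, isZero_of_id_add_id (C := hT.triCat.Obj) e', hA'⟩⟩

/-- The full subcategory of the ambient category on the objects of a thick subcategory is
triangulated in the sense of Mathlib. -/
theorem IsThick.isTriangulated_objectsOf (h : IsThick T D) :
    (TriData.objectsOf h.isTriangulated D).IsTriangulated := by
  have hT := h.isTriangulated
  have hD := h.isTriangulated_sub
  have := h.isClosedUnderIsomorphisms
  have := h.toIsTriangulatedSubcategory.containsZero
  refine TriCat.isTriangulated_of_cones h.toIsTriangulatedSubcategory.shift_obj_iff ?_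
  intro X Y f hX hY
  let X' : hT.isCat.Obj := X
  let Y' : hT.isCat.Obj := Y
  let f' : X' ⟶ Y' := f
  change X'.1 ∈ D.mor at hX
  change Y'.1 ∈ D.mor at hY
  have hf : f'.1 ∈ D.mor := h.full _ f'.2.1 (f'.2.2.1.symm ▸ hX) (f'.2.2.2.symm ▸ hY)
  let A : hD.isCat.Obj := ⟨X'.1, hX, (h.src_eq _ hX).trans X'.2.2⟩
  let B : hD.isCat.Obj := ⟨Y'.1, hY, (h.src_eq _ hY).trans Y'.2.2⟩
  let k : A ⟶ B := ⟨f'.1, hf, (h.src_eq _ hf).trans f'.2.2.1, (h.tgt_eq _ hf).trans f'.2.2.2⟩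
  obtain ⟨Z, g, l, H⟩ := hD.triCat.isTriangulated.exists_dist (X := A) (Y := B) k
  let Z' : hD.isCat.Obj := Z
  let g' : B ⟶ Z' := g
  let l' : Z' ⟶ (hD.isFunctor_shift.functor hD.isCat hD.isCat).obj A := l
  have hZ := Z'.2.1
  have hg := g'.2.1
  have hl := l'.2.1
  have H' : triple f'.1 g'.1 l'.1 ∈ D.dist := H
  let V : hT.isCat.Obj := ⟨Z'.1, h.mor_sub _ hZ, (h.src_eq _ hZ).symm.trans Z'.2.2⟩
  exact ⟨V, (⟨g'.1, h.mor_sub _ hg, (h.src_eq _ hg).symm.trans g'.2.2.1,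
      (h.tgt_eq _ hg).symm.trans g'.2.2.2⟩ : T.Hom Y'.1 V.1),
    (⟨l'.1, h.mor_sub _ hl, (h.src_eq _ hl).symm.trans l'.2.2.1,
      ((h.tgt_eq _ hl).symm.trans l'.2.2.2).trans (h.shift_eq _ hX)⟩ :
        T.Hom V.1 (app T.shift X'.1)), (h.dist_iff _ hf _ hg _ hl).1 H', hZ⟩

end

section
variable {T D : TriData S}

/-- Closure under direct summands, in terms of the morphisms of the category. -/
def IsClosedUnderSummands {C : CatData S} (hC : C.IsCat) (M : Superstructure S) : Prop :=
  ∀ (X Y Z : hC.Obj) (i : X ⟶ Z) (j : Y ⟶ Z), (∀ (V : hC.Obj) (f : X ⟶ V) (g : Y ⟶ V),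
    ∃ h : Z ⟶ V, (i ≫ h = f ∧ j ≫ h = g) ∧ ∀ k : Z ⟶ V, i ≫ k = f → j ≫ k = g → k = h) →
      Z.1 ∈ M → X.1 ∈ M

theorem IsClosedUnderSummands.enlarge {ι : S ↪ W} (hstar : IsEnlargement ι star) {C : CatData S}
    {hC : C.IsCat} {M : Superstructure S} (h : IsClosedUnderSummands hC M) :
    IsClosedUnderSummands (hC.enlarge hstar) (star M) := by
  refine (DefFm.transfer hstar ?_).1 h
  repeat' first
    | exact DefTm.of_val 0 (Nat.zero_lt_succ _) (fun _ => rfl) (fun _ => rfl)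
    | exact DefTm.of_val 1 (Nat.le_add_left _ _) (fun _ => rfl) (fun _ => rfl)
    | exact DefTm.of_val 2 (Nat.le_add_left _ _) (fun _ => rfl) (fun _ => rfl)
    | exact DefTm.of_val 3 (Nat.le_add_left _ _) (fun _ => rfl) (fun _ => rfl)
    | exact DefTm.of_val 4 (Nat.le_add_left _ _) (fun _ => rfl) (fun _ => rfl)
    | exact DefTm.of_val 5 (Nat.le_add_left _ _) (fun _ => rfl) (fun _ => rfl)
    | exact DefTm.of_val 6 (Nat.le_add_left _ _) (fun _ => rfl) (fun _ => rfl)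
    | exact DefTm.of_val 7 (Nat.le_add_left _ _) (fun _ => rfl) (fun _ => rfl)
    | exact DefTm.of_val 8 (Nat.le_add_left _ _) (fun _ => rfl) (fun _ => rfl)
    | exact DefTm.of_val 9 (Nat.le_add_left _ _) (fun _ => rfl) (fun _ => rfl)
    | exact DefTm.const _
    | with_reducible apply DefTm.comp
    | with_reducible apply DefFm.mem
    | with_reducible apply DefFm.eq_hom
    | with_reducible apply DefFm.and
    | with_reducible apply DefFm.imp
    | apply DefFm.forall_obj
    | with_reducible apply DefFm.forall_hom
    | with_reducible apply DefFm.exists_hom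

theorem IsTriangulatedSubcategory.enlarge {ι : S ↪ W} (hstar : IsEnlargement ι star)
    (h : IsTriangulatedSubcategory T D) :
    IsTriangulatedSubcategory (T.enlarge star) (D.enlarge star) := by
  refine ⟨h.isTriangulated.enlarge hstar, h.isTriangulated_sub.enlarge hstar,
    (DefFm.transfer hstar ?_).1 h.mor_sub, (DefFm.transfer hstar ?_).1 h.src_eq,
    (DefFm.transfer hstar ?_).1 h.tgt_eq, (DefFm.transfer hstar ?_).1 h.comp_iff,
    (DefFm.transfer hstar ?_).1 h.full, (DefFm.transfer hstar ?_).1 h.add_iff,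
    (DefFm.transfer hstar ?_).1 h.shift_eq, (DefFm.transfer hstar ?_).1 h.dist_iff⟩
  repeat' first
    | exact DefTm.of_val 0 (Nat.zero_lt_succ _) (fun _ => rfl) (fun _ => rfl)
    | exact DefTm.of_val 1 (Nat.le_add_left _ _) (fun _ => rfl) (fun _ => rfl)
    | exact DefTm.of_val 2 (Nat.le_add_left _ _) (fun _ => rfl) (fun _ => rfl)
    | apply DefTm.const
    | apply DefFm.forall_mem
    | apply DefFm.mem
    | apply DefFm.eq
    | apply DefFm.iff
    | apply DefFm.imp
    | apply DefTm.triple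
    | apply DefTm.app

theorem IsThick.isClosedUnderSummands (h : IsThick T D) :
    IsClosedUnderSummands h.isTriangulated.isCat D.mor :=
  fun X Y Z i j hZ => h.thick X Y Z i j ((nonempty_isColimit_binaryCofan_iff _ _).2 hZ)

theorem IsThick.enlarge {ι : S ↪ W} (hstar : IsEnlargement ι star) (h : IsThick T D) :
    IsThick (T.enlarge star) (D.enlarge star) :=
  { toIsTriangulatedSubcategory := h.toIsTriangulatedSubcategory.enlarge hstar
    thick := fun X Y Z i j hZ => h.isClosedUnderSummands.enlarge hstar X Y Z i j
      ((nonempty_isColimit_binaryCofan_iff _ _).1 hZ) }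

end

section
variable {C C' : CatData S} {s R M : Superstructure S}

/-- The morphisms that have a cone, among the triangles in `R`, that is an element of `M`. -/
def CatData.IsCat.coneIn (hC : C.IsCat) (hs : IsFunctor C C s) (R M : Superstructure S) :
    MorphismProperty hC.Obj :=
  fun X Y f => ∃ (Z : hC.Obj) (g : Y ⟶ Z) (h : Z ⟶ (hC.triangles hs R).shift.obj X),
    (hC.triangles hs R).dist f g h ∧ Z.1 ∈ M

theorem IsFractionLocalization.enlarge {ι : S ↪ W} (hstar : IsEnlargement ι star) {hC : C.IsCat}
    {hC' : C'.IsCat} {hs : IsFunctor C C s} {q : Superstructure S} {hq : IsFunctor C C' q}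
    (h : IsFractionLocalization (hC.coneIn hs R M) (hq.functor hC hC')) :
    IsFractionLocalization ((hC.enlarge hstar).coneIn (hs.enlarge hstar) (star R) (star M))
      ((hq.enlarge hstar).functor (hC.enlarge hstar) (hC'.enlarge hstar)) := by
  refine ⟨(DefFm.transfer hstar ?_).1 h.inverts, (DefFm.transfer hstar ?_).1 h.obj_injective,
    (DefFm.transfer hstar ?_).1 h.obj_surjective, (DefFm.transfer hstar ?_).1 h.exists_fraction,
    (DefFm.transfer hstar ?_).1 h.exists_comp_eq⟩
  all_goals try unfold CatData.IsCat.coneIn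
  repeat' first
    | (refine DefTm.of_val 0 (Nat.le_add_left _ _) ?_ ?_ <;> intro _ <;> with_reducible rfl)
    | (refine DefTm.of_val 1 (Nat.le_add_left _ _) ?_ ?_ <;> intro _ <;> with_reducible rfl)
    | (refine DefTm.of_val 2 (Nat.le_add_left _ _) ?_ ?_ <;> intro _ <;> with_reducible rfl)
    | (refine DefTm.of_val 3 (Nat.le_add_left _ _) ?_ ?_ <;> intro _ <;> with_reducible rfl)
    | (refine DefTm.of_val 4 (Nat.le_add_left _ _) ?_ ?_ <;> intro _ <;> with_reducible rfl)
    | (refine DefTm.of_val 6 (Nat.le_add_left _ _) ?_ ?_ <;> intro _ <;> with_reducible rfl)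
    | with_reducible apply DefTm.functor_obj
    | with_reducible apply DefTm.functor_map
    | with_reducible apply DefTm.shift_obj
    | with_reducible apply DefTm.comp
    | with_reducible apply DefFm.dist
    | with_reducible apply DefFm.mem
    | with_reducible apply DefFm.eq_hom
    | with_reducible apply DefFm.eq_obj
    | with_reducible apply DefFm.and
    | with_reducible apply DefFm.imp
    | with_reducible apply DefFm.forall_obj
    | with_reducible apply DefFm.exists_obj
    | with_reducible apply DefFm.forall_hom
    | with_reducible apply DefFm.exists_hom
    | with_reducible apply DefTm.id
    | with_reducible exact DefTm.const _

end

section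
variable {T D Q : TriData S} {q : Superstructure S}

/-- A quotient inside the superstructure in terms of fractions. -/
theorem isQuotient_iff : IsQuotient T D Q q ↔
    ∃ (hD : IsThick T D) (hQ : Q.IsTriangulated) (hq : IsFunctor T.toCatData Q.toCatData q),
      IsStrictTriangulatedFunctor (hq.triFunctor hD.isTriangulated hQ) ∧
      IsFractionLocalization (hD.isTriangulated.isCat.coneIn hD.isTriangulated.isFunctor_shift
        T.dist D.mor) (hq.functor hD.isTriangulated.isCat hQ.isCat) := by
  refine exists_congr fun hD => exists_congr fun hQ => exists_congr fun hq => ?_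
  have := hD.isTriangulated_objectsOf
  exact isVerdierQuotient_iff

theorem IsQuotient.enlarge {ι : S ↪ W} (hstar : IsEnlargement ι star) (h : IsQuotient T D Q q) :
    IsQuotient (T.enlarge star) (D.enlarge star) (Q.enlarge star) (star q) := by
  rw [isQuotient_iff] at h ⊢
  obtain ⟨hD, hQ, hq, h₁, h₂⟩ := h
  obtain ⟨_, _, _, h₁'⟩ := IsStrictTriFunctor.enlarge hstar ⟨hD.isTriangulated, hQ, hq, h₁⟩
  exact ⟨hD.enlarge hstar, hQ.enlarge hstar, hq.enlarge hstar, h₁', h₂.enlarge hstar⟩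

theorem IsQuotient.isCanonicallyIsoToQuotient (h : IsQuotient T D Q q) :
    IsCanonicallyIsoToQuotient T D Q q := by
  obtain ⟨hD, hQ, hq, h⟩ := h
  have := hD.isTriangulated_objectsOf
  exact ⟨hD, hQ, hq, fun V p hp => hp.exists_iso h⟩

end
end Enlarge

/-! ### Categories isomorphic to categories inside the superstructure -/

namespace Enlarge
open Superstructure
variable {S : Type u}

namespace Superstructure

theorem range_mk_mono : Monotone fun n => Set.range (mk (S := S) n) :=
  monotone_nat_of_le_succ fun n => by
    rintro _ ⟨x, rfl⟩
    exact ⟨Level.up n x, mk_up n x⟩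

theorem exists_bound (X : Superstructure S) : ∃ n, ∀ z ∈ X, z ∈ Set.range (mk (S := S) n) := by
  obtain ⟨n, hn⟩ := exists_rep X
  refine ⟨n, fun z hz => ?_⟩
  obtain ⟨m, hm, h⟩ := rank_lt hz n (hn n le_rfl)
  exact range_mk_mono hm.le h

theorem exists_set_of_bound {n : ℕ} {p : Superstructure S → Prop}
    (h : ∀ z, p z → z ∈ Set.range (mk (S := S) n)) :
    ∃ X : Superstructure S, IsSet X ∧ ∀ z, z ∈ X ↔ p z := by
  refine ⟨ofLevelSet {x : Level S n | p (mk n x)}, isSet_ofLevelSet _, fun z => ?_⟩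
  rw [mem_ofLevelSet]
  constructor
  · rintro ⟨x, hx, rfl⟩
    exact hx
  · intro hz
    obtain ⟨x, rfl⟩ := h z hz
    exact ⟨x, hz, rfl⟩

theorem upair_mem_range {n : ℕ} {a b : Superstructure S} (ha : a ∈ Set.range (mk (S := S) n))
    (hb : b ∈ Set.range (mk (S := S) n)) : upair a b ∈ Set.range (mk (S := S) (n + 1)) := by
  obtain ⟨x, rfl⟩ := ha
  obtain ⟨y, rfl⟩ := hb
  refine ⟨(show Level S (n + 1) from Sum.inr {x, y}), set_ext (isSet_ofLevelSet {x, y})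
    (isSet_upair _ _) fun z => ?_⟩
  rw [mem_upair]
  refine (mem_ofLevelSet {x, y} z).trans ?_
  simp only [Set.mem_insert_iff, Set.mem_singleton_iff, exists_eq_or_imp, exists_eq_left]
  exact or_congr eq_comm eq_comm

theorem opair_mem_range {n : ℕ} {a b : Superstructure S} (ha : a ∈ Set.range (mk (S := S) n))
    (hb : b ∈ Set.range (mk (S := S) n)) : opair a b ∈ Set.range (mk (S := S) (n + 2)) :=
  upair_mem_range (range_mk_mono n.le_succ ha) (upair_mem_range ha hb)

theorem triple_inj {a b c a' b' c' : Superstructure S} (h : triple a b c = triple a' b' c') :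
    a = a' ∧ b = b' ∧ c = c' := by
  obtain ⟨h₁, rfl⟩ := opair_inj h
  obtain ⟨rfl, rfl⟩ := opair_inj h₁
  exact ⟨rfl, rfl, rfl⟩

/-- Every ternary relation on a set of the superstructure is an element of the superstructure. -/
theorem exists_isTernary (A : Superstructure S)
    (p : Superstructure S → Superstructure S → Superstructure S → Prop) :
    ∃ R, IsTernary R A ∧ ∀ a ∈ A, ∀ b ∈ A, ∀ c ∈ A, triple a b c ∈ R ↔ p a b c := by
  obtain ⟨n, hn⟩ := exists_bound A
  obtain ⟨R, hR, h⟩ := exists_set_of_bound (n := n + 4)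
    (p := fun z => ∃ a ∈ A, ∃ b ∈ A, ∃ c ∈ A, p a b c ∧ z = triple a b c) (by
      rintro _ ⟨a, ha, b, hb, c, hc, -, rfl⟩
      exact opair_mem_range (opair_mem_range (hn a ha) (hn b hb))
        (range_mk_mono (n.le_add_right 2) (hn c hc)))
  refine ⟨R, ⟨hR, fun z hz => ?_⟩, fun a ha b hb c hc => ?_⟩
  · obtain ⟨a, ha, b, hb, c, hc, -, e⟩ := (h z).1 hz
    exact ⟨a, ha, b, hb, c, hc, e⟩
  · rw [h]
    constructor
    · rintro ⟨a', -, b', -, c', -, hp, e⟩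
      obtain ⟨rfl, rfl, rfl⟩ := triple_inj e
      exact hp
    · exact fun hp => ⟨a, ha, b, hb, c, hc, hp, rfl⟩

/-- Every map between sets of the superstructure is an element of the superstructure. -/
theorem exists_isFun {A B : Superstructure S} (F : Superstructure S → Superstructure S)
    (hF : ∀ a ∈ A, F a ∈ B) : ∃ f, IsFun f A B ∧ ∀ a ∈ A, app f a = F a := by
  obtain ⟨n, hn⟩ := exists_bound A
  obtain ⟨m, hm⟩ := exists_bound B
  obtain ⟨f, hf, h⟩ := exists_set_of_bound (n := max n m + 2)
    (p := fun z => ∃ a ∈ A, z = opair a (F a)) (by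
      rintro _ ⟨a, ha, rfl⟩
      exact opair_mem_range (range_mk_mono (le_max_left n m) (hn a ha))
        (range_mk_mono (le_max_right n m) (hm _ (hF a ha))))
  have hu : ∀ a ∈ A, ∃! b, opair a b ∈ f := fun a ha => by
    refine ⟨F a, (h _).2 ⟨a, ha, rfl⟩, fun b hb => ?_⟩
    obtain ⟨a', -, e⟩ := (h _).1 hb
    obtain ⟨rfl, rfl⟩ := opair_inj e
    rfl
  refine ⟨f, ⟨hf, fun z hz => ?_, hu⟩, fun a ha => app_eq (hu a ha) ((h _).2 ⟨a, ha, rfl⟩)⟩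
  obtain ⟨a, ha, e⟩ := (h z).1 hz
  exact ⟨a, ha, F a, hF a ha, e⟩

end Superstructure

/-- The arrows of a category, with their source and target. -/
abbrev Arrows (E : Type u) [Category.{u} E] : Type u := Σ X Y : E, (X ⟶ Y)

section
variable {E : Type u} [Category.{u} E]

/-- A category whose arrows embed into a stage of the superstructure is isomorphic to a category
inside the superstructure. -/
theorem exists_catData {n : ℕ} (c : Arrows E → Superstructure S) (hc : Function.Injective c)
    (hn : ∀ a, c a ∈ Set.range (mk (S := S) n)) :
    ∃ (C : CatData S) (hC : C.IsCat) (K : E ⥤ hC.Obj) (L : hC.Obj ⥤ E),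
      K ⋙ L = 𝟭 E ∧ L ⋙ K = 𝟭 hC.Obj := by
  obtain ⟨M, hM, hMc⟩ := exists_set_of_bound (p := fun z => ∃ a, c a = z)
    (by rintro _ ⟨a, rfl⟩; exact hn a)
  have hM' : ∀ a, c a ∈ M := fun a => (hMc _).2 ⟨a, rfl⟩
  obtain ⟨s, hs, hsc⟩ := exists_isFun (A := M) (B := M)
    (Function.extend c (fun a => c ⟨a.1, a.1, 𝟙 a.1⟩) fun _ => empty) (by
      intro z hz
      obtain ⟨a, rfl⟩ := (hMc z).1 hz
      rw [hc.extend_apply]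
      exact hM' _)
  obtain ⟨t, ht, htc⟩ := exists_isFun (A := M) (B := M)
    (Function.extend c (fun a => c ⟨a.2.1, a.2.1, 𝟙 a.2.1⟩) fun _ => empty) (by
      intro z hz
      obtain ⟨a, rfl⟩ := (hMc z).1 hz
      rw [hc.extend_apply]
      exact hM' _)
  have hs' : ∀ {X Y : E} (f : X ⟶ Y), app s (c ⟨X, Y, f⟩) = c ⟨X, X, 𝟙 X⟩ := fun f =>
    (hsc _ (hM' _)).trans (hc.extend_apply _ _ _)
  have ht' : ∀ {X Y : E} (f : X ⟶ Y), app t (c ⟨X, Y, f⟩) = c ⟨Y, Y, 𝟙 Y⟩ := fun f =>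
    (htc _ (hM' _)).trans (hc.extend_apply _ _ _)
  obtain ⟨R, hR, hRc⟩ := exists_isTernary M (fun x y z => ∃ (X Y Z : E) (f : X ⟶ Y) (g : Y ⟶ Z),
    x = c ⟨Y, Z, g⟩ ∧ y = c ⟨X, Y, f⟩ ∧ z = c ⟨X, Z, f ≫ g⟩)
  have hR' : ∀ {X Y Z : E} (f : X ⟶ Y) (g : Y ⟶ Z) (k : X ⟶ Z),
      triple (c ⟨Y, Z, g⟩) (c ⟨X, Y, f⟩) (c ⟨X, Z, k⟩) ∈ R ↔ f ≫ g = k := by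
    intro X Y Z f g k
    rw [hRc _ (hM' _) _ (hM' _) _ (hM' _)]
    constructor
    · rintro ⟨X', Y', Z', f', g', e₁, e₂, e₃⟩
      cases hc e₁
      cases hc e₂
      cases hc e₃
      rfl
    · rintro rfl
      exact ⟨_, _, _, _, _, rfl, rfl, rfl⟩
  have hends : ∀ {X Y X' Y' X'' Y'' : E} {f : X ⟶ Y} {g : X' ⟶ Y'} {k : X'' ⟶ Y''},
      triple (c ⟨X, Y, f⟩) (c ⟨X', Y', g⟩) (c ⟨X'', Y'', k⟩) ∈ R →
        X = Y' ∧ Y = Y'' ∧ X' = X'' := by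
    intro X Y X' Y' X'' Y'' f g k h
    obtain ⟨A, B, D, f', g', e₁, e₂, e₃⟩ := (hRc _ (hM' _) _ (hM' _) _ (hM' _)).1 h
    cases hc e₁
    cases hc e₂
    cases hc e₃
    exact ⟨rfl, rfl, rfl⟩
  have hobj : ∀ {X Y : E}, c ⟨X, X, 𝟙 X⟩ = c ⟨Y, Y, 𝟙 Y⟩ → X = Y := fun e =>
    congrArg Sigma.fst (hc e)
  have hC : CatData.IsCat (⟨M, s, t, R⟩ : CatData S) := by
    refine ⟨hM, hs, ht, hR, ?_, ?_, ?_, ?_, ?_, ?_, ?_, ?_, ?_⟩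
    · intro f hf
      obtain ⟨⟨X, Y, f⟩, rfl⟩ := (hMc f).1 hf
      change app s (app s _) = app s _
      rw [hs', hs']
    · intro f hf
      obtain ⟨⟨X, Y, f⟩, rfl⟩ := (hMc f).1 hf
      change app t (app s _) = app s _
      rw [hs', ht']
    · intro f hf
      obtain ⟨⟨X, Y, f⟩, rfl⟩ := (hMc f).1 hf
      change app s (app t _) = app t _
      rw [ht', hs']
    · intro f hf
      obtain ⟨⟨X, Y, f⟩, rfl⟩ := (hMc f).1 hf
      change app t (app t _) = app t _
      rw [ht', ht']
    · intro f hf g hg k hk h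
      obtain ⟨⟨X, Y, f⟩, rfl⟩ := (hMc f).1 hf
      obtain ⟨⟨X', Y', g⟩, rfl⟩ := (hMc g).1 hg
      obtain ⟨⟨X'', Y'', k⟩, rfl⟩ := (hMc k).1 hk
      obtain ⟨rfl, rfl, rfl⟩ := hends h
      exact ⟨(hs' _).trans (ht' _).symm, (ht' _).trans (ht' _).symm, (hs' _).trans (hs' _).symm⟩
    · intro f hf g hg h
      obtain ⟨⟨X, Y, f⟩, rfl⟩ := (hMc f).1 hf
      obtain ⟨⟨X', Y', g⟩, rfl⟩ := (hMc g).1 hg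
      obtain rfl := hobj ((hs' _).symm.trans (h.trans (ht' _)))
      refine ⟨c ⟨X', Y, g ≫ f⟩, ⟨hM' _, (hR' _ _ _).2 rfl⟩, ?_⟩
      rintro k ⟨hk, h⟩
      obtain ⟨⟨X'', Y'', k⟩, rfl⟩ := (hMc k).1 hk
      obtain ⟨-, rfl, rfl⟩ := hends h
      rw [(hR' _ _ _).1 h]
    · intro f hf
      obtain ⟨⟨X, Y, f⟩, rfl⟩ := (hMc f).1 hf
      change triple _ (app s _) _ ∈ R
      rw [hs']
      exact (hR' _ _ _).2 (Category.id_comp _)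
    · intro f hf
      obtain ⟨⟨X, Y, f⟩, rfl⟩ := (hMc f).1 hf
      change triple (app t _) _ _ ∈ R
      rw [ht']
      exact (hR' _ _ _).2 (Category.comp_id _)
    · intro f₁ h₁ f₂ h₂ f₃ h₃ f₁₂ h₁₂ f₂₃ h₂₃ f₁₂₃ h₁₂₃ e₁ e₂ e₃
      obtain ⟨⟨X₁, Y₁, f₁⟩, rfl⟩ := (hMc _).1 h₁
      obtain ⟨⟨X₂, Y₂, f₂⟩, rfl⟩ := (hMc _).1 h₂
      obtain ⟨⟨X₃, Y₃, f₃⟩, rfl⟩ := (hMc _).1 h₃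
      obtain ⟨⟨_, _, f₁₂⟩, rfl⟩ := (hMc _).1 h₁₂
      obtain ⟨⟨_, _, f₂₃⟩, rfl⟩ := (hMc _).1 h₂₃
      obtain ⟨⟨_, _, f₁₂₃⟩, rfl⟩ := (hMc _).1 h₁₂₃
      obtain ⟨rfl, rfl, rfl⟩ := hends e₁
      obtain ⟨rfl, rfl, rfl⟩ := hends e₂
      obtain ⟨-, rfl, rfl⟩ := hends e₃
      rw [hR'] at e₁ e₂ e₃ ⊢
      rw [← e₂, ← e₁, ← e₃, Category.assoc]
  let K : E ⥤ hC.Obj :=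
    { obj := fun X => ⟨c ⟨X, X, 𝟙 X⟩, hM' _, hs' _⟩
      map := fun {X Y} f => ⟨c ⟨X, Y, f⟩, hM' _, hs' _, ht' _⟩
      map_id := fun X => rfl
      map_comp := fun f g => Subtype.ext (hC.comp_eq ((hR' f g _).2 rfl)).symm }
  have : K.Faithful := ⟨fun {X Y} f g e => by
    have e' : (⟨X, Y, f⟩ : Arrows E) = ⟨X, Y, g⟩ := hc (congrArg Subtype.val e)
    cases e'
    rfl⟩
  have : K.Full := ⟨fun {X Y} φ => by
    obtain ⟨⟨X', Y', f⟩, hf⟩ := (hMc _).1 φ.2.1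
    obtain rfl := hobj ((hs' f).symm.trans ((congrArg (app s) hf).trans φ.2.2.1))
    obtain rfl := hobj ((ht' f).symm.trans ((congrArg (app t) hf).trans φ.2.2.2))
    exact ⟨f, Subtype.ext hf⟩⟩
  obtain ⟨L, h₁, h₂⟩ := exists_inverse_functor K ⟨fun X Y e => hobj (congrArg Subtype.val e),
    fun X => by
      obtain ⟨⟨X', Y', f⟩, hf⟩ := (hMc _).1 X.2.1
      exact ⟨X', Subtype.ext ((hs' f).symm.trans ((congrArg (app s) hf).trans X.2.2))⟩⟩
  exact ⟨_, hC, K, L, h₁, h₂⟩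

end

section

instance [Infinite S] : ∀ n, Infinite (Level S n)
  | 0 => inferInstanceAs (Infinite S)
  | _ + 1 => inferInstanceAs (Infinite (S ⊕ Set _))

/-- The arrows of a localization of a small category inside the superstructure embed into a stage
of the superstructure. They are fractions, hence determined by pairs of elements of some stage, and
that stage, being infinite, is in bijection with the set of its pairs. -/
theorem exists_injective_arrows [Infinite S] {C : CatData S} {hC : C.IsCat} {E : Type u}
    [Category.{u} E] {V : MorphismProperty hC.Obj} {q : hC.Obj ⥤ E}
    (h : IsFractionLocalization V q) :
    ∃ (n : ℕ) (c : Arrows E → Superstructure S), Function.Injective c ∧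
      ∀ a, c a ∈ Set.range (mk (S := S) n) := by
  obtain ⟨n, hn⟩ := exists_bound C.mor
  -- `r a u v` says that `a` is the fraction with numerator `u` and denominator `v`.
  let r : Arrows E → Superstructure S → Superstructure S → Prop := fun a u v =>
    ∃ (X Y Z : hC.Obj) (f : X ⟶ Z) (s : Y ⟶ Z) (φ : q.obj X ⟶ q.obj Y), V s ∧
      φ ≫ q.map s = q.map f ∧ a = ⟨_, _, φ⟩ ∧ u = Subtype.val f ∧ v = Subtype.val s
  have h₁ : ∀ a, ∃ u v : Level S n, r a (mk n u) (mk n v) := by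
    rintro ⟨A, B, φ⟩
    obtain ⟨X, rfl⟩ := h.obj_surjective A
    obtain ⟨Y, rfl⟩ := h.obj_surjective B
    obtain ⟨Z, f, s, hs, e⟩ := h.exists_fraction X Y φ
    obtain ⟨u, hu⟩ := hn _ f.2.1
    obtain ⟨v, hv⟩ := hn _ s.2.1
    exact ⟨u, v, X, Y, Z, f, s, φ, hs, e, rfl, hu, hv⟩
  have h₂ : ∀ a b u v, r a u v → r b u v → a = b := by
    rintro _ _ _ _ ⟨X, Y, Z, f, s, φ, hs, e, rfl, rfl, rfl⟩
      ⟨X', Y', Z', f', s', φ', -, e', rfl, hf, hs'⟩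
    obtain rfl : X = X' := Subtype.ext
      (f.2.2.1.symm.trans ((congrArg (app C.src) hf).trans f'.2.2.1))
    obtain rfl : Z = Z' := Subtype.ext
      (f.2.2.2.symm.trans ((congrArg (app C.tgt) hf).trans f'.2.2.2))
    obtain rfl : Y = Y' := Subtype.ext
      (s.2.2.1.symm.trans ((congrArg (app C.src) hs').trans s'.2.2.1))
    obtain rfl : f = f' := Subtype.ext hf
    obtain rfl : s = s' := Subtype.ext hs'
    obtain ⟨k, hk, -⟩ := h.inverts s hs
    have : φ = φ' := by
      rw [← Category.comp_id φ, ← hk, ← Category.assoc, e, ← e', Category.assoc, hk,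
        Category.comp_id]
    rw [this]
  choose u v huv using h₁
  obtain ⟨e⟩ : Nonempty (Level S n × Level S n ≃ Level S n) := by
    rw [← Cardinal.eq, Cardinal.mk_prod, Cardinal.lift_id]
    exact Cardinal.mul_eq_self (Cardinal.aleph0_le_mk _)
  refine ⟨n, fun a => mk n (e (u a, v a)), fun a b hab => ?_, fun a => ⟨_, rfl⟩⟩
  have := e.injective (mk_injective n hab)
  obtain ⟨hu, hv⟩ := Prod.ext_iff.1 this
  exact h₂ a b _ _ (huv a) (by
    have := huv b
    rwa [← show u a = u b from hu, ← show v a = v b from hv] at this)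

end
end Enlarge

/-! ### Existence of quotients inside the superstructure -/

namespace Enlarge
open Superstructure
variable {S : Type u}

section
variable {C C' : CatData S}

theorem CatData.IsCat.triple_mem_comp_iff (hC : C.IsCat) {X Y Z : hC.Obj} (f : X ⟶ Y) (g : Y ⟶ Z)
    (k : X ⟶ Z) : triple g.1 f.1 k.1 ∈ C.comp ↔ f ≫ g = k := by
  constructor
  · exact fun h => Subtype.ext (hC.comp_eq h)
  · rintro rfl
    exact (hC.comp_spec g.2.1 f.2.1 (g.2.2.1.trans f.2.2.2.symm)).2

/-- The arrow given by an element of the set of morphisms. -/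
theorem CatData.IsCat.exists_hom (hC : C.IsCat) {x : Superstructure S} (hx : x ∈ C.mor) :
    ∃ (X Y : hC.Obj) (f : X ⟶ Y), Subtype.val f = x :=
  ⟨⟨app C.src x, app_mem hC.isFun_src hx, hC.src_src x hx⟩,
    ⟨app C.tgt x, app_mem hC.isFun_tgt hx, hC.src_tgt x hx⟩, ⟨x, hx, rfl, rfl⟩, rfl⟩

/-- An arrow is determined by the underlying element of the superstructure, which has a source and a
target. -/
theorem CatData.IsCat.arrows_ext (hC : C.IsCat) {X Y X' Y' : hC.Obj} {f : X ⟶ Y} {f' : X' ⟶ Y'}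
    (h : Subtype.val f = Subtype.val f') : (⟨X, Y, f⟩ : Arrows hC.Obj) = ⟨X', Y', f'⟩ := by
  obtain rfl : X = X' := Subtype.ext
    (f.2.2.1.symm.trans ((congrArg (app C.src) h).trans f'.2.2.1))
  obtain rfl : Y = Y' := Subtype.ext
    (f.2.2.2.symm.trans ((congrArg (app C.tgt) h).trans f'.2.2.2))
  obtain rfl : f = f' := Subtype.ext h
  rfl

/-- Every functor between categories inside the superstructure lies in the superstructure. -/
theorem exists_isFunctor (hC : C.IsCat) (hC' : C'.IsCat) (F : hC.Obj ⥤ hC'.Obj) :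
    ∃ (q : Superstructure S) (hq : IsFunctor C C' q), hq.functor hC hC' = F := by
  let v : Arrows hC.Obj → Superstructure S := fun a => Subtype.val a.2.2
  have hv : Function.Injective v := fun ⟨_, _, _⟩ ⟨_, _, _⟩ h => hC.arrows_ext h
  obtain ⟨q, hq, hqc⟩ := exists_isFun (A := C.mor) (B := C'.mor)
    (Function.extend v (fun a => Subtype.val (F.map a.2.2)) fun _ => empty) (by
      intro x hx
      obtain ⟨X, Y, f, rfl⟩ := hC.exists_hom hx
      rw [show Subtype.val f = v ⟨X, Y, f⟩ from rfl, hv.extend_apply]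
      exact (F.map f).2.1)
  have hq' : ∀ {X Y : hC.Obj} (f : X ⟶ Y), app q (Subtype.val f) = Subtype.val (F.map f) :=
    fun {X Y} f => (hqc _ f.2.1).trans (hv.extend_apply _ _ ⟨X, Y, f⟩)
  have hid : ∀ X : hC.Obj, app q X.1 = (F.obj X).1 := fun X =>
    (hq' (𝟙 X)).trans (congrArg Subtype.val (F.map_id X))
  have hF : IsFunctor C C' q := by
    refine ⟨hq, fun x hx => ?_, fun x hx => ?_, fun x hx y hy z hz h => ?_⟩
    · obtain ⟨X, Y, f, rfl⟩ := hC.exists_hom hx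
      rw [hq' f, f.2.2.1]
      exact (hid X).trans (F.map f).2.2.1.symm
    · obtain ⟨X, Y, f, rfl⟩ := hC.exists_hom hx
      rw [hq' f, f.2.2.2]
      exact (hid Y).trans (F.map f).2.2.2.symm
    · obtain ⟨h₁, h₂, h₃⟩ := hC.comp_ends x hx y hy z hz h
      obtain ⟨X, Y, f, rfl⟩ := hC.exists_hom hy
      let Z : hC.Obj := ⟨app C.tgt x, app_mem hC.isFun_tgt hx, hC.src_tgt x hx⟩
      let g : Y ⟶ Z := ⟨x, hx, h₁.trans f.2.2.2, rfl⟩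
      let k : X ⟶ Z := ⟨z, hz, h₃.symm.trans f.2.2.1, h₂.symm⟩
      have e : f ≫ g = k := (hC.triple_mem_comp_iff f g k).1 h
      have e' := (hC'.triple_mem_comp_iff (F.map f) (F.map g) (F.map k)).2
        (by rw [← F.map_comp, e])
      rwa [← hq' f, ← hq' g, ← hq' k] at e'
  exact ⟨q, hF, functor_ext_val fun f => hq' f⟩

/-- Every triangulated structure on a category inside the superstructure lies in the
superstructure. -/
theorem exists_triData (hC : C.IsCat) [Preadditive hC.Obj] (t : Triangles hC.Obj)
    (ht : t.IsTriangulated) : ∃ (A s R : Superstructure S) (hs : IsFunctor C C s),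
      TriData.IsTriangulated ⟨C, A, s, R⟩ ∧ hC.triangles hs R = t ∧
        ∀ (X Y : hC.Obj) (f g k : X ⟶ Y), hC.rel A f g k ↔ f + g = k := by
  obtain ⟨s, hs, e⟩ := exists_isFunctor hC hC t.shift
  obtain ⟨F, d⟩ := t
  change _ = F at e
  subst e
  obtain ⟨R, hR, hRc⟩ := exists_isTernary C.mor (fun x y z => ∃ (X Y Z : hC.Obj) (f : X ⟶ Y)
    (g : Y ⟶ Z) (h : Z ⟶ (hs.functor hC hC).obj X), d f g h ∧ Subtype.val f = x ∧
      Subtype.val g = y ∧ Subtype.val h = z)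
  obtain ⟨A, hA, hAc⟩ := exists_isTernary C.mor (fun x y z => ∃ (X Y : hC.Obj) (f g : X ⟶ Y),
    Subtype.val f = x ∧ Subtype.val g = y ∧ Subtype.val (f + g) = z)
  have hAdd : ∀ (X Y : hC.Obj) (f g k : X ⟶ Y), hC.rel A f g k ↔ f + g = k := by
    intro X Y f g k
    refine (hAc _ f.2.1 _ g.2.1 _ k.2.1).trans ⟨?_, ?_⟩
    · rintro ⟨X', Y', f', g', e₁, e₂, e₃⟩
      cases hC.arrows_ext e₁
      obtain rfl : g' = g := Subtype.ext e₂
      exact Subtype.ext e₃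
    · rintro rfl
      exact ⟨X, Y, f, g, rfl, rfl, rfl⟩
  have htri : hC.triangles hs R = ⟨hs.functor hC hC, d⟩ := by
    refine congrArg (Triangles.mk _) ?_
    funext X Y Z f g h
    refine propext ((hRc _ f.2.1 _ g.2.1 _ h.2.1).trans ⟨?_, fun H =>
      ⟨X, Y, Z, f, g, h, H, rfl, rfl, rfl⟩⟩)
    rintro ⟨X', Y', Z', f', g', h', H, e₁, e₂, e₃⟩
    cases hC.arrows_ext e₁
    cases hC.arrows_ext e₂
    obtain rfl : h' = h := Subtype.ext e₃
    exact H
  refine ⟨A, s, R, hs, ⟨hC, hA, hs, hR, fun x hx y hy z hz h => ?_, inferInstance, hAdd, ?_⟩,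
    htri, hAdd⟩
  · obtain ⟨X, Y, Z, f, g, k, -, rfl, rfl, rfl⟩ := (hRc _ hx _ hy _ hz).1 h
    exact ⟨f.2.2.2.trans g.2.2.1.symm, g.2.2.2.trans k.2.2.1.symm,
      k.2.2.2.trans (congrArg (app s) f.2.2.1.symm)⟩
  · have h : (hC.triangles hs R).IsTriangulated := htri.symm ▸ ht
    exact h

end

section
variable {T D : TriData S}

theorem TriCat.isFractionLocalization_of_isStrictLocalization (T : TriCat.{u})
    (D : ObjectProperty T.Obj) [D.IsTriangulated] {E : Type u} [Category.{u} E] {L : T.Obj ⥤ E}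
    (h : IsStrictLocalization D.trW L) : IsFractionLocalization D.trW L :=
  h.isFractionLocalization

/-- The quotient by a thick subcategory exists inside the superstructure. -/
theorem IsThick.exists_isQuotient [Infinite S] (hD : IsThick T D) :
    ∃ (Q : TriData S) (q : Superstructure S), IsQuotient T D Q q := by
  have hT := hD.isTriangulated
  let P : ObjectProperty hT.triCat.Obj := TriData.objectsOf hT D
  have hP : P.IsTriangulated := hD.isTriangulated_objectsOf
  obtain ⟨n, c, hc, hn⟩ := exists_injective_arrows (hC := hT.isCat) (V := P.trW) (q := P.trW.Q)
    (hT.triCat.isFractionLocalization_of_isStrictLocalization P isStrictLocalization_Q)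
  obtain ⟨C, hC, K, L, h₁, h₂⟩ := exists_catData c hc hn
  obtain ⟨q, hq, e⟩ := exists_isFunctor hT.isCat hC (P.trW.Q ⋙ K)
  have hL : IsStrictLocalization P.trW (hq.functor hT.isCat hC) :=
    e ▸ isStrictLocalization_Q.comp_iso h₁ h₂
  obtain ⟨_, t, et, ht, hadd, hdist⟩ :=
    hT.triCat.exists_triangles_of_isStrictLocalization P hL
  obtain ⟨A, s, R, hs, hQ, rfl, hA⟩ := exists_triData hC t ht
  refine ⟨⟨C, A, s, R⟩, q, isQuotient_iff.2 ⟨hD, hQ, hq, ⟨et, ⟨?_, hdist⟩⟩, ?_⟩⟩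
  · refine (preservesAdd_iff hT hQ hq).1 fun X Y f g k h => (hA _ _ _ _ _).2 ?_
    have := (hT.add_iff f g k).1 h
    rw [← this]
    exact hadd.map_add.symm
  · have := hT.triCat.isFractionLocalization_of_isStrictLocalization P hL
    have e := hT.triCat.coneIn_eq_trW P
    exact (e ▸ this : IsFractionLocalization (hT.triCat.coneIn P) _)

end
end Enlarge

theorem mainTheorem11 {S W : Type u} [Infinite S] (ι : S ↪ W)
    (star : Superstructure S → Superstructure W) (hstar : IsEnlargement ι star) :
    (∀ T : TriData S, T.IsTriangulated → (T.enlarge star).IsTriangulated) ∧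
    (∀ (T T' : TriData S) (F : Superstructure S),
      IsStrictTriFunctor T T' F → IsStrictTriFunctor (T.enlarge star) (T'.enlarge star) (star F)) ∧
    (∀ (T T' : TriData S) (F θ : Superstructure S),
      IsTriFunctor T T' F θ → IsTriFunctor (T.enlarge star) (T'.enlarge star) (star F) (star θ)) ∧
    (∀ T D : TriData S, IsThick T D →
      IsThick (T.enlarge star) (D.enlarge star) ∧
      (∃ (Q : TriData S) (q : Superstructure S), IsQuotient T D Q q) ∧
      (∀ (Q : TriData S) (q : Superstructure S), IsQuotient T D Q q →
        IsQuotient (T.enlarge star) (D.enlarge star) (Q.enlarge star) (star q) ∧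
        IsCanonicallyIsoToQuotient (T.enlarge star) (D.enlarge star) (Q.enlarge star) (star q))) := by
  refine ⟨fun T h => h.enlarge hstar, fun T T' F h => h.enlarge hstar,
    fun T T' F θ h => h.enlarge hstar, fun T D h => ⟨h.enlarge hstar, h.exists_isQuotient,
      fun Q q hq => ⟨hq.enlarge hstar, (hq.enlarge hstar).isCanonicallyIsoToQuotient⟩⟩⟩
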